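/- Let $k$ be an algebraically closed field of characteristic $0$. Let $s_1<s_2<s_3$ be rational numbers and let $\Delta\subset\mathbb{R}^2$ be the triangle with side slopes $s_1,s_2,s_3$ that has $(0,0)$ as a vertex and $(0,1)$ in the interior of the opposite side, i.e. $\Delta=\{(x,y): y\ge s_1x,\ y\ge s_3x,\ y\le 1+s_2x\}$. Let $X_\Delta$ be the projective toric surface over $k$ whose fan is the normal fan of $\Delta$ (equivalently $X_\Delta=\operatorname{Proj}\bigoplus_{m\ge 0}k[m\Delta\cap\mathbb{Z}^2]$), and let $X=\operatorname{Bl}_{t_0}X_\Delta$ be its blowup at the identity $t_0=(1,1)$ of the torus. Suppose that (1) $w=\dfrac{1}{s_2-s_1}+\dfrac{1}{s_3-s_2}<1$; and (2) with $n=|[s_1,s_2]\cap\mathbb{Z}|$, one has $|(n-1)[s_2,s_3]\cap\mathbb{Z}|=n$ and $ns_2\notin\mathbb{Z}$. Then $X$ does not have a finitely generated Cox ring: for no Weil divisors $D_1,\dots,D_r$ on $X$ whose classes span $\operatorname{Cl}(X)\otimes\mathbb{Q}$ is the algebra $\bigoplus_{(m_1,\dots,m_r)\in\mathbb{Z}^r}H^0(X,\mathcal{O}_X(m_1D_1+\cdots+m_rD_r))$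 finitely generated over $k$. -/

import Mathlib

open AlgebraicGeometry CategoryTheory Order
open scoped TensorProduct Pointwise

universe u

noncomputable section

/-! ### Weil divisors, class group and Cox rings -/

section CoxRing

variable (X : Scheme.{u}) [IsIntegral X] [IsLocallyNoetherian X]

/-- Prime divisors of `X`, given by their generic points: the points of codimension one. -/
abbrev PrimeDivisor : Type u := {x : X // coheight x = 1}

/-- Weil divisors of a Noetherian integral scheme: the free abelian group on prime divisors. -/
abbrev WeilDivisor : Type u := PrimeDivisor X →₀ ℤ

variable {X}

/-- `D` is the divisor of the nonzero rational function `f`. -/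
def IsDivisorOf (D : WeilDivisor X) (f : X.functionField) : Prop :=
  f ≠ 0 ∧ ∀ P : PrimeDivisor X, D P = Scheme.ord f P.1

variable (X) in
/-- The divisor class group `Cl(X)`. (Divisors of rational functions form a group, as
`div (fg) = div f + div g`.) -/
abbrev WeilClassGroup : Type u :=
  WeilDivisor X ⧸ AddSubgroup.closure {D : WeilDivisor X | ∃ f, IsDivisorOf D f}

/-- `H⁰(X, 𝒪_X(D))`, as a set of rational functions: `0`, and all `f ≠ 0` with
`div f + D ≥ 0`. -/
def divisorSections (D : WeilDivisor X) : Set X.functionField :=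
  {f | f ≠ 0 → ∀ P : PrimeDivisor X, 0 ≤ Scheme.ord f P.1 + D P}

/-- The `k`-algebra structure on the function field of a `k`-scheme `p : X ⟶ Spec k`. -/
abbrev functionFieldAlgebra {k : Type u} [Field k] (p : X ⟶ Spec (.of k)) :
    Algebra k X.functionField :=
  ((Scheme.ΓSpecIso (.of k)).inv ≫ p.appTop ≫
    X.presheaf.germ ⊤ (genericPoint X) trivial).hom.toAlgebra

/-- The multigraded algebra `R(X; D₁, …, Dᵣ) = ⨁_{m ∈ ℤʳ} H⁰(X, 𝒪_X(m₁D₁ + ⋯ + mᵣDᵣ))`, realized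
inside the group algebra `K[ℤʳ] = K[t₁^{±1}, …, tᵣ^{±1}]` over the function field `K` as the
span of all `f t^m` with `f ∈ H⁰(X, 𝒪_X(m₁D₁ + ⋯ + mᵣDᵣ))`. On a normal `X` over `k` this span is
already a `k`-subalgebra, so that generating a subalgebra adds nothing. -/
def multisectionRing (k : Type u) [Field k] [Algebra k X.functionField] {r : ℕ}
    (D : Fin r → WeilDivisor X) :
    Subalgebra k (AddMonoidAlgebra X.functionField (Fin r → ℤ)) :=
  Algebra.adjoin k {F | ∃ (m : Fin r → ℤ) (f : X.functionField),
    f ∈ divisorSections (∑ i, m i • D i) ∧ F = AddMonoidAlgebra.single m f}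

/-- The classes of `D₁, …, Dᵣ` span `Cl(X) ⊗ ℚ`. -/
def SpansRationalClassGroup {r : ℕ} (D : Fin r → WeilDivisor X) : Prop :=
  Submodule.span ℚ (Set.range fun i : Fin r =>
    ((1 : ℚ) ⊗ₜ[ℤ] (QuotientAddGroup.mk (D i) : WeilClassGroup X) :
      ℚ ⊗[ℤ] WeilClassGroup X)) = ⊤

/-- The `k`-scheme `p : X ⟶ Spec k` has a finitely generated Cox ring: for some Weil divisors
`D₁, …, Dᵣ` whose classes span `Cl(X) ⊗ ℚ`, the `k`-algebra `R(X; D₁, …, Dᵣ)` is finitely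
generated. -/
def HasFinitelyGeneratedCoxRing {k : Type u} [Field k] (p : X ⟶ Spec (.of k)) : Prop :=
  letI := functionFieldAlgebra p
  ∃ (r : ℕ) (D : Fin r → WeilDivisor X),
    SpansRationalClassGroup D ∧ (multisectionRing k D).FG

end CoxRing

/-! ### Blowups -/

/-- The inverse image ideal sheaf `g⁻¹I · 𝒪_Z` is invertible, i.e. it defines an effective Cartier
divisor: locally on `Z` it is generated by one nonzerodivisor. -/
def InverseImageIsInvertible {Y Z : Scheme.{u}} (I : Y.IdealSheafData) (g : Z ⟶ Y) : Prop :=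
  ∀ z : Z, ∃ (V : Y.affineOpens) (U : Z.affineOpens) (e : U.1 ≤ g ⁻¹ᵁ V.1),
    z ∈ U.1 ∧ ∃ a ∈ nonZeroDivisors Γ(Z, U.1),
      (I.ideal V).map (g.appLE V.1 U.1 e).hom = Ideal.span {a}

/-- `π : X ⟶ Y` is the blowup of `Y` along the ideal sheaf `I`: it is universal (terminal) among
the morphisms to `Y` that make the inverse image of `I` invertible. -/
structure IsBlowup {X Y : Scheme.{u}} (π : X ⟶ Y) (I : Y.IdealSheafData) : Prop where
  invertible : InverseImageIsInvertible I π
  existsUnique_lift : ∀ {Z : Scheme.{u}} (g : Z ⟶ Y), InverseImageIsInvertible I g →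
    ∃! h : Z ⟶ X, h ≫ π = g

/-- The ideal sheaf of (the closure of) a point, with its reduced structure. -/
def pointIdeal {Y : Scheme.{u}} (y : Y) : Y.IdealSheafData :=
  Scheme.IdealSheafData.vanishingIdeal (TopologicalSpace.Closeds.closure {y})

/-! ### The triangle and its toric surface -/

/-- The triangle `Δ` with side slopes `s₁ < s₂ < s₃`, with the vertex `(0,0)`, and with `(0,1)` in the
interior of the opposite side. That side has slope `s₂`, and the sides through `(0,0)` have slopes
`s₁` (to the left) and `s₃` (to the right). -/
def triangle (s₁ s₂ s₃ : ℚ) : Set (ℚ × ℚ) :=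
  {p | s₁ * p.1 ≤ p.2 ∧ s₃ * p.1 ≤ p.2 ∧ p.2 ≤ 1 + s₂ * p.1}

theorem convex_triangle (s₁ s₂ s₃ : ℚ) : Convex ℚ (triangle s₁ s₂ s₃) := by
  rintro ⟨a, b⟩ ⟨h1, h2, h3⟩ ⟨a', b'⟩ ⟨h1', h2', h3'⟩ t t' ht ht' htt'
  simp only [triangle, Set.mem_ofPred_eq, Prod.smul_mk, Prod.mk_add_mk, smul_eq_mul] at *
  obtain rfl : t' = 1 - t := by linarith
  refine ⟨?_, ?_, ?_⟩ <;> nlinarith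

/-- The triangle is the convex hull of its vertices, of which the nonzero ones lie on the lines
through `(0,0)` with slopes `s₁`, `s₃` and on the line through `(0,1)` with slope `s₂`. -/
theorem triangle_eq_convexHull {s₁ s₂ s₃ : ℚ} (h₁₂ : s₁ < s₂) (h₂₃ : s₂ < s₃) :
    triangle s₁ s₂ s₃ = convexHull ℚ {((0 : ℚ), (0 : ℚ)),
      (-1 / (s₂ - s₁), s₁ * (-1 / (s₂ - s₁))), (1 / (s₃ - s₂), s₃ * (1 / (s₃ - s₂)))} := by
  have h1 : 0 < s₂ - s₁ := sub_pos.2 h₁₂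
  have h2 : 0 < s₃ - s₂ := sub_pos.2 h₂₃
  apply Set.Subset.antisymm
  · rintro ⟨x, y⟩ ⟨hx1, hx3, hx2⟩
    simp only at hx1 hx3 hx2
    have h3 : 0 < s₃ - s₁ := by linarith
    have key := (convex_convexHull ℚ {((0 : ℚ), (0 : ℚ)),
      (-1 / (s₂ - s₁), s₁ * (-1 / (s₂ - s₁))), (1 / (s₃ - s₂), s₃ * (1 / (s₃ - s₂)))}).sum_mem
      (t := Finset.univ) (w := ![1 + s₂ * x - y, (y - s₃ * x) * (s₂ - s₁) / (s₃ - s₁),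
        (y - s₁ * x) * (s₃ - s₂) / (s₃ - s₁)])
      (z := ![(0, 0), (-1 / (s₂ - s₁), s₁ * (-1 / (s₂ - s₁))),
        (1 / (s₃ - s₂), s₃ * (1 / (s₃ - s₂)))]) ?_ ?_ ?_
    · convert key using 1
      simp only [Fin.sum_univ_three, Matrix.cons_val_zero, Matrix.cons_val_one, Matrix.cons_val,
        Prod.smul_mk, Prod.mk_add_mk, smul_eq_mul, Prod.mk.injEq]
      constructor <;> field_simp <;> ring
    · intro i _
      fin_cases i
      · simpa using by linarith
      · exact div_nonneg (mul_nonneg (by linarith) h1.le) h3.le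
      · exact div_nonneg (mul_nonneg (by linarith) h2.le) h3.le
    · simp only [Fin.sum_univ_three, Matrix.cons_val_zero, Matrix.cons_val_one, Matrix.cons_val]
      field_simp
      ring
    · intro i _
      apply subset_convexHull
      fin_cases i <;> simp
  · refine convexHull_min ?_ (convex_triangle s₁ s₂ s₃)
    have e1 : (s₂ - s₁) * (1 / (s₂ - s₁)) = 1 := by field_simp
    have e2 : (s₃ - s₂) * (1 / (s₃ - s₂)) = 1 := by field_simp
    have p1 : 0 < 1 / (s₂ - s₁) := by positivity
    have p2 : 0 < 1 / (s₃ - s₂) := by positivity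
    have e3 : -1 / (s₂ - s₁) = - (1 / (s₂ - s₁)) := by ring
    rw [e3]
    set p := 1 / (s₂ - s₁)
    set q := 1 / (s₃ - s₂)
    rintro z (rfl | rfl | rfl) <;> simp only [triangle, Set.mem_ofPred_eq] <;>
      refine ⟨?_, ?_, ?_⟩ <;> nlinarith

/-- The lattice points `(m, a, b)` of the cone over `Δ`: those with `m ≥ 0` and
`(a, b) ∈ mΔ`. -/
def coneMonoid (s₁ s₂ s₃ : ℚ) : AddSubmonoid (ℕ × ℤ × ℤ) where
  carrier := {c | ((c.2.1 : ℚ), (c.2.2 : ℚ)) ∈ (c.1 : ℚ) • triangle s₁ s₂ s₃}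
  zero_mem' := ⟨(0, 0), by simp [triangle], by simp [Prod.ext_iff]⟩
  add_mem' := by
    rintro ⟨m, a, b⟩ ⟨m', a', b'⟩ h h'
    change ((a : ℚ), (b : ℚ)) ∈ (m : ℚ) • triangle s₁ s₂ s₃ at h
    change ((a' : ℚ), (b' : ℚ)) ∈ (m' : ℚ) • triangle s₁ s₂ s₃ at h'
    change (((a + a' : ℤ) : ℚ), ((b + b' : ℤ) : ℚ)) ∈ ((m + m' : ℕ) : ℚ) • triangle s₁ s₂ s₃
    have := Set.add_mem_add h h'
    rw [← (convex_triangle s₁ s₂ s₃).add_smul (by positivity) (by positivity)] at this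
    simpa using this

/-- The degree `(m, a, b) ↦ m` on the cone over `Δ`. -/
def coneDegree (s₁ s₂ s₃ : ℚ) : coneMonoid s₁ s₂ s₃ →+ ℕ :=
  (AddMonoidHom.fst ℕ (ℤ × ℤ)).comp (coneMonoid s₁ s₂ s₃).subtype

section Toric

variable (k : Type u) [Field k] (s₁ s₂ s₃ : ℚ)

/-- The grading of the semigroup algebra of the cone over `Δ`. Its piece of degree `m` has as a
basis the monomials `x^a y^b` with `(a, b) ∈ mΔ ∩ ℤ²`. -/
abbrev coneGrading : ℕ → Submodule k (AddMonoidAlgebra k (coneMonoid s₁ s₂ s₃)) :=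
  AddMonoidAlgebra.gradeBy k (coneDegree s₁ s₂ s₃)

/-- The projective toric surface `X_Δ = Proj ⨁_{m ≥ 0} k[mΔ ∩ ℤ²]` of the rational polygon `Δ`.
Its affine charts at the vertices of `Δ` are the spectra of the semigroup algebras of the duals of
the maximal cones of the normal fan of `Δ`. -/
abbrev toricSurface : Scheme.{u} := Proj (coneGrading k s₁ s₂ s₃)

/-- The structure morphism of `X_Δ` over `k`. -/
def toricSurfaceOver : toricSurface k s₁ s₂ s₃ ⟶ Spec (.of k) :=
  Proj.toSpecZero (coneGrading k s₁ s₂ s₃) ≫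
    Spec.map (CommRingCat.ofHom (algebraMap k (coneGrading k s₁ s₂ s₃ 0)))

/-- The graded homomorphism `⨁ k[mΔ ∩ ℤ²] → k[t]` that evaluates polynomials at `x = y = 1`: it
sends a monomial `x^a y^b` of degree `m` to `t^m`. -/
def evalOne : coneGrading k s₁ s₂ s₃ →+*ᵍ AddMonoidAlgebra.grade k (M := ℕ) where
  __ := AddMonoidAlgebra.mapDomainRingHom k (coneDegree s₁ s₂ s₃)
  map_mem {m f} hf := by
    classical
    intro j hj
    obtain ⟨c, hc, rfl⟩ := Finset.mem_image.1 (Finsupp.mapDomain_support hj)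
    exact hf c hc

/-- The identity `t₀ = (1,1)` of the torus in `X_Δ`: the homogeneous prime ideal generated by the
`f ∈ k[mΔ ∩ ℤ²]`, `m ≥ 0`, with `f(1,1) = 0`. -/
def torusIdentity : toricSurface k s₁ s₂ s₃ where
  asHomogeneousIdeal := (⊥ : HomogeneousIdeal (AddMonoidAlgebra.grade k (M := ℕ))).comap
    (evalOne k s₁ s₂ s₃)
  isPrime := (Ideal.isPrime_bot (α := AddMonoidAlgebra k ℕ)).comap (evalOne k s₁ s₂ s₃)
  not_irrelevant_le h := by
    have h0 : ((1, 0, 0) : ℕ × ℤ × ℤ) ∈ coneMonoid s₁ s₂ s₃ :=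
      ⟨(0, 0), by simp [triangle], by simp⟩
    have h1 : AddMonoidAlgebra.single (⟨_, h0⟩ : coneMonoid s₁ s₂ s₃) (1 : k) ∈
        HomogeneousIdeal.irrelevant (coneGrading k s₁ s₂ s₃) :=
      HomogeneousIdeal.mem_irrelevant_of_mem _ one_pos
        (AddMonoidAlgebra.single_mem_gradeBy (coneDegree s₁ s₂ s₃) _ _)
    have h2 : AddMonoidAlgebra.mapDomainRingHom k (coneDegree s₁ s₂ s₃)
        (AddMonoidAlgebra.single (⟨_, h0⟩ : coneMonoid s₁ s₂ s₃) (1 : k)) = 0 := h h1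
    simp at h2

end Toric

end

/-! Let `H` be the divisor of the side opposite the vertex, scaled so that sections of `aH` are the
Laurent polynomials supported in `aΔ`; let `E` be the exceptional curve and `C` the closure of `y =
1`, of class `H - E`. Since `H²` is twice the area of `Δ`, which is `w`, one has `C² = w - 1 < 0`,
and `aH - bE` is orthogonal to `C` exactly when `b = wa`. The proof plays two facts against each
other.

(i) On the ray `b = wa` every section with `b` large vanishes along `C`
(`columnSum_eq_zero_of_orthogonal`). In characteristic zero, `F` vanishes to order `M` at `(1,1)`
iff its coefficients pair to zero with all polynomial functions of degree `< M` on the lattice. For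
`M = wa` the triangle `aΔ` meets at most `M + 1` columns, so `F(x,1)` is a multiple of `x^A
(x-1)^M`. If it is nonzero, both extreme columns occur, and each is a single lattice vertex. The
counting hypotheses provide a polynomial of degree `n` (in an easy case, of degree one) that
vanishes on the support in one more column than its degree, but not at the left vertex; this uses `n
s₂ ∉ ℤ`. Linear factors that kill the remaining columns bring the degree to `M - 1`, and the pairing
isolates the coefficient at the left vertex, which is therefore zero: a contradiction. Passing to
powers, a section not divisible by `y - 1` has slope `b/a < w` unless it is constant
(`order_lt_of_not_dvd`).

(ii) Sections not divisible by `y - 1` exist with slopes arbitrarily close to `w`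
(`exists_section_columnSum_ne_zero`), by duality and a count of columns that uses `w < 1`.

If a Cox ring were finitely generated, take homogeneous generators and rational functions `u`, `v`
that make multiples of `H` and `-E` equivalent to combinations of the `D i`. The monomials in these
of total degree zero form a finitely generated monoid. Non-divisibility by `y - 1` passes to
factors, so the finitely many generators bound all slopes in (i) by some `w - δ`
(`AddSubmonoid.FG.exists_slope_le`). A section from (ii) of larger slope is a combination of such
monomials, one of which is not divisible by `y - 1`: a contradiction.

The rest identifies sections on `X` with Laurent polynomials (`exists_divisors`). The blowup is
known only through its universal property, which is tested on spectra of local rings and on the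
family of arcs `x = 1 + s`, `y = 1 + ts` over `k(t)`, whose order in `s` is the multiplicity at
`(1,1)`. -/

noncomputable section

/-! ### Polynomial functions on the plane lattice -/

section PolyFun

variable (k : Type u) [Field k] [CharZero k]

/-- The functions on `ℤ²` that are given by polynomials of total degree at most `d`, spanned by
products of binomial coefficients. -/
def polyFun (d : ℕ) : Submodule k (ℤ × ℤ → k) :=
  Submodule.span k {p | ∃ i j : ℕ, i + j ≤ d ∧
    p = fun v : ℤ × ℤ => Ring.choose (v.1 : k) i * Ring.choose (v.2 : k) j}

variable {k}

theorem polyFun_mono {d e : ℕ} (h : d ≤ e) : polyFun k d ≤ polyFun k e :=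
  Submodule.span_mono fun _ ⟨i, j, hij, hp⟩ => ⟨i, j, hij.trans h, hp⟩

theorem one_mem_polyFun : (1 : ℤ × ℤ → k) ∈ polyFun k 0 :=
  Submodule.subset_span ⟨0, 0, le_rfl, by ext; simp⟩

theorem descPochhammer_eval_eq_factorial_mul_choose (r : k) (j : ℕ) :
    (descPochhammer k j).eval r = j.factorial * Ring.choose r j := by
  have := Ring.descPochhammer_eq_factorial_smul_choose r j
  rw [nsmul_eq_mul] at this
  rw [← this, ← descPochhammer_map (Int.castRingHom k), Polynomial.eval_map,
    ← Polynomial.aeval_eq_smeval, Polynomial.aeval_def]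
  rfl

/-- This makes the span of binomial products stable under multiplication by coordinates, at the cost
of one degree. -/
theorem mul_choose (r : k) (i : ℕ) :
    r * Ring.choose r i = (i + 1) * Ring.choose r (i + 1) + i * Ring.choose r i := by
  have h := descPochhammer_succ_eval i r
  rw [descPochhammer_eval_eq_factorial_mul_choose, descPochhammer_eval_eq_factorial_mul_choose,
    Nat.factorial_succ] at h
  have hi : (i.factorial : k) ≠ 0 := by exact_mod_cast i.factorial_ne_zero
  apply mul_left_cancel₀ hi
  push_cast at h
  linear_combination -h

theorem fst_mul_mem_polyFun {d : ℕ} {p : ℤ × ℤ → k} (hp : p ∈ polyFun k d) :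
    (fun v => (v.1 : k) * p v) ∈ polyFun k (d + 1) := by
  induction hp using Submodule.span_induction with
  | mem p hp =>
    obtain ⟨i, j, hij, rfl⟩ := hp
    have : (fun v : ℤ × ℤ => (v.1 : k) * (Ring.choose (v.1 : k) i * Ring.choose (v.2 : k) j)) =
        ((i : k) + 1) • (fun v : ℤ × ℤ => Ring.choose (v.1 : k) (i + 1) * Ring.choose (v.2 : k) j) +
        (i : k) • (fun v : ℤ × ℤ => Ring.choose (v.1 : k) i * Ring.choose (v.2 : k) j) := by
      ext v
      simp only [Pi.add_apply, Pi.smul_apply, smul_eq_mul]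
      rw [← mul_assoc, mul_choose]
      ring
    rw [this]
    exact add_mem (Submodule.smul_mem _ _ (Submodule.subset_span ⟨i + 1, j, by omega, rfl⟩))
      (Submodule.smul_mem _ _ (Submodule.subset_span ⟨i, j, by omega, rfl⟩))
  | zero => simpa using! zero_mem _
  | add p q _ _ hp hq => simpa only [Pi.add_apply, mul_add] using! add_mem hp hq
  | smul c p _ hp =>
    have := Submodule.smul_mem _ c hp
    convert this using 1
    ext v
    simp only [Pi.smul_apply, smul_eq_mul]
    ring

theorem snd_mul_mem_polyFun {d : ℕ} {p : ℤ × ℤ → k} (hp : p ∈ polyFun k d) :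
    (fun v => (v.2 : k) * p v) ∈ polyFun k (d + 1) := by
  induction hp using Submodule.span_induction with
  | mem p hp =>
    obtain ⟨i, j, hij, rfl⟩ := hp
    have : (fun v : ℤ × ℤ => (v.2 : k) * (Ring.choose (v.1 : k) i * Ring.choose (v.2 : k) j)) =
        ((j : k) + 1) • (fun v : ℤ × ℤ => Ring.choose (v.1 : k) i * Ring.choose (v.2 : k) (j + 1)) +
        (j : k) • (fun v : ℤ × ℤ => Ring.choose (v.1 : k) i * Ring.choose (v.2 : k) j) := by
      ext v
      simp only [Pi.add_apply, Pi.smul_apply, smul_eq_mul]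
      rw [mul_left_comm, mul_choose]
      ring
    rw [this]
    exact add_mem (Submodule.smul_mem _ _ (Submodule.subset_span ⟨i, j + 1, by omega, rfl⟩))
      (Submodule.smul_mem _ _ (Submodule.subset_span ⟨i, j, by omega, rfl⟩))
  | zero => simpa using! zero_mem _
  | add p q _ _ hp hq => simpa only [Pi.add_apply, mul_add] using! add_mem hp hq
  | smul c p _ hp =>
    have := Submodule.smul_mem _ c hp
    convert this using 1
    ext v
    simp only [Pi.smul_apply, smul_eq_mul]
    ring

theorem affine_mul_mem_polyFun {d : ℕ} {p : ℤ × ℤ → k} (hp : p ∈ polyFun k d) (a b c : k) :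
    (fun v => (a * v.1 + b * v.2 + c) * p v) ∈ polyFun k (d + 1) := by
  have := add_mem (add_mem (Submodule.smul_mem _ a (fst_mul_mem_polyFun hp))
    (Submodule.smul_mem _ b (snd_mul_mem_polyFun hp)))
    (Submodule.smul_mem _ c (polyFun_mono d.le_succ hp))
  convert this using 1
  ext v
  simp only [Pi.add_apply, Pi.smul_apply, smul_eq_mul]
  ring

theorem prod_affine_mul_mem_polyFun {ι : Type*} (s : Finset ι) {d : ℕ} {p : ℤ × ℤ → k}
    (hp : p ∈ polyFun k d) (a b c : ι → k) :
    (fun v => (∏ i ∈ s, (a i * v.1 + b i * v.2 + c i)) * p v) ∈ polyFun k (d + s.card) := by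
  classical
  induction s using Finset.induction_on with
  | empty => simpa using hp
  | insert i s hi ih =>
    rw [Finset.card_insert_of_notMem hi, ← add_assoc]
    simpa only [Finset.prod_insert hi, mul_assoc] using affine_mul_mem_polyFun ih (a i) (b i) (c i)

/-- A nonzero function with values in `k` on a finite set of lattice points is detected by
polynomial functions; here, a polynomial function that vanishes on `s` except at `v₀`. -/
theorem exists_polyFun_separating (s : Finset (ℤ × ℤ)) (v₀ : ℤ × ℤ) :
    ∃ d, ∃ p ∈ polyFun k d, p v₀ ≠ 0 ∧ ∀ v ∈ s, v ≠ v₀ → p v = 0 := by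
  classical
  have key (v : ℤ × ℤ) : ∃ a b c : k, v ≠ v₀ →
      a * v.1 + b * v.2 + c = 0 ∧ a * v₀.1 + b * v₀.2 + c ≠ 0 := by
    by_cases h : v.1 = v₀.1
    · refine ⟨0, 1, -v.2, fun hv => ⟨by ring, fun h0 => hv (Prod.ext h ?_)⟩⟩
      have : (v₀.2 : k) = v.2 := by linear_combination h0
      exact_mod_cast this.symm
    · refine ⟨1, 0, -v.1, fun hv => ⟨by ring, fun h0 => h ?_⟩⟩
      have : (v₀.1 : k) = v.1 := by linear_combination h0
      exact_mod_cast this.symm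
  choose a b c habc using key
  refine ⟨_, _, prod_affine_mul_mem_polyFun (s.erase v₀) one_mem_polyFun a b c, ?_, ?_⟩
  · simp only [Pi.one_apply, mul_one]
    exact Finset.prod_ne_zero_iff.2 fun v hv => (habc v (Finset.ne_of_mem_erase hv)).2
  · intro v hv hne
    simp only [Pi.one_apply, mul_one]
    exact Finset.prod_eq_zero (Finset.mem_erase.2 ⟨hne, hv⟩) (habc v hne).1

end PolyFun

/-! ### Orders of vanishing at the identity of the torus -/

section VanishingOrder

variable {k : Type u} [Field k]

/-- The pairing of a Laurent polynomial `∑ c_v x^v` with a function `p` on the lattice: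
`∑ c_v p(v)`. -/
def pairing (p : ℤ × ℤ → k) : AddMonoidAlgebra k (ℤ × ℤ) →+ k where
  toFun F := F.coeff.sum fun v c => c * p v
  map_zero' := by simp
  map_add' F G := by
    classical
    rw [AddMonoidAlgebra.coeff_add]
    exact Finsupp.sum_add_index' (by simp) (by intros; ring)

theorem pairing_apply (p : ℤ × ℤ → k) (F : AddMonoidAlgebra k (ℤ × ℤ)) :
    pairing p F = ∑ v ∈ F.coeff.support, F.coeff v * p v := rfl

theorem pairing_single (p : ℤ × ℤ → k) (v : ℤ × ℤ) (c : k) :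
    pairing p (AddMonoidAlgebra.single v c) = c * p v := by
  exact Finsupp.sum_single_index (h := fun v c => c * p v) (zero_mul _)

theorem pairing_congr {p q : ℤ × ℤ → k} {F : AddMonoidAlgebra k (ℤ × ℤ)}
    (h : ∀ v ∈ F.coeff.support, p v = q v) : pairing p F = pairing q F :=
  Finset.sum_congr rfl fun v hv => congrArg (F.coeff v * ·) (h v hv)

theorem pairing_add_left (p q : ℤ × ℤ → k) (F : AddMonoidAlgebra k (ℤ × ℤ)) :
    pairing (p + q) F = pairing p F + pairing q F := by
  simp [pairing_apply, mul_add, Finset.sum_add_distrib]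

theorem pairing_smul_left (c : k) (p : ℤ × ℤ → k) (F : AddMonoidAlgebra k (ℤ × ℤ)) :
    pairing (c • p) F = c * pairing p F := by
  simp [pairing_apply, Finset.mul_sum, mul_left_comm]

/-- The Laurent polynomial `F` vanishes to order at least `b` at `(1,1)`, in terms of its divided
derivatives. -/
def VanishesToOrder (b : ℕ) (F : AddMonoidAlgebra k (ℤ × ℤ)) [CharZero k] : Prop :=
  ∀ i j : ℕ, i + j < b →
    pairing (fun v : ℤ × ℤ => Ring.choose (v.1 : k) i * Ring.choose (v.2 : k) j) F = 0

theorem VanishesToOrder.pairing_eq_zero [CharZero k] {b : ℕ} {F : AddMonoidAlgebra k (ℤ × ℤ)}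
    (hF : VanishesToOrder b F) {d : ℕ} (hd : d < b) {p : ℤ × ℤ → k} (hp : p ∈ polyFun k d) :
    pairing p F = 0 := by
  induction hp using Submodule.span_induction with
  | mem p hp =>
    obtain ⟨i, j, hij, rfl⟩ := hp
    exact hF i j (by omega)
  | zero => simp [pairing_apply]
  | add p q _ _ hp hq => rw [pairing_add_left, hp, hq, add_zero]
  | smul c p _ hp => rw [pairing_smul_left, hp, mul_zero]

/-- A polynomial function that separates one point of the support from the others reads off the
coefficient there. -/
theorem eq_zero_of_forall_vanishesToOrder [CharZero k] {F : AddMonoidAlgebra k (ℤ × ℤ)}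
    (hF : ∀ b, VanishesToOrder b F) : F = 0 := by
  by_contra h
  have h' : F.coeff ≠ 0 := by simpa using h
  obtain ⟨v₀, hv₀⟩ := Finsupp.support_nonempty_iff.2 h'
  obtain ⟨d, p, hp, hp0, hpv⟩ := exists_polyFun_separating (k := k) F.coeff.support v₀
  have := (hF (d + 1)).pairing_eq_zero d.lt_succ_self hp
  rw [pairing_apply, Finset.sum_eq_single_of_mem v₀ hv₀
    (fun v hv hne => by rw [hpv v hv hne, mul_zero])] at this
  exact (mul_ne_zero (Finsupp.mem_support_iff.1 hv₀) hp0) this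

/-- The sum of the coefficients of `F` in the column `x = x₀`, i.e. the coefficient of `x^{x₀}` in
`F(x, 1)`. -/
def columnSum (x₀ : ℤ) (F : AddMonoidAlgebra k (ℤ × ℤ)) : k :=
  pairing (fun v => if v.1 = x₀ then 1 else 0) F

theorem exists_mem_support_of_columnSum_ne_zero {x₀ : ℤ} {F : AddMonoidAlgebra k (ℤ × ℤ)}
    (h : columnSum x₀ F ≠ 0) : ∃ v ∈ F.coeff.support, v.1 = x₀ := by
  contrapose! h
  exact Finset.sum_eq_zero fun v hv => by simp [h v hv]

/-- A Laurent polynomial with at most `M + 1` columns that vanishes to order `M` restricts to a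
multiple of `x^A (x - 1)^M` on the curve `y = 1`: if one column sum vanishes, all do. -/
theorem columnSum_eq_zero_of_columnSum_eq_zero [CharZero k] {M : ℕ}
    {F : AddMonoidAlgebra k (ℤ × ℤ)} (hF : VanishesToOrder M F) {A : ℤ}
    (hA : ∀ v ∈ F.coeff.support, v.1 ∈ Finset.Icc A (A + M)) {x₁ : ℤ}
    (hx₁ : x₁ ∈ Finset.Icc A (A + M)) (h₁ : columnSum x₁ F = 0) (x : ℤ) : columnSum x F = 0 := by
  by_contra hx
  have hxx : x ≠ x₁ := fun h => hx (h ▸ h₁)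
  obtain ⟨v, hv, rfl⟩ := exists_mem_support_of_columnSum_ne_zero hx
  have hx' := hA v hv
  -- The `M - 1` columns other than the two in question: the product of the `x - i` over them has
  -- degree below `M`, so its pairing with `F` gives a relation between just two column sums.
  set s := ((Finset.Icc A (A + M)).erase v.1).erase x₁
  have hs : s.card + 2 = M + 1 := by
    have h1 := Finset.card_erase_add_one (Finset.mem_erase.2 ⟨hxx.symm, hx₁⟩)
    have h2 := Finset.card_erase_add_one hx'
    rw [Int.card_Icc] at h2
    change s.card + 1 = _ at h1
    omega
  have hp := prod_affine_mul_mem_polyFun s (one_mem_polyFun (k := k)) (fun _ => 1) (fun _ => 0)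
    (fun i => -(i : k))
  have h0 := hF.pairing_eq_zero (by omega) hp
  set q : ℤ → k := fun x => ∏ i ∈ s, ((x : k) - i)
  have h2 : pairing (q v.1 • (fun w : ℤ × ℤ => if w.1 = v.1 then (1 : k) else 0) +
      q x₁ • (fun w : ℤ × ℤ => if w.1 = x₁ then (1 : k) else 0)) F = 0 := by
    refine (pairing_congr fun w hw => ?_).trans h0
    have e : ∏ i ∈ s, (1 * (w.1 : k) + 0 * (w.2 : k) + -(i : k)) = q w.1 :=
      Finset.prod_congr rfl fun i _ => by ring
    simp only [Pi.add_apply, Pi.smul_apply, smul_eq_mul, Pi.one_apply, mul_one, e]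
    by_cases hw1 : w.1 = v.1
    · simp [hw1, hxx]
    by_cases hw2 : w.1 = x₁
    · simp [hw2, hxx.symm]
    · simp only [hw1, hw2, if_false, mul_zero, add_zero]
      refine (Finset.prod_eq_zero (Finset.mem_erase.2 ⟨hw2, Finset.mem_erase.2 ⟨hw1, hA w hw⟩⟩)
        ?_).symm
      exact sub_self (w.1 : k)
  rw [pairing_add_left, pairing_smul_left, pairing_smul_left] at h2
  change q v.1 * columnSum v.1 F + q x₁ * columnSum x₁ F = 0 at h2
  rw [h₁, mul_zero, add_zero] at h2
  refine mul_ne_zero (Finset.prod_ne_zero_iff.2 fun i hi => ?_) hx h2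
  rw [sub_ne_zero]
  have : i ≠ v.1 := Finset.ne_of_mem_erase (Finset.mem_of_mem_erase hi)
  exact_mod_cast this.symm

/-- If a polynomial function of degree `d` vanishes on `d + 1` columns of the support, then it
vanishes at the point of a column of only one point (unless that coefficient is zero). -/
theorem coeff_eq_zero_of_polyFun [CharZero k] {M : ℕ}
    {F : AddMonoidAlgebra k (ℤ × ℤ)} (hF : VanishesToOrder M F) {A : ℤ}
    (hA : ∀ v ∈ F.coeff.support, v.1 ∈ Finset.Icc A (A + M)) {d : ℕ} {p : ℤ × ℤ → k}
    (hp : p ∈ polyFun k d) {K : Finset ℤ} (hK : K ⊆ Finset.Icc A (A + M)) (hKd : K.card = d + 1)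
    (hpK : ∀ v ∈ F.coeff.support, v.1 ∈ K → p v = 0) {v₀ : ℤ × ℤ} (hv₀ : v₀.1 ∈ Finset.Icc A (A + M))
    (hv₀K : v₀.1 ∉ K)
    (hcol : ∀ v ∈ F.coeff.support, v.1 = v₀.1 → v = v₀) (hpv : p v₀ ≠ 0) : F.coeff v₀ = 0 := by
  -- `M - d - 1` columns remain outside `K` and the column of `v₀`; multiplying `p` by the linear
  -- forms that vanish on them gives degree `M - 1`, still below the order of vanishing.
  set s := (Finset.Icc A (A + M) \ K).erase v₀.1
  have hs : s.card + 1 + (d + 1) = M + 1 := by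
    have h1 := Finset.card_erase_add_one (Finset.mem_sdiff.2 ⟨hv₀, hv₀K⟩)
    have h2 := Finset.card_sdiff_add_card_eq_card hK
    rw [Int.card_Icc] at h2
    change s.card + 1 = _ at h1
    omega
  have hq := prod_affine_mul_mem_polyFun s hp (fun _ => 1) (fun _ => 0) (fun i => -(i : k))
  have h0 := hF.pairing_eq_zero (by omega) hq
  set q : ℤ → k := fun x => ∏ i ∈ s, ((x : k) - i)
  have e (w : ℤ × ℤ) : ∏ i ∈ s, (1 * (w.1 : k) + 0 * (w.2 : k) + -(i : k)) = q w.1 :=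
    Finset.prod_congr rfl fun i _ => by ring
  simp only [e] at h0
  by_contra hne
  have hv : v₀ ∈ F.coeff.support := Finsupp.mem_support_iff.2 hne
  rw [pairing_apply, Finset.sum_eq_single_of_mem v₀ hv] at h0
  · refine mul_ne_zero hne (mul_ne_zero (Finset.prod_ne_zero_iff.2 fun i hi => ?_) hpv) h0
    rw [sub_ne_zero]
    exact_mod_cast (Finset.ne_of_mem_erase hi).symm
  · intro w hw hwv
    by_cases hwK : w.1 ∈ K
    · simp [hpK w hw hwK]
    · have hw1 : w.1 ≠ v₀.1 := fun h => hwv (hcol w hw h)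
      have : q w.1 = 0 := Finset.prod_eq_zero (Finset.mem_erase.2 ⟨hw1,
        Finset.mem_sdiff.2 ⟨hA w hw, hwK⟩⟩) (sub_self (w.1 : k))
      simp [this]

end VanishingOrder

/-! ### Interpolation on a standard simplex -/

section Interpolation

variable {k : Type u} [Field k]

/-- The products `y (y-1) ⋯ (y-i+1) · (u-y) (u-y-1) ⋯ (u-y-(n-i)+1)`, for `i ≤ n` a basis of the
polynomials of degree `n` that vanish at the lattice points `0 ≤ y ≤ u < n`. -/
def simplexFun (n i : ℕ) (u y : k) : k :=
  (∏ j ∈ Finset.range i, (y - j)) * ∏ j ∈ Finset.range (n - i), (u - y - j)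

/-- Since `y + (u - y) < n = i + (n - i)`, either `y < i` or `u - y < n - i`, and one of the two
products has a zero factor. -/
theorem simplexFun_eq_zero {n i : ℕ} (hi : i ≤ n) {u y : ℕ} (hy : y ≤ u) (hu : u < n) :
    simplexFun n i (u : k) (y : k) = 0 := by
  by_cases h : y < i
  · exact mul_eq_zero_of_left (Finset.prod_eq_zero (Finset.mem_range.2 h) (sub_self _)) _
  · refine mul_eq_zero_of_right _ (Finset.prod_eq_zero (i := u - y) (Finset.mem_range.2 ?_) ?_)
    · omega
    · rw [Nat.cast_sub hy]; ring

theorem prod_range_sub_one_mul (y : k) (i : ℕ) :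
    y * ∏ j ∈ Finset.range i, (y - 1 - j) = (y - i) * ∏ j ∈ Finset.range i, (y - j) := by
  rw [mul_comm (y - i), ← Finset.prod_range_succ, Finset.prod_range_succ', mul_comm]
  congr 1
  · refine Finset.prod_congr rfl fun j _ => ?_
    push_cast; ring
  · simp

/-- The coefficients do not depend on `i`, so any combination of the `simplexFun n i` satisfies the
same relation; it transports values from column `u - 1` to column `u`. -/
theorem simplexFun_recurrence {n i : ℕ} (hi : i ≤ n) (u y : k) :
    y * simplexFun n i (u - 1) (y - 1) + (u - y) * simplexFun n i (u - 1) y =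
      (u - n) * simplexFun n i u y := by
  have h1 := prod_range_sub_one_mul y i
  have h2 := prod_range_sub_one_mul (u - y) (n - i)
  have e1 : ∏ j ∈ Finset.range (n - i), (u - 1 - (y - 1) - (j : k)) =
    ∏ j ∈ Finset.range (n - i), (u - y - (j : k)) := Finset.prod_congr rfl fun j _ => by ring
  have e2 : ∏ j ∈ Finset.range (n - i), (u - 1 - y - (j : k)) =
    ∏ j ∈ Finset.range (n - i), (u - y - 1 - (j : k)) := Finset.prod_congr rfl fun j _ => by ring
  rw [Nat.cast_sub hi] at h2
  unfold simplexFun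
  rw [e1, e2]
  linear_combination (∏ j ∈ Finset.range (n - i), (u - y - (j : k))) * h1 +
    (∏ j ∈ Finset.range i, (y - (j : k))) * h2

/-- `simplexFun n i u` as a polynomial in `y`. -/
def simplexPoly (n i : ℕ) (u : k) : Polynomial k :=
  (∏ j ∈ Finset.range i, (Polynomial.X - Polynomial.C (j : k))) *
    ∏ j ∈ Finset.range (n - i), (Polynomial.C (u - j) - Polynomial.X)

theorem eval_simplexPoly (n i : ℕ) (u y : k) :
    (simplexPoly n i u).eval y = simplexFun n i u y := by
  simp only [simplexPoly, simplexFun, Polynomial.eval_mul, Polynomial.eval_prod,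
    Polynomial.eval_sub, Polynomial.eval_X, Polynomial.eval_C]
  congr 1
  exact Finset.prod_congr rfl fun j _ => by ring

theorem degree_simplexPoly_lt {n i : ℕ} (hi : i ≤ n) (u : k) :
    (simplexPoly n i u).degree < ((n + 1 : ℕ) : WithBot ℕ) := by
  have h1 : (∏ j ∈ Finset.range i, (Polynomial.X - Polynomial.C (j : k))).natDegree ≤ i := by
    refine (Polynomial.natDegree_prod_le _ _).trans ?_
    simp only [Polynomial.natDegree_X_sub_C, Finset.sum_const, Finset.card_range, smul_eq_mul,
      mul_one, le_refl]
  have h2 : (∏ j ∈ Finset.range (n - i), (Polynomial.C (u - j) - Polynomial.X)).natDegree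
      ≤ n - i := by
    refine (Polynomial.natDegree_prod_le _ _).trans
      ((Finset.sum_le_card_nsmul _ _ 1 fun j _ => ?_).trans (by simp))
    refine (Polynomial.natDegree_sub_le _ _).trans ?_
    rw [Polynomial.natDegree_C, Polynomial.natDegree_X]
    decide
  have h3 : (simplexPoly n i u).natDegree ≤ n := by
    refine Polynomial.natDegree_mul_le.trans ?_
    omega
  exact lt_of_le_of_lt (Polynomial.degree_le_of_natDegree_le h3) (by exact_mod_cast n.lt_succ_self)

variable [CharZero k]

/-- On the column `u = m ≥ n`, the functions `simplexFun n i` span the polynomials of degree at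
most `n`. -/
theorem exists_sum_simplexPoly {n m : ℕ} (hm : n ≤ m) (h : Polynomial k)
    (hh : h.degree < ((n + 1 : ℕ) : WithBot ℕ)) :
    ∃ α : Fin (n + 1) → k, ∑ i : Fin (n + 1), α i • simplexPoly n i (m : k) = h := by
  let T : (Fin (n + 1) → k) →ₗ[k] Polynomial.degreeLT k (n + 1) :=
    Fintype.linearCombination k fun i => ⟨simplexPoly n i (m : k),
      Polynomial.mem_degreeLT.2 (degree_simplexPoly_lt (Nat.lt_succ_iff.1 i.2) _)⟩
  have hTv (α) : (T α : Polynomial k) = ∑ i : Fin (n + 1), α i • simplexPoly n i (m : k) := by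
    simp [T, Fintype.linearCombination_apply]
  have hinj : Function.Injective T := by
    rw [injective_iff_map_eq_zero]
    intro α hα
    have h0 : ∑ i : Fin (n + 1), α i • simplexPoly n i (m : k) = 0 := by rw [← hTv, hα]; rfl
    -- Triangularity: at `y = j` the terms with `i > j` vanish, those with `i < j` are already gone,
    -- and the `j`-th is nonzero because `m ≥ n`.
    have key : ∀ j : ℕ, ∀ hj : j < n + 1, α ⟨j, hj⟩ = 0 := by
      intro j
      induction j using Nat.strong_induction_on with
      | _ j ih =>
        intro hj
        have h1 := congrArg (Polynomial.eval (j : k)) h0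
        simp only [Polynomial.eval_finsetSum, Polynomial.eval_smul, eval_simplexPoly, smul_eq_mul,
          Polynomial.eval_zero] at h1
        rw [Finset.sum_eq_single_of_mem ⟨j, hj⟩ (Finset.mem_univ _)] at h1
        · refine (mul_eq_zero.1 h1).resolve_right (mul_ne_zero ?_ ?_) <;>
            refine Finset.prod_ne_zero_iff.2 fun l hl => ?_ <;> rw [Finset.mem_range] at hl <;>
            simp only at hl
          · rw [sub_ne_zero]; exact_mod_cast hl.ne'
          · have : ((m - j - l : ℕ) : k) = (m : k) - j - l := by
              rw [Nat.cast_sub (by omega), Nat.cast_sub (by omega)]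
            rw [← this]
            have : m - j - l ≠ 0 := by omega
            exact_mod_cast this
        · intro i _ hij
          rcases lt_or_gt_of_ne (fun h => hij (Fin.ext h) : (i : ℕ) ≠ j) with hlt | hgt
          · rw [ih i hlt i.2, zero_mul]
          · refine mul_eq_zero_of_right _ (mul_eq_zero_of_left ?_ _)
            exact Finset.prod_eq_zero (Finset.mem_range.2 hgt) (sub_self _)
    ext i
    exact key i i.2
  have hsurj := (LinearMap.injective_iff_surjective_of_finrank_eq_finrank (f := T) (by
    rw [Module.finrank_fin_fun, LinearEquiv.finrank_eq (Polynomial.degreeLTEquiv k (n + 1)),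
      Module.finrank_fin_fun])).1 hinj
  obtain ⟨α, hα⟩ := hsurj ⟨h, Polynomial.mem_degreeLT.2 hh⟩
  exact ⟨α, by rw [← hTv, hα]⟩

/-- There is a polynomial of degree `n` that vanishes on the standard simplex of size `n - 1` and
at the `n` points `Y + 1, …, Y + n` of the column `u = M - 1`; it does not vanish at `(M, Y)` unless
`n Y + M = 0`. -/
theorem exists_simplexFun_interpolation {n M : ℕ} (hM : n < M) (Y : ℤ) (hY : n * Y + M ≠ 0) :
    ∃ α : Fin (n + 1) → k,
      (∀ z : ℤ, Y + 1 ≤ z → z ≤ Y + n → ∑ i, α i * simplexFun n i ((M : k) - 1) z = 0) ∧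
      ∑ i, α i * simplexFun n i (M : k) Y ≠ 0 := by
  obtain ⟨α, hα⟩ := exists_sum_simplexPoly (k := k) (n := n) (m := M - 1) (by omega)
    (∏ i ∈ Finset.range n, (Polynomial.X - Polynomial.C ((Y : k) + 1 + i))) (by
      rw [Polynomial.degree_prod]
      simp only [Polynomial.degree_X_sub_C, Finset.sum_const, Finset.card_range, nsmul_eq_mul,
        mul_one]
      exact_mod_cast n.lt_succ_self)
  rw [Nat.cast_sub (by omega), Nat.cast_one] at hα
  have hev (z : k) : ∑ i, α i * simplexFun n i ((M : k) - 1) z =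
      ∏ i ∈ Finset.range n, (z - (Y + 1 + i)) := by
    have := congrArg (Polynomial.eval z) hα
    simpa [Polynomial.eval_finsetSum, eval_simplexPoly, Polynomial.eval_prod] using this
  refine ⟨α, fun z h1 h2 => ?_, fun h0 => ?_⟩
  · rw [hev]
    refine Finset.prod_eq_zero (i := (z - Y - 1).toNat) (Finset.mem_range.2 (by omega)) ?_
    have : (((z - Y - 1).toNat : ℤ) : k) = z - Y - 1 := by
      rw [Int.toNat_of_nonneg (by omega)]; push_cast; ring
    rw [Int.cast_natCast] at this
    rw [this]; ring
  -- On column `M - 1` the combination is `∏ (z - (Y + 1 + i))`, with values `(-1)^n n!` at `Y` and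
  -- `(-1)^n (n+1)!` at `Y - 1`. The recurrence makes `M - n` times the value at `(M, Y)` equal to
  -- `(-1)^n n! (nY + M)`.
  · have hrec : (Y : k) * ∑ i, α i * simplexFun n i ((M : k) - 1) (Y - 1) +
        ((M : k) - Y) * ∑ i, α i * simplexFun n i ((M : k) - 1) Y =
        ((M : k) - n) * ∑ i, α i * simplexFun n i (M : k) Y := by
      rw [Finset.mul_sum, Finset.mul_sum, Finset.mul_sum, ← Finset.sum_add_distrib]
      refine Finset.sum_congr rfl fun i _ => ?_
      linear_combination α i * simplexFun_recurrence (Nat.lt_succ_iff.1 i.2) (M : k) (Y : k)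
    rw [h0, mul_zero, hev, hev] at hrec
    have e1 : ∏ i ∈ Finset.range n, ((Y : k) - (Y + 1 + i)) = (-1) ^ n * n.factorial := by
      rw [← Finset.prod_range_add_one_eq_factorial, Nat.cast_prod]
      conv_rhs => rw [← Finset.card_range n, ← Finset.prod_const, Finset.card_range,
        ← Finset.prod_mul_distrib]
      exact Finset.prod_congr rfl fun i _ => by push_cast; ring
    have e2 : ∏ i ∈ Finset.range n, ((Y : k) - 1 - (Y + 1 + i)) =
        (-1) ^ n * (n.factorial * (n + 1)) := by
      have : ((n + 1).factorial : k) = n.factorial * (n + 1) := by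
        rw [Nat.factorial_succ]; push_cast; ring
      rw [← this, ← Finset.prod_range_add_one_eq_factorial, Finset.prod_range_succ', Nat.cast_mul,
        Nat.cast_prod]
      conv_rhs => rw [← Finset.card_range n, ← Finset.prod_const, Finset.card_range]
      rw [zero_add, Nat.cast_one, mul_one, ← Finset.prod_mul_distrib]
      exact Finset.prod_congr rfl fun i _ => by push_cast; ring
    rw [e1, e2] at hrec
    have h3 : ((-1) ^ n * (n.factorial : k)) * ((n * Y + M : ℤ) : k) = 0 := by
      push_cast
      linear_combination hrec
    refine mul_ne_zero (mul_ne_zero (pow_ne_zero _ (neg_ne_zero.2 one_ne_zero)) ?_) ?_ h3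
    · exact_mod_cast n.factorial_ne_zero
    · exact_mod_cast hY

end Interpolation

/-! ### Sections of the class orthogonal to the negative curve -/

section Orthogonal

/-- The lattice points of `aΔ`; there are none if `a < 0`. -/
def trianglePoints (s₁ s₂ s₃ : ℚ) (a : ℤ) : Set (ℤ × ℤ) :=
  {v | s₁ * v.1 ≤ v.2 ∧ s₃ * v.1 ≤ v.2 ∧ (v.2 : ℚ) ≤ a + s₂ * v.1}

theorem ncard_setOf_le_le (r s : ℚ) :
    {z : ℤ | r ≤ z ∧ (z : ℚ) ≤ s}.ncard = (⌊s⌋ + 1 - ⌈r⌉).toNat := by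
  have : {z : ℤ | r ≤ z ∧ (z : ℚ) ≤ s} = (Finset.Icc ⌈r⌉ ⌊s⌋ : Set ℤ) := by
    ext z
    simp [Int.ceil_le, Int.le_floor]
  rw [this, Set.ncard_coe_finset, Int.card_Icc]

/-- If the columns `j < n` of the cone of slopes `σ` and `τ` at a lattice vertex contain
`0, …, j`, and the last one contains only `n` lattice points, then they contain nothing else. -/
theorem mem_Icc_of_ncard_eq {n : ℕ} {σ τ : ℚ} (hσ : σ ≤ 0) (hτ : 1 ≤ τ) (hn : 1 ≤ n)
    (hcard : {z : ℤ | ((n : ℚ) - 1) * σ ≤ z ∧ (z : ℚ) ≤ ((n : ℚ) - 1) * τ}.ncard = n)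
    {j : ℕ} (hj : j < n) {z : ℤ} (h1 : σ * j ≤ z) (h2 : (z : ℚ) ≤ τ * j) : 0 ≤ z ∧ z ≤ j := by
  rw [ncard_setOf_le_le] at hcard
  have hn' : (0 : ℚ) ≤ (n : ℚ) - 1 := by
    have : (1 : ℚ) ≤ n := by exact_mod_cast hn
    linarith
  have h3 : ⌈((n : ℚ) - 1) * σ⌉ ≤ 0 := Int.ceil_le.2 (by push_cast; nlinarith)
  have h4 : (n : ℤ) - 1 ≤ ⌊((n : ℚ) - 1) * τ⌋ := Int.le_floor.2 (by push_cast; nlinarith)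
  have h5 : (0 : ℤ) - 1 < ⌈((n : ℚ) - 1) * σ⌉ := by omega
  have h6 : ⌊((n : ℚ) - 1) * τ⌋ < n := by omega
  rw [Int.lt_ceil] at h5
  rw [Int.floor_lt] at h6
  push_cast at h5 h6
  have hj' : (j : ℚ) ≤ (n : ℚ) - 1 := by
    have : (j : ℚ) + 1 ≤ n := by exact_mod_cast hj
    linarith
  constructor
  · have : (-1 : ℚ) < z := by nlinarith
    have : (-1 : ℤ) < z := by exact_mod_cast this
    omega
  · rcases Nat.eq_zero_or_pos j with rfl | hj0
    · have : (z : ℚ) ≤ 0 := by simpa using h2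
      exact_mod_cast this
    · have hj1 : (0 : ℚ) < j := by exact_mod_cast hj0
      have hn1 : (0 : ℚ) < (n : ℚ) - 1 := by linarith
      have : (z : ℚ) < j + 1 := by
        have h7 : ((n : ℚ) - 1) * (τ - 1) * j < j := by
          have : ((n : ℚ) - 1) * (τ - 1) < 1 := by linarith
          nlinarith
        have h8 : (τ - 1) * (j : ℚ) ≤ (τ - 1) * ((n : ℚ) - 1) :=
          mul_le_mul_of_nonneg_left hj' (by linarith)
        linarith
      have : z < j + 1 := by exact_mod_cast this
      omega

variable {k : Type u} [Field k] [CharZero k]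

theorem simplexFun_mem_polyFun {n i : ℕ} (hi : i ≤ n) (c₀ c₁ t : k) :
    (fun v : ℤ × ℤ => simplexFun n i (c₀ - v.1) (c₁ - v.2 - t * (c₀ - v.1))) ∈ polyFun k n := by
  have h1 := prod_affine_mul_mem_polyFun (Finset.range (n - i)) (one_mem_polyFun (k := k))
    (fun _ => -1 - t) (fun _ => 1) (fun j => c₀ - c₁ + t * c₀ - j)
  have h2 := prod_affine_mul_mem_polyFun (Finset.range i) h1
    (fun _ => t) (fun _ => -1) (fun j => c₁ - t * c₀ - j)
  rw [Finset.card_range, Finset.card_range, zero_add, Nat.sub_add_cancel hi] at h2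
  convert h2 using 1
  ext v
  simp only [simplexFun, Pi.one_apply, mul_one]
  congr 1 <;> exact Finset.prod_congr rfl fun j _ => by ring

/-- Let `w a = M` be an integer. A Laurent polynomial supported in `aΔ` that vanishes to order `M`
at `(1,1)` vanishes on the curve `y = 1`. -/
theorem columnSum_eq_zero_of_orthogonal {s₁ s₂ s₃ : ℚ} (h₁₂ : s₁ < s₂) (h₂₃ : s₂ < s₃)
    (hw : 1 / (s₂ - s₁) + 1 / (s₃ - s₂) < 1)
    {n : ℕ} (hn : n = {z : ℤ | s₁ ≤ z ∧ (z : ℚ) ≤ s₂}.ncard)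
    (hcol : {z : ℤ | ((n : ℚ) - 1) * s₂ ≤ z ∧ (z : ℚ) ≤ ((n : ℚ) - 1) * s₃}.ncard = n)
    (hns : ¬ ∃ z : ℤ, (n : ℚ) * s₂ = z)
    {a : ℤ} {M : ℕ} (hM : (M : ℚ) = (1 / (s₂ - s₁) + 1 / (s₃ - s₂)) * a) (hnM : n < M)
    {F : AddMonoidAlgebra k (ℤ × ℤ)} (hsupp : ∀ v ∈ F.coeff.support, v ∈ trianglePoints s₁ s₂ s₃ a)
    (hF : VanishesToOrder M F) (x : ℤ) : columnSum x F = 0 := by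
  set p := 1 / (s₂ - s₁) with hp
  set q := 1 / (s₃ - s₂) with hq
  have hp0 : 0 < p := one_div_pos.2 (by linarith)
  have hq0 : 0 < q := one_div_pos.2 (by linarith)
  have hp1 : p * (s₂ - s₁) = 1 := one_div_mul_cancel (by linarith)
  have hq1 : q * (s₃ - s₂) = 1 := one_div_mul_cancel (by linarith)
  have hlen₁ : 1 < s₂ - s₁ := by
    have : p < 1 := by linarith
    nlinarith
  have hlen₂ : 1 < s₃ - s₂ := by
    have : q < 1 := by linarith
    nlinarith
  have hleft {v} (hv : v ∈ F.coeff.support) : -(a * p) ≤ v.1 := by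
    obtain ⟨h1, -, h2⟩ := hsupp v hv
    have h3 : 0 ≤ p * (a + (s₂ - s₁) * v.1) := mul_nonneg hp0.le (by linarith)
    have h4 : p * (a + (s₂ - s₁) * v.1) = a * p + v.1 := by linear_combination v.1 * hp1
    linarith
  have hright {v} (hv : v ∈ F.coeff.support) : v.1 ≤ a * q := by
    obtain ⟨-, h1, h2⟩ := hsupp v hv
    have h3 : 0 ≤ q * (a - (s₃ - s₂) * v.1) := mul_nonneg hq0.le (by linarith)
    have h4 : q * (a - (s₃ - s₂) * v.1) = a * q - v.1 := by linear_combination -v.1 * hq1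
    linarith
  -- The triangle `aΔ` lies over `[-ap, aq]`, of length `wa = M`, so at most the `M + 1` columns `A,
  -- …, A + M` meet it.
  set A := ⌈-(a * p)⌉ with hA
  have hcols : ∀ v ∈ F.coeff.support, v.1 ∈ Finset.Icc A (A + M) := by
    intro v hv
    rw [Finset.mem_Icc]
    refine ⟨Int.ceil_le.2 (hleft hv), ?_⟩
    have h1 := hright hv
    have h2 := Int.le_ceil (-(a * p))
    have : (v.1 : ℚ) ≤ ((A + M : ℤ) : ℚ) := by push_cast; linarith
    exact_mod_cast this
  by_contra hx
  have hne {x₁} (hx₁ : x₁ ∈ Finset.Icc A (A + M)) : columnSum x₁ F ≠ 0 :=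
    fun h => hx (columnSum_eq_zero_of_columnSum_eq_zero hF hcols hx₁ h x)
  -- All column sums are now nonzero, so the extreme columns meet the support. This forces `-ap` to
  -- be the integer `A`, and the extreme points `(A, B)` and `(A + M, N)` to be the vertices of
  -- `aΔ`.
  obtain ⟨⟨A', N⟩, hR, hRx⟩ := exists_mem_support_of_columnSum_ne_zero (hne (x₁ := A + M) (by simp))
  obtain ⟨⟨A₁, B⟩, hL, hLx⟩ := exists_mem_support_of_columnSum_ne_zero (hne (x₁ := A) (by simp))
  obtain rfl : A' = A + M := hRx
  obtain rfl : A₁ = A := hLx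
  have hAp : (A : ℚ) = -(a * p) := by
    have h1 := hright hR
    have h2 := Int.le_ceil (-(a * p))
    push_cast at h1
    linarith
  have hB1 : s₁ * A = a + s₂ * A := by rw [hAp]; linear_combination a * hp1
  have hN1 : s₃ * (A + M) = a + s₂ * (A + M) := by
    rw [hAp, hM]; linear_combination a * hq1
  have hB : (B : ℚ) = a + s₂ * A := by
    obtain ⟨h1, -, h2⟩ := hsupp _ hL
    simp only at h1 h2
    linarith
  have hN : (N : ℚ) = a + s₂ * (A + M) := by
    obtain ⟨-, h1, h2⟩ := hsupp _ hR
    push_cast at h1 h2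
    linarith
  have hs2 : ∀ z : ℤ, s₂ ≠ z := fun z hz => hns ⟨n * z, by rw [hz]; push_cast; ring⟩
  -- New coordinates centred at the right vertex: `u = A + M - x` and, after a shear by `t`, `z = N
  -- - y - tu`. There the triangle has sides of slopes `s₂ - t ∈ (-1, 0)` and `s₃ - t`, and `(M, Y)`
  -- is the left vertex.
  set t := ⌊s₂⌋ + 1 with ht
  have ht1 : s₂ < t := by push_cast [ht]; exact Int.lt_floor_add_one s₂
  have ht2 : (t : ℚ) - 1 < s₂ := by
    have h1 := (Int.floor_le s₂).lt_of_ne (hs2 _).symm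
    push_cast [ht]; linarith
  set Y : ℤ := N - B - t * M with hY
  have hYM : (Y : ℚ) = (s₂ - t) * M := by
    push_cast [hY]; rw [hN, hB]; ring
  have hM0 : (0 : ℚ) < M := by exact_mod_cast (by omega : 0 < M)
  have hlattice {v} (hv : v ∈ F.coeff.support) {u : ℤ} (hu : v.1 = A + M - u) :
      (s₂ - t) * u ≤ ((N - v.2 - t * u : ℤ) : ℚ) ∧ ((N - v.2 - t * u : ℤ) : ℚ) ≤ (s₃ - t) * u := by
    obtain ⟨-, h1, h2⟩ := hsupp v hv
    rw [hu] at h1 h2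
    push_cast at h1 h2 ⊢
    constructor <;> linarith
  have hLcol : ∀ v ∈ F.coeff.support, v.1 = A → v = (A, B) := by
    intro v hv hv1
    refine Prod.ext hv1 ?_
    obtain ⟨h1, -, h2⟩ := hsupp v hv
    rw [hv1] at h1 h2
    have : (v.2 : ℚ) = B := by linarith
    exact_mod_cast this
  refine Finsupp.mem_support_iff.1 hL ?_
  -- If `s₃ - t < 1`, the columns `u = 0, 1` contain only `z = 0`, so the linear function `z`,
  -- nonzero at the left vertex, already suffices with `d = 1`.
  by_cases hs3 : s₃ - t < 1
  · refine coeff_eq_zero_of_polyFun hF hcols (d := 1)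
      (p := fun v => (t * v.1 + (-1) * v.2 + (N - t * (A + M))) * (1 : ℤ × ℤ → k) v)
      (K := {A + M, A + M - 1}) (affine_mul_mem_polyFun one_mem_polyFun _ _ _) ?_ ?_ ?_
      (by simp) ?_ hLcol ?_
    · intro z hz
      simp only [Finset.mem_insert, Finset.mem_singleton] at hz
      rw [Finset.mem_Icc]; omega
    · rw [Finset.card_pair (by omega)]
    · intro v hv hvK
      have key : ∀ u : ℤ, 0 ≤ u → u ≤ 1 → v.1 = A + M - u → N - v.2 - t * u = 0 := by
        intro u hu0 hu1 hu
        obtain ⟨h1, h2⟩ := hlattice hv hu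
        have hu0' : (0 : ℚ) ≤ u := by exact_mod_cast hu0
        have hu1' : (u : ℚ) ≤ 1 := by exact_mod_cast hu1
        have h3 : (-1 : ℚ) < ((N - v.2 - t * u : ℤ) : ℚ) := by nlinarith
        have h4 : ((N - v.2 - t * u : ℤ) : ℚ) < 1 := by nlinarith
        have h3' : (-1 : ℤ) < N - v.2 - t * u := by exact_mod_cast h3
        have h4' : N - v.2 - t * u < 1 := by exact_mod_cast h4
        omega
      simp only [Finset.mem_insert, Finset.mem_singleton] at hvK
      have key' : N - v.2 - t * (A + M - v.1) = 0 := by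
        rcases hvK with h | h
        · exact key _ (by omega) (by omega) (by ring)
        · exact key _ (by omega) (by omega) (by ring)
      have := congrArg (Int.cast : ℤ → k) key'
      push_cast at this
      simp only [Pi.one_apply, mul_one]
      linear_combination this
    · have : n ≠ 0 := fun h => hns ⟨0, by simp [h]⟩
      simp only [Finset.mem_insert, Finset.mem_singleton]; omega
    · have hY0 : Y ≠ 0 := by
        intro h
        rw [h, Int.cast_zero, zero_eq_mul] at hYM
        rcases hYM with h | h
        · linarith
        · linarith
      have : (Y : k) ≠ 0 := by exact_mod_cast hY0
      intro h
      apply this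
      simp only [Pi.one_apply, mul_one] at h
      push_cast [hY]
      linear_combination h
  · push Not at hs3
    have hn1 : 1 ≤ n := by
      rcases Nat.eq_zero_or_pos n with h | h
      · exact absurd ⟨0, by simp [h]⟩ hns
      · exact h
    -- As `Y = (s₂ - t) M`, vanishing would give `n s₂ = nt - 1`, an integer.
    have hnY : n * Y + M ≠ 0 := by
      intro h
      have h' : (n : ℚ) * Y + M = 0 := by exact_mod_cast h
      rw [hYM] at h'
      have h2 : (n : ℚ) * (s₂ - t) + 1 = 0 := by
        apply mul_right_cancel₀ hM0.ne'
        linear_combination h'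
      exact hns ⟨n * t - 1, by push_cast; linear_combination h2⟩
    obtain ⟨α, hα, hα0⟩ := exists_simplexFun_interpolation (k := k) hnM Y hnY
    refine coeff_eq_zero_of_polyFun hF hcols (d := n)
      (p := ∑ i : Fin (n + 1), α i • fun v : ℤ × ℤ => simplexFun n i ((A + M : k) - v.1)
        ((N : k) - v.2 - t * ((A + M : k) - v.1)))
      -- The `n` columns nearest the right vertex and the column next to the left vertex; `n < M`
      -- makes them `n + 1` distinct columns and keeps `A` out.
      (K := insert (A + 1) (Finset.Ioc (A + M - n) (A + M)))
      (Submodule.sum_mem _ fun i _ => Submodule.smul_mem _ _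
        (simplexFun_mem_polyFun (Nat.lt_succ_iff.1 i.2) _ _ _)) ?_ ?_ ?_ (by simp) ?_ hLcol ?_
    · intro z hz
      simp only [Finset.mem_insert, Finset.mem_Ioc] at hz
      rw [Finset.mem_Icc]; omega
    · rw [Finset.card_insert_of_notMem, Int.card_Ioc]
      · omega
      · rw [Finset.mem_Ioc]; omega
    · intro v hv hvK
      simp only [Finset.sum_apply, Pi.smul_apply, smul_eq_mul]
      rw [Finset.mem_insert] at hvK
      rcases hvK with hv1 | hvK
      -- On column `A + 1` the height `v.2 - B` lies between `⌈s₁⌉` and `⌊s₂⌋`, which are `n`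
      -- values; in the new coordinate they are `Y + 1, …, Y + n`, the zeros prescribed in the
      -- interpolation.
      · obtain ⟨h1, -, h2⟩ := hsupp v hv
        rw [hv1] at h1 h2
        push_cast at h1 h2
        have hz1 : ⌈s₁⌉ ≤ v.2 - B := Int.ceil_le.2 (by push_cast; linarith)
        have hz2 : v.2 - B ≤ ⌊s₂⌋ := Int.le_floor.2 (by push_cast; linarith)
        rw [ncard_setOf_le_le] at hn
        have := hα (N - v.2 - t * (M - 1)) (by
          rw [hY]; linarith) (by
          have : (n : ℤ) = ⌊s₂⌋ + 1 - ⌈s₁⌉ := by omega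
          rw [hY, this]; linarith)
        rw [← this]
        refine Finset.sum_congr rfl fun i _ => ?_
        rw [hv1]
        push_cast
        congr 2 <;> ring
      · rw [Finset.mem_Ioc] at hvK
        obtain ⟨j, hj⟩ : ∃ j : ℕ, (j : ℤ) = A + M - v.1 :=
          ⟨(A + M - v.1).toNat, Int.toNat_of_nonneg (by omega)⟩
        have hjn : j < n := by omega
        obtain ⟨h1, h2⟩ := hlattice hv (u := j) (by omega)
        -- The shear by the integer `(n - 1)t` preserves the lattice point count, so the columns `u
        -- < n` lie in the standard simplex, where every `simplexFun n i` vanishes.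
        obtain ⟨h3, h4⟩ := mem_Icc_of_ncard_eq (n := n) (σ := s₂ - t) (τ := s₃ - t) (by linarith)
          hs3 hn1 (by
            conv_rhs => rw [← hcol]
            rw [ncard_setOf_le_le, ncard_setOf_le_le]
            have e1 : ((n : ℚ) - 1) * (s₂ - t) = ((n : ℚ) - 1) * s₂ - ((((n : ℤ) - 1) * t : ℤ) : ℚ) := by
              push_cast; ring
            have e2 : ((n : ℚ) - 1) * (s₃ - t) = ((n : ℚ) - 1) * s₃ - ((((n : ℤ) - 1) * t : ℤ) : ℚ) := by
              push_cast; ring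
            rw [e1, e2, Int.ceil_sub_intCast, Int.floor_sub_intCast]
            congr 1; ring) hjn (by exact_mod_cast h1) (by exact_mod_cast h2)
        obtain ⟨y, hy⟩ : ∃ y : ℕ, (y : ℤ) = N - v.2 - t * j :=
          ⟨_, Int.toNat_of_nonneg h3⟩
        have hj' : ((A : k) + M - v.1) = j := by
          have := congrArg (Int.cast : ℤ → k) hj
          push_cast at this; rw [this]
        have hy' : ((N : k) - v.2 - t * j) = y := by
          have := congrArg (Int.cast : ℤ → k) hy
          push_cast at this; rw [this]
        rw [hj', hy']
        exact Finset.sum_eq_zero fun i _ => by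
          rw [simplexFun_eq_zero (Nat.lt_succ_iff.1 i.2) (by omega) hjn, mul_zero]
    · rw [Finset.mem_insert, Finset.mem_Ioc]; omega
    · simp only [Finset.sum_apply, Pi.smul_apply, smul_eq_mul]
      convert hα0 using 3
      push_cast [hY]
      congr 1 <;> ring

end Orthogonal

/-! ### Sections that do not vanish on the negative curve -/

section Existence

open Polynomial

variable {k : Type u} [Field k]

/-- Evaluation of a polynomial in two variables at a lattice point. -/
def evalPoint (Q : k[X][X]) (v : ℤ × ℤ) : k := (Q.eval (C (v.2 : k))).eval (v.1 : k)

theorem evalPoint_eq (Q : k[X][X]) (v : ℤ × ℤ) :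
    evalPoint Q v = (Q.map (evalRingHom (v.1 : k))).eval (v.2 : k) := by
  have := Polynomial.hom_eval₂ Q (RingHom.id _) (evalRingHom (v.1 : k)) (C (v.2 : k))
  rw [RingHom.comp_id, coe_evalRingHom, eval_C] at this
  rw [evalPoint, Polynomial.eval_map]
  exact this

/-- A polynomial of degree less than `m` in two variables that vanishes at sufficiently many points
on sufficiently many columns is zero. -/
theorem eq_zero_of_evalPoint_eq_zero [CharZero k] {m : ℕ} {Q : k[X][X]}
    -- The outer variable is `y`; with truncated subtraction this says that the total degree is
    -- below `m`, and that `Q = 0` if `m = 0`.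
    (hQ : ∀ j, Q.coeff j ∈ degreeLT k (m - j)) {I : Finset ℤ} {c : ℤ → Finset ℤ}
    (hI : ∀ t, 1 ≤ t → t ≤ m → m + 1 ≤ (I.filter fun x => t ≤ (c x).card).card + t)
    (h0 : ∀ x ∈ I, ∀ y ∈ c x, evalPoint Q (x, y) = 0) : Q = 0 := by
  induction m generalizing Q I with
  | zero =>
    ext1 j
    have := hQ j
    rw [Nat.zero_sub, mem_degreeLT, Nat.cast_zero, ← not_le, zero_le_degree_iff, not_not] at this
    rw [this, coeff_zero]
  | succ m ih =>
    -- A column with more zeros than the degree allows: `Q` vanishes identically on it, so `x - x₀`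
    -- divides `Q`. The quotient has smaller degree, and removing the column keeps the count.
    obtain ⟨x₀, hx₀⟩ : (I.filter fun x => m + 1 ≤ (c x).card).Nonempty := by
      rw [← Finset.card_pos]
      have := hI (m + 1) (by omega) le_rfl
      omega
    rw [Finset.mem_filter] at hx₀
    have hR : Q.map (evalRingHom (x₀ : k)) = 0 := by
      refine eq_zero_of_degree_lt_of_eval_finset_eq_zero
        ((c x₀).map ⟨(Int.cast : ℤ → k), Int.cast_injective⟩) ?_ ?_
      · rw [Finset.card_map]
        refine lt_of_lt_of_le ((degree_lt_iff_coeff_zero _ (m + 1)).2 fun j hj => ?_)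
          (by exact_mod_cast hx₀.2)
        have := hQ j
        rw [Nat.sub_eq_zero_of_le hj, mem_degreeLT, Nat.cast_zero, ← not_le, zero_le_degree_iff,
          not_not] at this
        rw [coeff_map, this, map_zero]
      · intro y hy
        obtain ⟨z, hz, rfl⟩ := Finset.mem_map.1 hy
        have := h0 x₀ hx₀.1 z hz
        rwa [evalPoint_eq] at this
    have hdvd : C (X - C (x₀ : k)) ∣ Q := by
      rw [C_dvd_iff_dvd_coeff]
      intro j
      rw [dvd_iff_isRoot]
      have := congrArg (fun R => R.coeff j) hR
      simpa using this
    obtain ⟨Q', rfl⟩ := hdvd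
    have hQ' : Q' = 0 := by
      refine ih (Q := Q') (I := I.erase x₀) (fun j => ?_) (fun t ht1 htm => ?_) fun x hx y hy => ?_
      · have := hQ j
        rw [coeff_C_mul, mem_degreeLT] at this
        rw [mem_degreeLT]
        by_cases h : Q'.coeff j = 0
        · rw [h, degree_zero]; exact WithBot.bot_lt_coe _
        · rw [degree_mul, degree_X_sub_C, degree_eq_natDegree h] at this
          rw [degree_eq_natDegree h]
          have h' : 1 + (Q'.coeff j).natDegree < m + 1 - j := by exact_mod_cast this
          have : (Q'.coeff j).natDegree < m - j := by omega
          exact_mod_cast this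
      · have := hI t ht1 (by omega)
        rw [Finset.filter_erase]
        have h2 := Finset.pred_card_le_card_erase (s := I.filter fun x => t ≤ (c x).card) (a := x₀)
        omega
      · have := h0 x (Finset.mem_of_mem_erase hx) y hy
        rw [evalPoint, eval_mul, eval_mul, eval_C] at this
        refine (mul_eq_zero.1 this).resolve_left ?_
        rw [eval_sub, eval_X, eval_C, ← ne_eq, sub_ne_zero]
        exact_mod_cast Finset.ne_of_mem_erase hx
    rw [hQ', mul_zero]

theorem exists_evalPoint_eq [CharZero k] {d : ℕ} {p : ℤ × ℤ → k} (hp : p ∈ polyFun k d) :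
    ∃ Q : k[X][X], (∀ j, Q.coeff j ∈ degreeLT k (d + 1 - j)) ∧ ∀ v, evalPoint Q v = p v := by
  induction hp using Submodule.span_induction with
  | mem p hp =>
    obtain ⟨i, j, hij, rfl⟩ := hp
    refine ⟨C (C ((i.factorial * j.factorial : k)⁻¹) * descPochhammer k i) *
      (descPochhammer k j).map C, fun l => ?_, fun v => ?_⟩
    · rw [coeff_C_mul, coeff_map, mem_degreeLT]
      by_cases hl : j < l
      · rw [coeff_eq_zero_of_natDegree_lt (by rwa [descPochhammer_natDegree]), C_0, mul_zero,
          degree_zero]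
        exact WithBot.bot_lt_coe _
      · refine lt_of_le_of_lt (degree_mul_le _ _) ?_
        refine lt_of_le_of_lt (add_le_add (degree_mul_le _ _) degree_C_le) ?_
        refine lt_of_le_of_lt (add_le_add (add_le_add degree_C_le degree_le_natDegree) le_rfl) ?_
        rw [descPochhammer_natDegree, zero_add, add_zero]
        exact_mod_cast (by omega : i < d + 1 - l)
    · have h1 : (((descPochhammer k j).map C).eval (C (v.2 : k))) =
          C ((descPochhammer k j).eval (v.2 : k)) := by
        rw [Polynomial.eval_map, eval₂_at_apply]
      have hi : (i.factorial : k) ≠ 0 := by exact_mod_cast i.factorial_ne_zero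
      have hj : (j.factorial : k) ≠ 0 := by exact_mod_cast j.factorial_ne_zero
      rw [evalPoint, eval_mul, h1, eval_mul, eval_C, eval_C, eval_mul, eval_C,
        descPochhammer_eval_eq_factorial_mul_choose, descPochhammer_eval_eq_factorial_mul_choose]
      field_simp
  | zero => exact ⟨0, fun j => by simp, fun v => by simp [evalPoint]⟩
  | add p q _ _ hp hq =>
    obtain ⟨P, hP, hP'⟩ := hp
    obtain ⟨Q, hQ, hQ'⟩ := hq
    exact ⟨P + Q, fun j => by rw [coeff_add]; exact add_mem (hP j) (hQ j),
      fun v => by simp [evalPoint, ← hP', ← hQ']⟩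
  | smul c p _ hp =>
    obtain ⟨P, hP, hP'⟩ := hp
    exact ⟨C (C c) * P, fun j => by
      rw [coeff_C_mul, ← smul_eq_C_mul]; exact Submodule.smul_mem _ _ (hP j),
      fun v => by simp [evalPoint, ← hP']⟩

/-- A linear functional that vanishes on the common kernel of finitely many linear functionals is a
linear combination of them. -/
theorem exists_eq_sum_smul_of_forall_eq_zero {V ι : Type*} [AddCommGroup V] [Module k V] [Fintype ι]
    (l : V →ₗ[k] k) (L : ι → V →ₗ[k] k) (h : ∀ v, (∀ i, L i v = 0) → l v = 0) :
    ∃ α : ι → k, ∀ v, l v = ∑ i, α i * L i v := by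
  have := mem_span_of_iInf_ker_le_ker (L := L) (K := l) fun v hv => by
    rw [Submodule.mem_iInf] at hv
    exact h v hv
  rw [Submodule.mem_span_range_iff_exists_fun] at this
  obtain ⟨α, rfl⟩ := this
  exact ⟨α, fun v => by simp⟩

/-- If a function `g` on `T` is not polynomial of degree less than `b`, it pairs nontrivially with
a Laurent polynomial that is supported in `T` and vanishes to order `b`. -/
theorem exists_pairing_ne_zero [CharZero k] {d : ℕ} (T : Set (ℤ × ℤ)) (g : ℤ × ℤ → k)
    (hg : ∀ p ∈ polyFun k d, ∃ v ∈ T, p v ≠ g v) :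
    ∃ F : AddMonoidAlgebra k (ℤ × ℤ), (∀ v ∈ F.coeff.support, v ∈ T) ∧
      VanishesToOrder (d + 1) F ∧ pairing g F ≠ 0 := by
  classical
  let L (p : ℤ × ℤ → k) : (T →₀ k) →ₗ[k] k := Finsupp.linearCombination k fun v => p v.1
  let e (F : T →₀ k) : AddMonoidAlgebra k (ℤ × ℤ) :=
    AddMonoidAlgebra.ofCoeff (F.mapDomain Subtype.val)
  have hL (p) (F : T →₀ k) : L p F = pairing p (e F) := by
    rw [pairing_apply]
    change _ = (F.mapDomain Subtype.val).sum fun v c => c * p v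
    rw [Finsupp.sum_mapDomain_index (by simp) (by intros; ring)]
    simp [L, Finsupp.linearCombination_apply]
  let ι := {ij : Fin (d + 1) × Fin (d + 1) // (ij.1 : ℕ) + ij.2 ≤ d}
  let P (ij : ι) : ℤ × ℤ → k :=
    fun v => Ring.choose (v.1 : k) ij.1.1 * Ring.choose (v.2 : k) ij.1.2
  by_contra! h
  -- Otherwise pairing with `g` is a combination of the pairings with the binomial products;
  -- evaluating at the point masses in `T` exhibits `g` as a polynomial function on `T`.
  obtain ⟨α, hα⟩ := exists_eq_sum_smul_of_forall_eq_zero (L g) (fun ij => L (P ij)) fun F hF => by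
    rw [hL]
    refine h _ (fun v hv => ?_) fun i j hij => ?_
    · obtain ⟨w, -, rfl⟩ := Finset.mem_image.1 (Finsupp.mapDomain_support hv)
      exact w.2
    · have := hF ⟨⟨⟨i, by omega⟩, ⟨j, by omega⟩⟩, by simp only; omega⟩
      rwa [hL] at this
  obtain ⟨v, hv, hne⟩ := hg (∑ ij, α ij • P ij) (Submodule.sum_mem _ fun ij _ =>
    Submodule.smul_mem _ _ (Submodule.subset_span ⟨_, _, ij.2, rfl⟩))
  apply hne
  simpa [L] using (hα (Finsupp.single ⟨v, hv⟩ 1)).symm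

/-- By duality, failure would make the indicator of the column `x = 0` agree on `aΔ` with a
polynomial of degree below `b`. That polynomial vanishes on all other columns of `aΔ`, which are
long enough to force it to be zero, against its value `1` at the origin. The `2` in the bound pays
for two roundings. -/
theorem exists_section_columnSum_ne_zero [CharZero k] {s₁ s₂ s₃ : ℚ} (h₁₂ : s₁ < s₂) (h₂₃ : s₂ < s₃)
    (hw : 1 / (s₂ - s₁) + 1 / (s₃ - s₂) < 1) {a b : ℕ} (hb : 1 ≤ b)
    (hab : (b : ℚ) + 2 ≤ (1 / (s₂ - s₁) + 1 / (s₃ - s₂)) * a) :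
    ∃ F : AddMonoidAlgebra k (ℤ × ℤ), (∀ v ∈ F.coeff.support, v ∈ trianglePoints s₁ s₂ s₃ a) ∧
      VanishesToOrder b F ∧ columnSum 0 F ≠ 0 := by
  obtain ⟨d, rfl⟩ := Nat.exists_eq_add_of_le' hb
  refine exists_pairing_ne_zero _ _ fun p hp => ?_
  by_contra! hpg
  obtain ⟨Q, hQ, hQp⟩ := exists_evalPoint_eq hp
  set p' := 1 / (s₂ - s₁) with hp'
  set q' := 1 / (s₃ - s₂) with hq'
  have hp0 : 0 < p' := one_div_pos.2 (by linarith)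
  have hq0 : 0 < q' := one_div_pos.2 (by linarith)
  have hp1 : p' * (s₂ - s₁) = 1 := one_div_mul_cancel (by linarith)
  have hq1 : q' * (s₃ - s₂) = 1 := one_div_mul_cancel (by linarith)
  -- The nonzero `x` over which the vertical section of `aΔ` has length at least `t`, hence at least
  -- `t` lattice points.
  let J (t : ℕ) : Finset ℤ := (Finset.Icc (-⌊((a : ℚ) - t) * p'⌋) ⌊((a : ℚ) - t) * q'⌋).erase 0
  have hQ0 : Q = 0 := by
    refine eq_zero_of_evalPoint_eq_zero hQ (I := J 0)
      (c := fun x => Finset.Icc ⌈max (s₁ * x) (s₃ * x)⌉ ⌊a + s₂ * x⌋) (fun t ht htd => ?_) ?_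
    · have hta : (t : ℚ) ≤ a := by
        have : (t : ℚ) ≤ d + 1 := by exact_mod_cast htd
        push_cast at hab
        nlinarith
      have hsub : J t ⊆ (J 0).filter fun x : ℤ =>
          t ≤ (Finset.Icc ⌈max (s₁ * x) (s₃ * x)⌉ ⌊a + s₂ * x⌋).card := by
        intro x hx
        obtain ⟨hx0, hx⟩ := Finset.mem_erase.1 hx
        rw [Finset.mem_Icc, neg_le, Int.le_floor, Int.le_floor] at hx
        obtain ⟨hx1, hx2⟩ := hx
        push_cast at hx1
        have hx1' : t ≤ a + (s₂ - s₁) * x := by nlinarith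
        have hx2' : t ≤ a - (s₃ - s₂) * x := by nlinarith
        refine Finset.mem_filter.2 ⟨Finset.mem_erase.2 ⟨hx0, Finset.mem_Icc.2 ⟨?_, ?_⟩⟩, ?_⟩
        · rw [neg_le, Int.le_floor]
          push_cast
          have : (0 : ℚ) ≤ t := t.cast_nonneg
          nlinarith
        · rw [Int.le_floor]
          push_cast
          have : (0 : ℚ) ≤ t := t.cast_nonneg
          nlinarith
        · rw [Int.card_Icc]
          have h1 : max (s₁ * (x : ℚ)) (s₃ * x) + t ≤ a + s₂ * x := by
            rw [← le_sub_iff_add_le]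
            exact max_le (by linarith) (by linarith)
          have h2 := Int.ceil_lt_add_one (max (s₁ * (x : ℚ)) (s₃ * x))
          have h3 := Int.lt_floor_add_one (a + s₂ * (x : ℚ))
          have h4 : ((⌈max (s₁ * (x : ℚ)) (s₃ * x)⌉ + t - 1 : ℤ) : ℚ) <
              ((⌊a + s₂ * (x : ℚ)⌋ + 1 : ℤ) : ℚ) := by
            push_cast; linarith
          have h5 := Int.cast_lt.1 h4
          omega
      have hcard := Finset.card_le_card hsub
      have h1 := Int.lt_floor_add_one (((a : ℚ) - t) * p')
      have h2 := Int.lt_floor_add_one (((a : ℚ) - t) * q')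
      have h3 : 0 ≤ ⌊((a : ℚ) - t) * p'⌋ := Int.floor_nonneg.2 (mul_nonneg (by linarith) hp0.le)
      have h4 : 0 ≤ ⌊((a : ℚ) - t) * q'⌋ := Int.floor_nonneg.2 (mul_nonneg (by linarith) hq0.le)
      have h5 : (J t).card + 1 = (⌊((a : ℚ) - t) * q'⌋ + 1 - -⌊((a : ℚ) - t) * p'⌋).toNat := by
        rw [← Int.card_Icc]
        exact Finset.card_erase_add_one (Finset.mem_Icc.2 ⟨by omega, h4⟩)
      -- The floors add up to more than `(a - t)w - 2 ≥ b - tw`, with `b = d + 1`, and `tw ≤ t`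
      -- because `w < 1`.
      have h6 : ((d + 1 - t : ℤ) : ℚ) < ((⌊((a : ℚ) - t) * p'⌋ + ⌊((a : ℚ) - t) * q'⌋ : ℤ) : ℚ) := by
        push_cast at hab ⊢
        have ht0 : (0 : ℚ) ≤ t := t.cast_nonneg
        nlinarith
      have h7 := Int.cast_lt.1 h6
      omega
    · intro x hx y hy
      rw [hQp]
      rw [Finset.mem_Icc, Int.ceil_le, Int.le_floor, max_le_iff] at hy
      rw [hpg (x, y) ⟨hy.1.1, hy.1.2, by exact_mod_cast hy.2⟩]
      exact if_neg (Finset.ne_of_mem_erase hx)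
  have h1 := hpg (0, 0) (by simp [trianglePoints])
  rw [← hQp, hQ0] at h1
  simp [evalPoint] at h1

end Existence

/-! ### The ideal of the identity of the torus and the exceptional valuation -/

section Arc

variable {k : Type u} [Field k]

/-- The binomial expansion of `z^i = (1 + (z - 1))^i`, truncated at order `b`. By Pascal's rule the
truncations for `i` and `i + 1` differ by the factor `z` modulo `(z - 1)^b`, so the claim moves in
both directions along `ℤ`. -/
theorem pow_dvd_zpow_sub_sum_choose [CharZero k] {R : Type*} [CommRing R] [Algebra k R] (z : Rˣ)
    (b : ℕ) (i : ℤ) : ((z : R) - 1) ^ b ∣ ((z ^ i : Rˣ) : R) -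
      ∑ l ∈ Finset.range b, algebraMap k R (Ring.choose (i : k) l) * ((z : R) - 1) ^ l := by
  cases b with
  | zero => simp
  | succ b =>
    set A : ℤ → R := fun i =>
      ∑ l ∈ Finset.range (b + 1), algebraMap k R (Ring.choose (i : k) l) * ((z : R) - 1) ^ l with hA
    have key (i : ℤ) : A (i + 1) =
        z * A i - algebraMap k R (Ring.choose (i : k) b) * ((z : R) - 1) ^ (b + 1) := by
      simp only [hA]
      clear hA
      induction b with
      | zero => simp
      | succ d ih =>
        rw [Finset.sum_range_succ, ih, Finset.sum_range_succ _ (d + 1)]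
        push_cast
        rw [Ring.choose_succ_succ, map_add]
        ring
    have step (i : ℤ) : ((z ^ (i + 1) : Rˣ) : R) - A (i + 1) = z * (((z ^ i : Rˣ) : R) - A i) +
        algebraMap k R (Ring.choose (i : k) b) * ((z : R) - 1) ^ (b + 1) := by
      rw [key, zpow_add_one, Units.val_mul]
      ring
    have iff (i : ℤ) : ((z : R) - 1) ^ (b + 1) ∣ ((z ^ (i + 1) : Rˣ) : R) - A (i + 1) ↔
        ((z : R) - 1) ^ (b + 1) ∣ ((z ^ i : Rˣ) : R) - A i := by
      rw [step, dvd_add_left (Dvd.intro_left _ rfl), Units.dvd_mul_left]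
    change _ ∣ _ - A i
    induction i using Int.induction_on with
    | zero =>
      have : A 0 = 1 := by
        simp only [hA]
        rw [Finset.sum_range_succ', Finset.sum_eq_zero fun l _ => by
          rw [Int.cast_zero, Ring.choose_zero_succ, map_zero, zero_mul]]
        simp
      simp [this]
    | succ i ih => exact (iff _).2 ih
    | pred i ih => exact (iff _).1 (by rwa [sub_add_cancel])

/-- The maximal ideal of the identity of the torus, generated by `x - 1` and `y - 1`. -/
def identityIdeal (k : Type u) [Field k] : Ideal (AddMonoidAlgebra k (ℤ × ℤ)) :=
  Ideal.span {AddMonoidAlgebra.single (1, 0) 1 - 1, AddMonoidAlgebra.single (0, 1) 1 - 1}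

/-- The monomials as units. -/
def monomialUnit (k : Type u) [Field k] : Multiplicative (ℤ × ℤ) →* (AddMonoidAlgebra k (ℤ × ℤ))ˣ :=
  (AddMonoidAlgebra.of k (ℤ × ℤ)).toHomUnits

theorem coe_monomialUnit (v : ℤ × ℤ) : (monomialUnit k (.ofAdd v) : AddMonoidAlgebra k (ℤ × ℤ)) =
    AddMonoidAlgebra.single v 1 := rfl

theorem monomialUnit_eq (v : ℤ × ℤ) : monomialUnit k (.ofAdd v) =
    monomialUnit k (.ofAdd (1, 0)) ^ v.1 * monomialUnit k (.ofAdd (0, 1)) ^ v.2 := by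
  have : v = v.1 • (1, 0) + v.2 • (0, 1) := by ext <;> simp
  conv_lhs => rw [this]
  rw [ofAdd_add, ofAdd_zsmul, ofAdd_zsmul, map_mul, map_zpow, map_zpow]

/-- Taylor expansion at `(1,1)`: the pairings with binomial products are the Taylor coefficients. On
a monomial it is the product of the two binomial expansions. -/
theorem sub_sum_pairing_mem [CharZero k] (b : ℕ) (F : AddMonoidAlgebra k (ℤ × ℤ)) :
    F - ∑ i ∈ Finset.range b, ∑ j ∈ Finset.range b,
      algebraMap k _ (pairing (fun v : ℤ × ℤ => Ring.choose (v.1 : k) i * Ring.choose (v.2 : k) j) F)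
        * (AddMonoidAlgebra.single (1, 0) 1 - 1) ^ i * (AddMonoidAlgebra.single (0, 1) 1 - 1) ^ j ∈
      identityIdeal k ^ b := by
  induction F using AddMonoidAlgebra.induction_linear with
  | zero => simp
  | add F G hF hG =>
    convert add_mem hF hG using 1
    simp only [map_add, add_mul, Finset.sum_add_distrib]
    ring
  | single v c =>
    have hx : (AddMonoidAlgebra.single (1, 0) 1 - 1 : AddMonoidAlgebra k (ℤ × ℤ)) ∈ identityIdeal k :=
      Ideal.subset_span (by simp)
    have hy : (AddMonoidAlgebra.single (0, 1) 1 - 1 : AddMonoidAlgebra k (ℤ × ℤ)) ∈ identityIdeal k :=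
      Ideal.subset_span (by simp)
    have h1 := Ideal.mem_of_dvd _ (pow_dvd_zpow_sub_sum_choose (k := k)
      (monomialUnit k (.ofAdd (1, 0))) b v.1) (Ideal.pow_mem_pow hx b)
    have h2 := Ideal.mem_of_dvd _ (pow_dvd_zpow_sub_sum_choose (k := k)
      (monomialUnit k (.ofAdd (0, 1))) b v.2) (Ideal.pow_mem_pow hy b)
    have h3 : AddMonoidAlgebra.single v c = algebraMap k (AddMonoidAlgebra k (ℤ × ℤ)) c *
        ((monomialUnit k (.ofAdd (1, 0)) ^ v.1 : (AddMonoidAlgebra k (ℤ × ℤ))ˣ) *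
        (monomialUnit k (.ofAdd (0, 1)) ^ v.2 : (AddMonoidAlgebra k (ℤ × ℤ))ˣ)) := by
      rw [← Units.val_mul, ← monomialUnit_eq, coe_monomialUnit]
      simp
    have h4 := Ideal.mul_mem_left _ (algebraMap k _ c) (add_mem (Ideal.mul_mem_right
      ((monomialUnit k (.ofAdd (0, 1)) ^ v.2 : (AddMonoidAlgebra k (ℤ × ℤ))ˣ) :
        AddMonoidAlgebra k (ℤ × ℤ)) _ h1)
      (Ideal.mul_mem_left _ (∑ l ∈ Finset.range b, algebraMap k _ (Ring.choose (v.1 : k) l) *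
        ((monomialUnit k (.ofAdd (1, 0)) : AddMonoidAlgebra k (ℤ × ℤ)) - 1) ^ l) h2))
    convert h4 using 1
    rw [h3, sub_mul, mul_sub, sub_add_sub_cancel, mul_sub, Finset.sum_mul_sum, Finset.mul_sum]
    congr 1
    refine Finset.sum_congr rfl fun i _ => ?_
    rw [Finset.mul_sum]
    refine Finset.sum_congr rfl fun j _ => ?_
    rw [← h3, pairing_single]
    simp only [coe_monomialUnit, map_mul]
    ring

theorem mem_identityIdeal_pow_of_vanishesToOrder [CharZero k] {b : ℕ}
    {F : AddMonoidAlgebra k (ℤ × ℤ)} (hF : VanishesToOrder b F) : F ∈ identityIdeal k ^ b := by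
  have := sub_sum_pairing_mem b F
  refine (Submodule.sub_mem_iff_left _ (Submodule.sum_mem _ fun i _ =>
    Submodule.sum_mem _ fun j _ => ?_)).1 this
  by_cases hij : i + j < b
  · rw [hF i j hij, map_zero, zero_mul, zero_mul]
    exact zero_mem _
  · rw [mul_assoc]
    refine Ideal.mul_mem_left _ _ (Ideal.pow_le_pow_right (not_lt.1 hij) ?_)
    rw [pow_add]
    exact Ideal.mul_mem_mul (Ideal.pow_mem_pow (Ideal.subset_span (by simp)) _)
      (Ideal.pow_mem_pow (Ideal.subset_span (by simp)) _)

/-- The formal arc `x = 1 + s`, `y = 1 + t s` through `(1,1)` with generic slope `t`: the completion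
of the exceptional divisor. -/
def arcUnits (k : Type u) [Field k] : Multiplicative (ℤ × ℤ) →* (PowerSeries (RatFunc k))ˣ where
  toFun v :=
    (PowerSeries.isUnit_iff_constantCoeff.2 (by simp) :
      IsUnit (1 + PowerSeries.X : PowerSeries (RatFunc k))).unit ^ v.toAdd.1 *
    (PowerSeries.isUnit_iff_constantCoeff.2 (by simp) :
      IsUnit (1 + PowerSeries.C RatFunc.X * PowerSeries.X : PowerSeries (RatFunc k))).unit ^ v.toAdd.2
  map_one' := by simp
  map_mul' v w := by
    simp only [toAdd_mul, Prod.fst_add, Prod.snd_add, zpow_add]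
    exact mul_mul_mul_comm _ _ _ _

def arc (k : Type u) [Field k] : AddMonoidAlgebra k (ℤ × ℤ) →ₐ[k] PowerSeries (RatFunc k) :=
  AddMonoidAlgebra.lift k _ _ ((Units.coeHom _).comp (arcUnits k))

theorem arc_x_sub_one : arc k (AddMonoidAlgebra.single (1, 0) 1 - 1) = PowerSeries.X := by
  simp [arc, arcUnits]

theorem arc_y_sub_one : arc k (AddMonoidAlgebra.single (0, 1) 1 - 1) =
    PowerSeries.C RatFunc.X * PowerSeries.X := by
  simp [arc, arcUnits]

theorem X_pow_dvd_arc {b : ℕ} {F : AddMonoidAlgebra k (ℤ × ℤ)} (hF : F ∈ identityIdeal k ^ b) :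
    PowerSeries.X ^ b ∣ arc k F := by
  have h : (identityIdeal k ^ b).map (arc k).toRingHom ≤ Ideal.span {PowerSeries.X ^ b} := by
    rw [Ideal.map_pow, ← Ideal.span_singleton_pow]
    refine Ideal.pow_right_mono ?_ b
    rw [identityIdeal, Ideal.map_span, Ideal.span_le]
    rintro _ ⟨x, rfl | rfl, rfl⟩
    · exact Ideal.mem_span_singleton.2 (dvd_of_eq arc_x_sub_one.symm)
    · exact Ideal.mem_span_singleton.2 (Dvd.intro_left _ arc_y_sub_one.symm)
  exact Ideal.mem_span_singleton.1 (h (Ideal.mem_map_of_mem _ hF))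

/-- Below order `b`, the coefficient of `s^m` along the arc is `∑ p(i,j) t^j` over `i + j = m`, with
`p(i,j)` the Taylor coefficients. As `t` is transcendental, it vanishes only if all these `p(i,j)`
do. -/
theorem X_pow_dvd_arc_iff [CharZero k] {b : ℕ} {F : AddMonoidAlgebra k (ℤ × ℤ)} :
    PowerSeries.X ^ b ∣ arc k F ↔ VanishesToOrder b F := by
  refine ⟨fun h i₀ j₀ hij => ?_, fun h => X_pow_dvd_arc (mem_identityIdeal_pow_of_vanishesToOrder h)⟩
  have h1 := X_pow_dvd_arc (sub_sum_pairing_mem b F)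
  rw [map_sub, dvd_sub_right h, PowerSeries.X_pow_dvd_iff] at h1
  have h2 := h1 _ hij
  set p : ℕ → ℕ → k := fun i j =>
    pairing (fun v : ℤ × ℤ => Ring.choose (v.1 : k) i * Ring.choose (v.2 : k) j) F with hp
  change p i₀ j₀ = 0
  have h3 : PowerSeries.coeff (i₀ + j₀) (arc k (∑ i ∈ Finset.range b, ∑ j ∈ Finset.range b,
      algebraMap k _ (p i j) * (AddMonoidAlgebra.single (1, 0) 1 - 1) ^ i *
        (AddMonoidAlgebra.single (0, 1) 1 - 1) ^ j)) =
      algebraMap (Polynomial k) (RatFunc k) (∑ i ∈ Finset.range b, ∑ j ∈ Finset.range b,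
        if i + j = i₀ + j₀ then Polynomial.monomial j (p i j) else 0) := by
    simp only [map_sum]
    refine Finset.sum_congr rfl fun i _ => Finset.sum_congr rfl fun j _ => ?_
    have h4 : arc k (algebraMap k _ (p i j) * (AddMonoidAlgebra.single (1, 0) 1 - 1) ^ i *
        (AddMonoidAlgebra.single (0, 1) 1 - 1) ^ j) =
        PowerSeries.C (algebraMap k (RatFunc k) (p i j) * RatFunc.X ^ j) *
          PowerSeries.X ^ (i + j) := by
      rw [map_mul, map_mul, map_pow, map_pow, arc_x_sub_one, arc_y_sub_one, AlgHom.commutes, mul_pow,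
        map_mul, map_pow, PowerSeries.algebraMap_apply, pow_add]
      ring
    rw [h4, PowerSeries.coeff_C_mul, PowerSeries.coeff_X_pow]
    by_cases h : i + j = i₀ + j₀
    · rw [if_pos h, if_pos h.symm, ← Polynomial.C_mul_X_pow_eq_monomial, mul_one, map_mul, map_pow,
        RatFunc.algebraMap_X, RatFunc.algebraMap_C, RatFunc.algebraMap_eq_C]
    · rw [if_neg h, if_neg (Ne.symm h), mul_zero, map_zero]
  rw [h3, ← map_zero (algebraMap (Polynomial k) (RatFunc k))] at h2
  have h4 := congrArg (Polynomial.coeff · j₀) (IsFractionRing.injective _ _ h2)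
  simp only [Polynomial.finsetSum_coeff, Polynomial.coeff_zero] at h4
  rw [Finset.sum_eq_single_of_mem i₀ (by simp; omega), Finset.sum_eq_single_of_mem j₀
    (by simp; omega)] at h4
  · simpa using h4
  · intro j _ hj
    rw [if_neg (by omega), Polynomial.coeff_zero]
  · intro i _ hi
    refine Finset.sum_eq_zero fun j _ => ?_
    split_ifs with h
    · rw [Polynomial.coeff_monomial, if_neg (by omega)]
    · simp

theorem mem_identityIdeal_pow_iff [CharZero k] {b : ℕ} {F : AddMonoidAlgebra k (ℤ × ℤ)} :
    F ∈ identityIdeal k ^ b ↔ VanishesToOrder b F :=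
  ⟨fun h => X_pow_dvd_arc_iff.1 (X_pow_dvd_arc h), mem_identityIdeal_pow_of_vanishesToOrder⟩

theorem isUnit_arc_iff [CharZero k] {F : AddMonoidAlgebra k (ℤ × ℤ)} :
    IsUnit (arc k F) ↔ F ∉ identityIdeal k := by
  rw [← pow_one (identityIdeal k), mem_identityIdeal_pow_iff, ← X_pow_dvd_arc_iff, pow_one,
    PowerSeries.X_dvd_iff, PowerSeries.isUnit_iff_constantCoeff, isUnit_iff_ne_zero]

theorem mem_identityIdeal_iff [CharZero k] {F : AddMonoidAlgebra k (ℤ × ℤ)} :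
    F ∈ identityIdeal k ↔ pairing (fun _ => 1) F = 0 := by
  rw [← pow_one (identityIdeal k), mem_identityIdeal_pow_iff]
  refine ⟨fun h => by simpa using h 0 0 one_pos, fun h i j hij => ?_⟩
  obtain ⟨rfl, rfl⟩ : i = 0 ∧ j = 0 := by omega
  simpa using h

end Arc

/-! ### Restriction to the curve `y = 1` and divisibility by `y - 1` -/

section Restriction

variable {k : Type u} [Field k]

/-- The restriction of Laurent polynomials to the curve `y = 1`. -/
def restrictCurve (k : Type u) [Field k] : AddMonoidAlgebra k (ℤ × ℤ) →+* AddMonoidAlgebra k ℤ :=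
  AddMonoidAlgebra.mapDomainRingHom k (AddMonoidHom.fst ℤ ℤ)

theorem coeff_restrictCurve (F : AddMonoidAlgebra k (ℤ × ℤ)) (x : ℤ) :
    (restrictCurve k F).coeff x = columnSum x F := by
  induction F using AddMonoidAlgebra.induction_linear with
  | zero => simp [columnSum]
  | add F G hF hG => rw [map_add, AddMonoidAlgebra.coeff_add, Finsupp.add_apply, hF, hG, columnSum,
      columnSum, columnSum, map_add]
  | single v c =>
    rw [columnSum, pairing_single, restrictCurve, AddMonoidAlgebra.mapDomainRingHom_apply,
      AddMonoidAlgebra.mapDomain_single, AddMonoidAlgebra.coeff_single, Finsupp.single_apply,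
      mul_ite, mul_one, mul_zero]
    rfl

theorem restrictCurve_eq_zero_iff {F : AddMonoidAlgebra k (ℤ × ℤ)} :
    restrictCurve k F = 0 ↔ ∀ x, columnSum x F = 0 := by
  rw [← AddMonoidAlgebra.coeff_eq_zero, Finsupp.ext_iff]
  simp [coeff_restrictCurve]

/-- Modulo `y - 1` every monomial `x^a y^b` equals `x^a`, so `F` is congruent to its restriction,
pulled back to the torus. -/
theorem ker_restrictCurve [CharZero k] :
    RingHom.ker (restrictCurve k) = Ideal.span {AddMonoidAlgebra.single (0, 1) 1 - 1} := by
  let ι : AddMonoidAlgebra k ℤ →+* AddMonoidAlgebra k (ℤ × ℤ) :=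
    AddMonoidAlgebra.mapDomainRingHom k (AddMonoidHom.inl ℤ ℤ)
  refine le_antisymm (fun F hF => ?_) ?_
  · have key (F) : F - ι (restrictCurve k F) ∈
        Ideal.span {(AddMonoidAlgebra.single (0, 1) 1 - 1 : AddMonoidAlgebra k (ℤ × ℤ))} := by
      induction F using AddMonoidAlgebra.induction_linear with
      | zero => simp
      | add F G hF hG => rw [map_add, map_add, add_sub_add_comm]; exact add_mem hF hG
      | single v c =>
        have h1 : ι (restrictCurve k (AddMonoidAlgebra.single v c)) =
            AddMonoidAlgebra.single (v.1, 0) c := by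
          rw [restrictCurve, AddMonoidAlgebra.mapDomainRingHom_apply,
            AddMonoidAlgebra.mapDomainRingHom_apply, AddMonoidAlgebra.mapDomain_single,
            AddMonoidAlgebra.mapDomain_single]
          rfl
        have h2 : AddMonoidAlgebra.single v c - AddMonoidAlgebra.single (v.1, 0) c =
            AddMonoidAlgebra.single (v.1, 0) c *
              (((monomialUnit k (.ofAdd (0, 1)) ^ v.2 : (AddMonoidAlgebra k (ℤ × ℤ))ˣ) :
                AddMonoidAlgebra k (ℤ × ℤ)) - 1) := by
          rw [← map_zpow, ← ofAdd_zsmul, coe_monomialUnit, mul_sub, mul_one,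
            AddMonoidAlgebra.single_mul_single]
          simp
        rw [h1, h2]
        refine Ideal.mul_mem_left _ _ (Ideal.mem_span_singleton.2 ?_)
        have := pow_dvd_zpow_sub_sum_choose (k := k) (monomialUnit k (.ofAdd (0, 1))) 1 v.2
        simp only [pow_one, Finset.sum_range_one, Ring.choose_zero_right, map_one, one_mul,
          pow_zero] at this
        exact this
    have := key F
    rwa [(RingHom.mem_ker).1 hF, map_zero, sub_zero] at this
  · rw [Ideal.span_singleton_le_iff_mem, RingHom.mem_ker]
    rw [map_sub, map_one, sub_eq_zero, restrictCurve, AddMonoidAlgebra.mapDomainRingHom_apply,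
      AddMonoidAlgebra.mapDomain_single]
    rfl

theorem prime_y_sub_one [CharZero k] : Prime (AddMonoidAlgebra.single (0, 1) 1 - 1 : AddMonoidAlgebra k (ℤ × ℤ)) := by
  have h0 : (AddMonoidAlgebra.single (0, 1) 1 - 1 : AddMonoidAlgebra k (ℤ × ℤ)) ≠ 0 := by
    rw [sub_ne_zero, AddMonoidAlgebra.one_def, ne_eq, AddMonoidAlgebra.single_inj]
    simp
  rw [← Ideal.span_singleton_prime h0, ← ker_restrictCurve]
  exact RingHom.ker_isPrime _

theorem y_sub_one_dvd_iff [CharZero k] {F : AddMonoidAlgebra k (ℤ × ℤ)} :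
    AddMonoidAlgebra.single (0, 1) 1 - 1 ∣ F ↔ ∀ x, columnSum x F = 0 := by
  rw [← Ideal.mem_span_singleton, ← ker_restrictCurve, RingHom.mem_ker, restrictCurve_eq_zero_iff]

end Restriction

/-! ### Orders of vanishing along prime divisors -/

section Ord

variable {X : Scheme.{u}} [IsIntegral X] [IsLocallyNoetherian X]

theorem eq_of_specializes_of_coheight {X : Scheme.{u}} {P Q : X} (h : Q ⤳ P) (hP : coheight P = 1)
    (hQ : coheight Q = 1) : P = Q := by
  by_contra hne
  have hlt : P < Q := ⟨h, fun h' => hne (Specializes.antisymm h' h).eq⟩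
  have := coheight_add_one_le hlt
  rw [hP, hQ] at this
  exact absurd this (by decide)

theorem algebraMap_stalk_injective {X : Scheme.{u}} [IsIntegral X] (P : X) :
    Function.Injective (algebraMap (X.presheaf.stalk P) X.functionField) :=
  IsFractionRing.injective _ _

/-- A point whose local ring has a nonzero principal maximal ideal has codimension one. -/
theorem coheight_eq_one_of_maximalIdeal_eq_span {P : X} {a : X.presheaf.stalk P} (ha : a ≠ 0)
    (h : IsLocalRing.maximalIdeal (X.presheaf.stalk P) = Ideal.span {a}) : coheight P = 1 := by
  refine le_antisymm ?_ ?_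
  · have h1 := ringKrullDim_le_spanFinrank_maximalIdeal (R := X.presheaf.stalk P)
    rw [ringKrullDim_stalk_eq_coheight, h] at h1
    have h2 := Submodule.spanFinrank_span_le_ncard_of_finite (R := X.presheaf.stalk P)
      (Set.finite_singleton a)
    rw [Set.ncard_singleton] at h2
    have h3 := h1.trans (Nat.cast_le.2 h2)
    exact_mod_cast h3
  · rw [Order.one_le_iff_ne_zero, ne_eq, coheight_eq_zero]
    intro hmax
    have h1 : P ⤳ genericPoint X := hmax (genericPoint_specializes P)
    obtain rfl : P = genericPoint X := (h1.antisymm (genericPoint_specializes P)).eq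
    have h2 : a ∈ IsLocalRing.maximalIdeal (X.presheaf.stalk (genericPoint X)) :=
      h ▸ Ideal.mem_span_singleton_self a
    rw [IsLocalRing.mem_maximalIdeal] at h2
    exact h2 (isUnit_iff_ne_zero.2 ha : IsUnit (a : X.functionField))

theorem ord_algebraMap_nonneg (P : X) (a : X.presheaf.stalk P) :
    0 ≤ Scheme.ord (algebraMap _ X.functionField a) P := by
  by_cases hP : coheight P = 1
  · have : Ring.KrullDimLE 1 (X.presheaf.stalk P) := krullDimLE_of_coheight_le hP.le
    by_cases ha : a = 0
    · simp [ha]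
    rw [Scheme.le_ord_iff hP (by simpa using ha)]
    exact Ring.ordFrac_ge_one_of_ne_zero ha
  · rw [Scheme.ord_eq_zero_of_coheight_neq_one hP]

theorem ord_algebraMap_eq_zero {P : X} {a : X.presheaf.stalk P} (ha : IsUnit a) :
    Scheme.ord (algebraMap _ X.functionField a) P = 0 := by
  obtain ⟨a, rfl⟩ := ha
  have h1 := ord_algebraMap_nonneg P (a : X.presheaf.stalk P)
  have h2 := ord_algebraMap_nonneg P ((a⁻¹ : (X.presheaf.stalk P)ˣ) : X.presheaf.stalk P)
  have h3 : Scheme.ord (algebraMap _ X.functionField (a : X.presheaf.stalk P) *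
      algebraMap _ X.functionField ((a⁻¹ : (X.presheaf.stalk P)ˣ) : X.presheaf.stalk P)) P = 0 := by
    rw [← map_mul, Units.mul_inv, map_one]
    have := Scheme.ord_mul (x := P) (one_ne_zero (α := X.functionField)) one_ne_zero
    rw [one_mul] at this
    omega
  rw [Scheme.ord_mul (by simp) (by simp)] at h3
  omega

theorem ord_algebraMap_pos {P : X} (hP : coheight P = 1) {a : X.presheaf.stalk P} (ha : a ≠ 0)
    (hu : ¬ IsUnit a) : 0 < Scheme.ord (algebraMap _ X.functionField a) P := by
  have : Ring.KrullDimLE 1 (X.presheaf.stalk P) := krullDimLE_of_coheight_le hP.le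
  refine lt_of_le_of_ne (ord_algebraMap_nonneg P a) fun h => hu ?_
  have h1 := (Scheme.ord_eq_iff hP (by simpa using ha)).1 h.symm
  change Ring.ordFrac (X.presheaf.stalk P) _ = _ at h1
  rw [Ring.ordFrac_eq_ord _ ha, ← Ring.ordMonoidWithZeroHom_eq_ordMonoidHom
    ⟨a, mem_nonZeroDivisors_of_ne_zero ha⟩] at h1
  have h2 : (Ring.ordMonoidHom (⟨a, mem_nonZeroDivisors_of_ne_zero ha⟩ :
      nonZeroDivisors (X.presheaf.stalk P))).toAdd = 0 := by
    have := Multiplicative.ofAdd.injective (WithZero.coe_injective h1)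
    exact_mod_cast this
  have h3 := Ring.ordMonoidHom_eq_ord (⟨a, mem_nonZeroDivisors_of_ne_zero ha⟩ :
      nonZeroDivisors (X.presheaf.stalk P))
  rw [h2, Nat.cast_zero, eq_comm, Ring.ord, Module.length_eq_zero_iff,
    Submodule.Quotient.subsingleton_iff] at h3
  exact Ideal.span_singleton_eq_top.1 h3

theorem ord_pow {P : X} {f : X.functionField} (hf : f ≠ 0) (n : ℕ) :
    Scheme.ord (f ^ n) P = n * Scheme.ord f P := by
  induction n with
  | zero =>
    have := Scheme.ord_mul (x := P) (one_ne_zero (α := X.functionField)) one_ne_zero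
    rw [one_mul] at this
    simp; omega
  | succ n ih => rw [pow_succ, Scheme.ord_mul (pow_ne_zero n hf) hf, ih]; push_cast; ring

theorem ord_zpow {P : X} {f : X.functionField} (hf : f ≠ 0) (n : ℤ) :
    Scheme.ord (f ^ n) P = n * Scheme.ord f P := by
  obtain ⟨n, rfl | rfl⟩ := n.eq_nat_or_neg
  · rw [zpow_natCast, ord_pow hf]
  · have := Scheme.ord_mul (x := P) (pow_ne_zero n hf) (inv_ne_zero (pow_ne_zero n hf))
    rw [mul_inv_cancel₀ (pow_ne_zero n hf), ← pow_zero f, ord_pow hf, ord_pow hf] at this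
    rw [zpow_neg, zpow_natCast]
    push_cast at this ⊢
    linarith

end Ord

/-! ### Inverse images of the ideal of a point -/

section InverseImage

variable {X Y Z : Scheme.{u}}

/-- Away from the closure of `y₀` the ideal is the unit ideal, generated by `1`. -/
theorem inverseImageIsInvertible_of_forall_not_specializes {y₀ : Y} (g : Z ⟶ Y)
    (h : ∀ z, ¬ y₀ ⤳ g z) : InverseImageIsInvertible (pointIdeal y₀) g := by
  intro z
  obtain ⟨_, ⟨V, hV, rfl⟩, hzV, hVc⟩ := Y.isBasis_affineOpens.exists_subset_of_mem_open
    (show g z ∈ ((closure {y₀})ᶜ : Set Y) from fun hz => h z (specializes_iff_mem_closure.2 hz))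
    isClosed_closure.isOpen_compl
  obtain ⟨_, ⟨U, hU, rfl⟩, hzU, hUV⟩ := Z.isBasis_affineOpens.exists_subset_of_mem_open
    (show z ∈ g ⁻¹ᵁ V from hzV) (g ⁻¹ᵁ V).2
  refine ⟨⟨V, hV⟩, ⟨U, hU⟩, hUV, hzU, 1, one_mem _, ?_⟩
  have : (pointIdeal y₀).ideal ⟨V, hV⟩ = ⊤ := by
    rw [pointIdeal, Scheme.IdealSheafData.vanishingIdeal_ideal, Ideal.eq_top_iff_one,
      PrimeSpectrum.mem_vanishingIdeal]
    exact fun x hx => absurd hx (hVc (hV.range_fromSpec ▸ ⟨x, rfl⟩))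
  rw [this, Ideal.map_top, Ideal.span_singleton_one]

theorem pointIdeal_ideal (y : Y) {V : Y.Opens} (hV : IsAffineOpen V) (hy : y ∈ V) :
    (pointIdeal y).ideal ⟨V, hV⟩ = (hV.primeIdealOf ⟨y, hy⟩).asIdeal := by
  rw [pointIdeal, Scheme.IdealSheafData.vanishingIdeal_ideal]
  ext f
  rw [PrimeSpectrum.mem_vanishingIdeal]
  refine ⟨fun h => h _ ?_, fun h p hp => ?_⟩
  · change hV.fromSpec _ ∈ closure {y}
    rw [IsAffineOpen.fromSpec_primeIdealOf]
    exact subset_closure rfl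
  · have h1 : hV.fromSpec (hV.primeIdealOf ⟨y, hy⟩) ⤳ hV.fromSpec p := by
      rw [IsAffineOpen.fromSpec_primeIdealOf]
      exact specializes_iff_mem_closure.2 hp
    exact (PrimeSpectrum.le_iff_specializes _ _).2
      (hV.fromSpec.isOpenEmbedding.isInducing.specializes_iff.1 h1) h

theorem map_germ_pointIdeal (y : Y) {V : Y.Opens} (hV : IsAffineOpen V) (hy : y ∈ V) :
    ((pointIdeal y).ideal ⟨V, hV⟩).map (Y.presheaf.germ V y hy).hom =
      IsLocalRing.maximalIdeal (Y.presheaf.stalk y) := by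
  rw [pointIdeal_ideal y hV hy]
  let := Y.presheaf.algebra_section_stalk ⟨y, hy⟩
  have := hV.isLocalization_stalk ⟨y, hy⟩
  exact IsLocalization.AtPrime.map_eq_maximalIdeal _ (Y.presheaf.stalk y)

theorem appLE_SpecMap_fromSpec {V : Y.Opens} (hV : IsAffineOpen V) {R : CommRingCat.{u}}
    (ψ : Γ(Y, V) ⟶ R) (g : Spec R ⟶ Y) (hg : g = Spec.map ψ ≫ hV.fromSpec) (e : ⊤ ≤ g ⁻¹ᵁ V) :
    g.appLE V ⊤ e = ψ ≫ (Scheme.ΓSpecIso R).inv := by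
  subst hg
  have e' : ⊤ ≤ Spec.map ψ ⁻¹ᵁ hV.fromSpec ⁻¹ᵁ V := e
  have h : (Spec.map ψ ≫ hV.fromSpec).appLE V ⊤ e =
      hV.fromSpec.app V ≫ (Spec.map ψ).appLE _ ⊤ e' := Scheme.Hom.comp_appLE ..
  rw [h, IsAffineOpen.fromSpec_app_self, Category.assoc,
    Scheme.ΓSpecIso_inv_naturality]
  refine congrArg ((Scheme.ΓSpecIso Γ(Y, V)).inv ≫ ·) ?_
  rw [Scheme.Hom.map_appLE]
  exact (congrArg ((Spec.map ψ).app ⊤ ≫ ·) ((Spec R).presheaf.map_id _)).trans (Category.comp_id _)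

/-- The spectrum of the local ring lands in every affine neighbourhood of `y`, so invertibility
reduces to principality of the extension of the maximal ideal. The separate `y`, equal to `y₀`,
avoids transport between stalks in applications with `y = π P`. -/
theorem inverseImageIsInvertible_SpecMap {y₀ y : Y} (hy : y = y₀) {R : CommRingCat.{u}}
    (θ : Y.presheaf.stalk y ⟶ R) {a : R} (ha : a ∈ nonZeroDivisors R)
    (h : (IsLocalRing.maximalIdeal (Y.presheaf.stalk y)).map θ.hom = Ideal.span {a}) :
    InverseImageIsInvertible (pointIdeal y₀) (Spec.map θ ≫ Y.fromSpecStalk y) := by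
  subst hy
  intro z
  obtain ⟨_, ⟨V, hV, rfl⟩, hyV, -⟩ := Y.isBasis_affineOpens.exists_subset_of_mem_open
    (Set.mem_univ y) isOpen_univ
  have e : ⊤ ≤ (Spec.map θ ≫ Y.fromSpecStalk y) ⁻¹ᵁ V := by
    intro x _
    have : Y.fromSpecStalk y (Spec.map θ x) ∈ Set.range (Y.fromSpecStalk y) := ⟨_, rfl⟩
    rw [Scheme.range_fromSpecStalk] at this
    exact this.mem_open V.2 hyV
  have key : (Spec.map θ ≫ Y.fromSpecStalk y).appLE V ⊤ e =
      Y.presheaf.germ V y hyV ≫ θ ≫ (Scheme.ΓSpecIso R).inv := by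
    rw [appLE_SpecMap_fromSpec hV (Y.presheaf.germ V y hyV ≫ θ) _ _ e, Category.assoc]
    have : Y.fromSpecStalk y = Spec.map (Y.presheaf.germ V y hyV) ≫ hV.fromSpec :=
      (hV.fromSpecStalk_eq_fromSpecStalk hyV).symm
    rw [Spec.map_comp, Category.assoc, this]
  refine ⟨⟨V, hV⟩, ⟨⊤, isAffineOpen_top _⟩, e, trivial, (Scheme.ΓSpecIso R).inv a, ?_, ?_⟩
  · rw [← MulEquivClass.map_nonZeroDivisors (Scheme.ΓSpecIso R).commRingCatIsoToRingEquiv.symm]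
    exact Submonoid.mem_map_of_mem _ ha
  · rw [key, CommRingCat.hom_comp, CommRingCat.hom_comp, ← Ideal.map_map, ← Ideal.map_map,
      map_germ_pointIdeal y hV, h, Ideal.map_span, Set.image_singleton]

theorem InverseImageIsInvertible.exists_map_stalkMap_eq {y₀ : Y} {g : Z ⟶ Y}
    (h : InverseImageIsInvertible (pointIdeal y₀) g) {z : Z} (hz : g z = y₀) :
    ∃ a ∈ nonZeroDivisors (Z.presheaf.stalk z),
      (IsLocalRing.maximalIdeal (Y.presheaf.stalk (g z))).map (g.stalkMap z).hom =
        Ideal.span {a} := by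
  subst hz
  obtain ⟨⟨V, hV⟩, U, e, hzU, a, ha, hVa⟩ := h z
  have hzV : g z ∈ V := e hzU
  refine ⟨Z.presheaf.germ U.1 z hzU a, ?_, ?_⟩
  · let := Z.presheaf.algebra_section_stalk ⟨z, hzU⟩
    have := U.2.isLocalization_stalk ⟨z, hzU⟩
    exact IsLocalization.map_nonZeroDivisors_le (U.2.primeIdealOf ⟨z, hzU⟩).asIdeal.primeCompl
      (Z.presheaf.stalk z) (Submonoid.mem_map_of_mem _ ha)
  · have key : Y.presheaf.germ V (g z) hzV ≫ g.stalkMap z =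
        g.appLE V U.1 e ≫ Z.presheaf.germ U.1 z hzU := by
      rw [Scheme.Hom.germ_stalkMap, Scheme.Hom.appLE, Category.assoc, TopCat.Presheaf.germ_res]
    rw [← map_germ_pointIdeal (g z) hV hzV, Ideal.map_map, ← CommRingCat.hom_comp, key,
      CommRingCat.hom_comp, ← Ideal.map_map, hVa, Ideal.map_span, Set.image_singleton]

end InverseImage

/-! ### Blowups of closed points -/

section Blowup

variable {X Y : Scheme.{u}} {π : X ⟶ Y} {y₀ : Y}

theorem IsBlowup.hom_ext {I : Y.IdealSheafData} (hπ : IsBlowup π I) {Z : Scheme.{u}} {f g : Z ⟶ X}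
    (h : f ≫ π = g ≫ π) (hf : InverseImageIsInvertible I (f ≫ π)) : f = g :=
  (hπ.existsUnique_lift _ hf).unique rfl h.symm

/-- The hypothesis `hy₀` says that `y₀` is closed; the points of the spectrum of the local ring at
`p ≠ y₀` are generizations of `p`, so none of them lies over `y₀`. -/
theorem inverseImageIsInvertible_SpecMap_of_ne (hy₀ : ∀ y, y₀ ⤳ y → y = y₀) {p : Y} (hp : p ≠ y₀)
    {R : CommRingCat.{u}} (θ : Y.presheaf.stalk p ⟶ R) :
    InverseImageIsInvertible (pointIdeal y₀) (Spec.map θ ≫ Y.fromSpecStalk p) := by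
  refine inverseImageIsInvertible_of_forall_not_specializes _ fun z hz => hp (hy₀ p (hz.trans ?_))
  have : Y.fromSpecStalk p (Spec.map θ z) ∈ Set.range (Y.fromSpecStalk p) := ⟨_, rfl⟩
  rwa [Scheme.range_fromSpecStalk] at this

theorem IsBlowup.exists_lift_fromSpecStalk (hπ : IsBlowup π (pointIdeal y₀))
    (hy₀ : ∀ y, y₀ ⤳ y → y = y₀) {p : Y} (hp : p ≠ y₀) :
    ∃ h : Spec (Y.presheaf.stalk p) ⟶ X, h ≫ π = Y.fromSpecStalk p := by
  have := inverseImageIsInvertible_SpecMap_of_ne hy₀ hp (𝟙 _)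
  rw [Spec.map_id, Category.id_comp] at this
  exact (hπ.existsUnique_lift _ this).exists

/-- Both morphisms lift the same morphism to `Y`, and lifts to the blowup are unique. Hence `P` is
the image of the closed point under the lift, which makes `π` injective away from `y₀`. -/
theorem IsBlowup.SpecMap_stalkMap_comp (hπ : IsBlowup π (pointIdeal y₀))
    (hy₀ : ∀ y, y₀ ⤳ y → y = y₀) {P : X} (hP : π P ≠ y₀)
    {h : Spec (Y.presheaf.stalk (π P)) ⟶ X} (hh : h ≫ π = Y.fromSpecStalk (π P)) :
    Spec.map (π.stalkMap P) ≫ h = X.fromSpecStalk P := by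
  have e : (Spec.map (π.stalkMap P) ≫ h) ≫ π = Spec.map (π.stalkMap P) ≫ Y.fromSpecStalk (π P) := by
    rw [Category.assoc, hh]
  refine hπ.hom_ext ?_ ?_
  · rw [e, Scheme.SpecMap_stalkMap_fromSpecStalk]
  · rw [e]
    exact inverseImageIsInvertible_SpecMap_of_ne hy₀ hP _

theorem IsBlowup.lift_closedPoint (hπ : IsBlowup π (pointIdeal y₀))
    (hy₀ : ∀ y, y₀ ⤳ y → y = y₀) {P : X} (hP : π P ≠ y₀)
    {h : Spec (Y.presheaf.stalk (π P)) ⟶ X} (hh : h ≫ π = Y.fromSpecStalk (π P)) :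
    h (IsLocalRing.closedPoint (Y.presheaf.stalk (π P))) = P := by
  have h1 := congrArg (fun f => f (IsLocalRing.closedPoint (X.presheaf.stalk P)))
    (hπ.SpecMap_stalkMap_comp hy₀ hP hh)
  simp only [Scheme.fromSpecStalk_closedPoint] at h1
  exact (congrArg h (IsLocalRing.comap_closedPoint (π.stalkMap P).hom).symm).trans h1

theorem IsBlowup.exists_eq (hπ : IsBlowup π (pointIdeal y₀))
    (hy₀ : ∀ y, y₀ ⤳ y → y = y₀) {p : Y} (hp : p ≠ y₀) : ∃ P, π P = p := by
  obtain ⟨h, hh⟩ := hπ.exists_lift_fromSpecStalk hy₀ hp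
  refine ⟨h (IsLocalRing.closedPoint (Y.presheaf.stalk p)), ?_⟩
  exact (congrArg (fun f : Spec (Y.presheaf.stalk p) ⟶ Y =>
    f (IsLocalRing.closedPoint (Y.presheaf.stalk p))) hh).trans Y.fromSpecStalk_closedPoint

theorem IsBlowup.eq_of_eq (hπ : IsBlowup π (pointIdeal y₀))
    (hy₀ : ∀ y, y₀ ⤳ y → y = y₀) {P P' : X} (hP : π P ≠ y₀) (h : π P = π P') : P = P' := by
  have key (p : Y) (hp : p ≠ y₀) : ∃ P₀, ∀ P, π P = p → P = P₀ := by
    obtain ⟨h, hh⟩ := hπ.exists_lift_fromSpecStalk hy₀ hp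
    refine ⟨h (IsLocalRing.closedPoint (Y.presheaf.stalk p)), ?_⟩
    rintro P rfl
    exact (hπ.lift_closedPoint hy₀ hp hh).symm
  obtain ⟨P₀, h₀⟩ := key _ hP
  rw [h₀ P rfl, h₀ P' h.symm]

/-- The lift of the spectrum of the local ring at `π P` sends the closed point to `P`, so it comes
from a map `r` of local rings. This stands in for the isomorphism away from the centre: it yields
surjectivity on stalks and the lifting of generizations. -/
theorem IsBlowup.exists_section_stalkMap (hπ : IsBlowup π (pointIdeal y₀))
    (hy₀ : ∀ y, y₀ ⤳ y → y = y₀) {P : X} (hP : π P ≠ y₀) :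
    ∃ r : X.presheaf.stalk P ⟶ Y.presheaf.stalk (π P), r ≫ π.stalkMap P = 𝟙 _ ∧
      Spec.map r ≫ X.fromSpecStalk P ≫ π = Y.fromSpecStalk (π P) := by
  obtain ⟨h, hh⟩ := hπ.exists_lift_fromSpecStalk hy₀ hP
  have h1 := hπ.SpecMap_stalkMap_comp hy₀ hP hh
  have h2 := hπ.lift_closedPoint hy₀ hP hh
  have h3 := Scheme.Spec_stalkClosedPointTo_fromSpecStalk h
  generalize Scheme.stalkClosedPointTo h = r at h3
  revert r
  rw [h2]
  intro r h3
  refine ⟨r, ?_, by rw [← Category.assoc, h3, hh]⟩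
  rw [← h3, ← Category.assoc, ← Spec.map_comp] at h1
  have h4 : Spec.map (r ≫ π.stalkMap P) = Spec.map (𝟙 _) := by
    rw [← cancel_mono (X.fromSpecStalk P), h1, Spec.map_id, Category.id_comp]
  exact Spec.map_injective h4

theorem IsBlowup.stalkMap_surjective (hπ : IsBlowup π (pointIdeal y₀))
    (hy₀ : ∀ y, y₀ ⤳ y → y = y₀) {P : X} (hP : π P ≠ y₀) :
    Function.Surjective (π.stalkMap P) := by
  obtain ⟨r, hr, -⟩ := hπ.exists_section_stalkMap hy₀ hP
  exact fun a => ⟨r a, by rw [← CommRingCat.comp_apply, hr]; rfl⟩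

theorem IsBlowup.exists_specializes (hπ : IsBlowup π (pointIdeal y₀))
    (hy₀ : ∀ y, y₀ ⤳ y → y = y₀) {P : X} (hP : π P ≠ y₀) {q : Y} (hq : q ⤳ π P) :
    ∃ Q, π Q = q ∧ Q ⤳ P := by
  obtain ⟨r, -, hr⟩ := hπ.exists_section_stalkMap hy₀ hP
  obtain ⟨z, rfl⟩ : q ∈ Set.range (Y.fromSpecStalk (π P)) := by
    rwa [Scheme.range_fromSpecStalk]
  refine ⟨X.fromSpecStalk P (Spec.map r z), ?_, ?_⟩
  · rw [← hr]; simp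
  · have : X.fromSpecStalk P (Spec.map r z) ∈ Set.range (X.fromSpecStalk P) := ⟨_, rfl⟩
    rwa [Scheme.range_fromSpecStalk] at this

/-- A local ring over the blown up point, with principal pullback of the maximal ideal, maps to
the blowup. If it and the local ring of `P` arise from a common ring `B`, with nested centers, then
its image specializes to `P`. -/
theorem IsBlowup.specializes_of_comap_le (hπ : IsBlowup π (pointIdeal y₀)) {P : X}
    (hP : π P = y₀) {B R : CommRingCat.{u}} [IsLocalRing R] (α : Y.presheaf.stalk (π P) ⟶ B)
    {ξ : B} (hξ : (IsLocalRing.maximalIdeal (Y.presheaf.stalk (π P))).map α.hom = Ideal.span {ξ})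
    (hξB : ξ ∈ nonZeroDivisors B)
    (βP : B ⟶ X.presheaf.stalk P) (hβP : α ≫ βP = π.stalkMap P)
    (hξP : βP ξ ∈ nonZeroDivisors (X.presheaf.stalk P))
    (βR : B ⟶ R) (hξR : βR ξ ∈ nonZeroDivisors R) (e : Spec R ⟶ X)
    (he : e ≫ π = Spec.map (α ≫ βR) ≫ Y.fromSpecStalk (π P))
    (hle : (IsLocalRing.maximalIdeal R).comap βR.hom ≤
      (IsLocalRing.maximalIdeal (X.presheaf.stalk P)).comap βP.hom) :
    e (IsLocalRing.closedPoint R) ⤳ P := by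
  obtain ⟨κ, hκ⟩ := (hπ.existsUnique_lift _ (inverseImageIsInvertible_SpecMap hP α hξB hξ)).exists
  -- Uniqueness of lifts: `κ` restricts to `e` on `Spec R` and to the canonical map on the spectrum
  -- of the local ring of `P`. The nesting of the centers in `Spec B` is then carried to `X` by
  -- continuity.
  have h1 : Spec.map βR ≫ κ = e := by
    have e1 : (Spec.map βR ≫ κ) ≫ π = Spec.map (α ≫ βR) ≫ Y.fromSpecStalk (π P) := by
      rw [Category.assoc, hκ, Spec.map_comp, Category.assoc]
    refine hπ.hom_ext (e1.trans he.symm) ?_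
    rw [e1]
    refine inverseImageIsInvertible_SpecMap hP _ hξR ?_
    rw [CommRingCat.hom_comp, ← Ideal.map_map, hξ, Ideal.map_span, Set.image_singleton]
  have h2 : Spec.map βP ≫ κ = X.fromSpecStalk P := by
    have e2 : (Spec.map βP ≫ κ) ≫ π = Spec.map (α ≫ βP) ≫ Y.fromSpecStalk (π P) := by
      rw [Category.assoc, hκ, Spec.map_comp, Category.assoc]
    refine hπ.hom_ext ?_ ?_
    · rw [e2, hβP, Scheme.SpecMap_stalkMap_fromSpecStalk]
    rw [e2]
    refine inverseImageIsInvertible_SpecMap hP _ hξP ?_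
    rw [CommRingCat.hom_comp, ← Ideal.map_map, hξ, Ideal.map_span, Set.image_singleton]
  have h3 : Spec.map βR (IsLocalRing.closedPoint R) ⤳
      Spec.map βP (IsLocalRing.closedPoint (X.presheaf.stalk P)) :=
    (PrimeSpectrum.le_iff_specializes _ _).1 hle
  have h4 : (Spec.map βR ≫ κ) (IsLocalRing.closedPoint R) ⤳
      (Spec.map βP ≫ κ) (IsLocalRing.closedPoint (X.presheaf.stalk P)) := h3.map κ.continuous
  rwa [h1, h2, Scheme.fromSpecStalk_closedPoint] at h4

end Blowup

/-! ### The homogeneous coordinate ring of the toric surface -/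

section ConeAlgebra

theorem uniqueFactorizationMonoid_laurent (R : Type*) [CommRing R] [IsDomain R]
    [UniqueFactorizationMonoid R] : UniqueFactorizationMonoid (LaurentPolynomial R) :=
  UniqueFactorizationMonoid.of_isLocalization (Submonoid.powers (Polynomial.X : Polynomial R)) _

/-- Unique factorization allows rational functions to be put in lowest terms, so that a denominator
shows up as a pole along a curve in the torus. -/
instance uniqueFactorizationMonoid_torus (k : Type u) [Field k] :
    UniqueFactorizationMonoid (AddMonoidAlgebra k (ℤ × ℤ)) := by
  have h1 := uniqueFactorizationMonoid_laurent k
  have h2 := uniqueFactorizationMonoid_laurent (LaurentPolynomial k)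
  exact (AddMonoidAlgebra.curryRingEquiv (R := k) (M := ℤ) (N := ℤ)).symm.toMulEquiv.uniqueFactorizationMonoid
    (hα := h2)

variable {s₁ s₂ s₃ : ℚ}

theorem mem_coneMonoid_iff (h₁₂ : s₁ < s₂) (h₂₃ : s₂ < s₃) {c : ℕ × ℤ × ℤ} :
    c ∈ coneMonoid s₁ s₂ s₃ ↔ c.2 ∈ trianglePoints s₁ s₂ s₃ c.1 := by
  obtain ⟨m, a, b⟩ := c
  change ((a : ℚ), (b : ℚ)) ∈ (m : ℚ) • triangle s₁ s₂ s₃ ↔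
    s₁ * a ≤ b ∧ s₃ * a ≤ b ∧ (b : ℚ) ≤ ((m : ℤ) : ℚ) + s₂ * a
  rw [Int.cast_natCast]
  rcases m.eq_zero_or_pos with rfl | hm
  · rw [Nat.cast_zero, Set.zero_smul_set ⟨(0, 0), by simp [triangle]⟩]
    refine ⟨fun h => ?_, fun ⟨h1, h3, h2⟩ => ?_⟩
    · rw [Set.mem_zero, Prod.mk_eq_zero] at h
      simp [h.1, h.2]
    · have ha : (a : ℚ) = 0 := by nlinarith
      rw [ha] at h1 h2
      have hb : (b : ℚ) = 0 := by linarith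
      simp [ha, hb]
  · have hm' : (0 : ℚ) < m := by exact_mod_cast hm
    rw [Set.mem_smul_set_iff_inv_smul_mem₀ hm'.ne']
    change s₁ * ((m : ℚ)⁻¹ * a) ≤ (m : ℚ)⁻¹ * b ∧ s₃ * ((m : ℚ)⁻¹ * a) ≤ (m : ℚ)⁻¹ * b ∧
      (m : ℚ)⁻¹ * b ≤ 1 + s₂ * ((m : ℚ)⁻¹ * a) ↔ _
    rw [mul_left_comm, mul_left_comm s₃, mul_left_comm s₂, mul_le_mul_iff_right₀ (by positivity),
      mul_le_mul_iff_right₀ (by positivity), ← mul_le_mul_iff_right₀ hm' (b := (m : ℚ)⁻¹ * b), mul_add,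
      mul_inv_cancel_left₀ hm'.ne', mul_inv_cancel_left₀ hm'.ne', mul_one]

/-- Translations of a finite set of lattice points into a multiple of the triangle. -/
theorem exists_translate_mem_trianglePoints (A : Finset (ℤ × ℤ)) (m₀ : ℕ) (w₀ : ℤ × ℤ)
    (h1 : s₁ * w₀.1 < w₀.2 ∨ s₁ * w₀.1 = w₀.2 ∧ ∀ v ∈ A, s₁ * v.1 ≤ v.2)
    (h3 : s₃ * w₀.1 < w₀.2 ∨ s₃ * w₀.1 = w₀.2 ∧ ∀ v ∈ A, s₃ * v.1 ≤ v.2)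
    (h2 : (w₀.2 : ℚ) < m₀ + s₂ * w₀.1 ∨ (w₀.2 : ℚ) = m₀ + s₂ * w₀.1 ∧
      ∀ v ∈ A, (v.2 : ℚ) ≤ s₂ * v.1) :
    ∃ N : ℕ, 1 ≤ N ∧ ∀ v ∈ A, N • w₀ + v ∈ trianglePoints s₁ s₂ s₃ ((N * m₀ : ℕ) : ℤ) := by
  -- For each side, either `w₀` is strictly inside and large multiples absorb any `v`, or `w₀` lies
  -- on the side and `v` already satisfies its homogeneous inequality.
  have key (x y : ℚ) (h : 0 < x ∨ x = 0 ∧ 0 ≤ y) : ∀ᶠ N : ℕ in Filter.atTop, 0 ≤ N * x + y := by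
    rcases h with h | ⟨rfl, h⟩
    · have := (tendsto_natCast_atTop_atTop (R := ℚ)).atTop_mul_const h
      filter_upwards [this.eventually_ge_atTop (-y)] with N hN
      linarith
    · simp [h]
  have h : ∀ᶠ N : ℕ in Filter.atTop,
      ∀ v ∈ A, N • w₀ + v ∈ trianglePoints s₁ s₂ s₃ ((N * m₀ : ℕ) : ℤ) := by
    rw [Filter.eventually_all_finset]
    intro v hv
    filter_upwards [key (w₀.2 - s₁ * w₀.1) (v.2 - s₁ * v.1)
      (h1.imp sub_pos.2 fun h => ⟨sub_eq_zero.2 h.1.symm, sub_nonneg.2 (h.2 v hv)⟩),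
      key (w₀.2 - s₃ * w₀.1) (v.2 - s₃ * v.1)
      (h3.imp sub_pos.2 fun h => ⟨sub_eq_zero.2 h.1.symm, sub_nonneg.2 (h.2 v hv)⟩),
      key (m₀ + s₂ * w₀.1 - w₀.2) (s₂ * v.1 - v.2)
      (h2.imp sub_pos.2 fun h => ⟨sub_eq_zero.2 h.1.symm, sub_nonneg.2 (h.2 v hv)⟩)] with N e1 e3 e2
    have f1 : (N • w₀ + v).1 = N * w₀.1 + v.1 := by
      rw [Prod.fst_add, Prod.smul_fst, nsmul_eq_mul]
    have f2 : (N • w₀ + v).2 = N * w₀.2 + v.2 := by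
      rw [Prod.snd_add, Prod.smul_snd, nsmul_eq_mul]
    refine ⟨?_, ?_, ?_⟩ <;> rw [f1, f2] <;> push_cast <;> linarith
  obtain ⟨N, hN, hN1⟩ := (h.and (Filter.eventually_ge_atTop 1)).exists
  exact ⟨N, hN1, hN⟩

end ConeAlgebra

/-! ### Homogeneous elements as Laurent polynomials -/

section Dehomogenize

variable {k : Type u} [Field k] {s₁ s₂ s₃ : ℚ}

variable (k s₁ s₂ s₃) in
/-- Dehomogenization: the monomial of degree `m` at `(a, b)` maps to `x^a y^b`. -/
def dehomogenize : AddMonoidAlgebra k (coneMonoid s₁ s₂ s₃) →+* AddMonoidAlgebra k (ℤ × ℤ) :=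
  AddMonoidAlgebra.mapDomainRingHom k
    ((AddMonoidHom.snd ℕ (ℤ × ℤ)).comp (coneMonoid s₁ s₂ s₃).subtype)

theorem dehomogenize_single (c : coneMonoid s₁ s₂ s₃) (r : k) :
    dehomogenize k s₁ s₂ s₃ (AddMonoidAlgebra.single c r) = AddMonoidAlgebra.single c.1.2 r := by
  rw [dehomogenize, AddMonoidAlgebra.mapDomainRingHom_apply, AddMonoidAlgebra.mapDomain_single]
  rfl

theorem degree_of_mem_support {m : ℕ} {F : AddMonoidAlgebra k (coneMonoid s₁ s₂ s₃)}
    (hF : F ∈ coneGrading k s₁ s₂ s₃ m) {c : coneMonoid s₁ s₂ s₃} (hc : c ∈ F.coeff.support) :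
    c.1.1 = m :=
  (AddMonoidAlgebra.mem_gradeBy_iff k _ _ _).1 hF hc

theorem single_mem_coneGrading (c : coneMonoid s₁ s₂ s₃) (r : k) :
    AddMonoidAlgebra.single c r ∈ coneGrading k s₁ s₂ s₃ c.1.1 :=
  AddMonoidAlgebra.single_mem_gradeBy (coneDegree s₁ s₂ s₃) _ _

/-- Within one degree `m`, distinct monomials have distinct exponents `(a, b)`; so dehomogenization
loses nothing on homogeneous elements. -/
theorem coeff_dehomogenize {m : ℕ} {F : AddMonoidAlgebra k (coneMonoid s₁ s₂ s₃)}
    (hF : F ∈ coneGrading k s₁ s₂ s₃ m) (c : coneMonoid s₁ s₂ s₃) (hc : c.1.1 = m) :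
    (dehomogenize k s₁ s₂ s₃ F).coeff c.1.2 = F.coeff c := by
  have h : F = ∑ d ∈ F.coeff.support, AddMonoidAlgebra.single d (F.coeff d) :=
    (AddMonoidAlgebra.sum_coeff_single F).symm
  conv_lhs => rw [h]
  rw [map_sum, AddMonoidAlgebra.coeff_sum, Finsupp.finsetSum_apply]
  simp only [dehomogenize_single, AddMonoidAlgebra.coeff_single]
  rw [Finset.sum_eq_single c]
  · simp
  · intro d hd hdc
    rw [Finsupp.single_eq_of_ne]
    intro h
    exact hdc (Subtype.ext (Prod.ext ((degree_of_mem_support hF hd).trans hc.symm) h.symm))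
  · intro h
    rw [Finsupp.notMem_support_iff.1 h, Finsupp.single_zero, Finsupp.zero_apply]

theorem exists_of_mem_support_dehomogenize {m : ℕ} {F : AddMonoidAlgebra k (coneMonoid s₁ s₂ s₃)}
    (hF : F ∈ coneGrading k s₁ s₂ s₃ m) {v : ℤ × ℤ}
    (hv : v ∈ (dehomogenize k s₁ s₂ s₃ F).coeff.support) :
    ∃ c ∈ F.coeff.support, c.1 = (m, v) := by
  obtain ⟨c, hc, rfl⟩ := Finset.mem_image.1 (Finsupp.mapDomain_support hv)
  exact ⟨c, hc, Prod.ext (degree_of_mem_support hF hc) rfl⟩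

theorem dehomogenize_eq_zero_iff {m : ℕ} {F : AddMonoidAlgebra k (coneMonoid s₁ s₂ s₃)}
    (hF : F ∈ coneGrading k s₁ s₂ s₃ m) : dehomogenize k s₁ s₂ s₃ F = 0 ↔ F = 0 := by
  refine ⟨fun h => ?_, fun h => by rw [h, map_zero]⟩
  by_contra hne
  obtain ⟨c, hc⟩ := Finsupp.support_nonempty_iff.2 (AddMonoidAlgebra.coeff_eq_zero.not.2 hne)
  refine Finsupp.mem_support_iff.1 hc ?_
  rw [← coeff_dehomogenize hF c (degree_of_mem_support hF hc), h]
  rfl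

theorem exists_homogenize {m : ℕ} {F : AddMonoidAlgebra k (ℤ × ℤ)}
    (hF : ∀ v ∈ F.coeff.support, ((m, v) : ℕ × ℤ × ℤ) ∈ coneMonoid s₁ s₂ s₃) :
    ∃ G ∈ coneGrading k s₁ s₂ s₃ m, dehomogenize k s₁ s₂ s₃ G = F := by
  classical
  refine ⟨∑ v : F.coeff.support, AddMonoidAlgebra.single ⟨(m, v.1), hF v.1 v.2⟩ (F.coeff v.1),
    Submodule.sum_mem _ fun v _ => single_mem_coneGrading _ _, ?_⟩
  rw [map_sum]
  simp only [dehomogenize_single]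
  rw [Finset.sum_coe_sort F.coeff.support fun v => AddMonoidAlgebra.single v (F.coeff v)]
  exact AddMonoidAlgebra.sum_coeff_single F

/-- The vertex `(0,0)` of the triangle, as a monomial of degree `1`. -/
def vertexMonomial (k : Type u) [Field k] (s₁ s₂ s₃ : ℚ) :
    AddMonoidAlgebra k (coneMonoid s₁ s₂ s₃) :=
  AddMonoidAlgebra.single ⟨(1, 0, 0), ⟨(0, 0), by simp [triangle], by simp⟩⟩ 1

theorem vertexMonomial_pow_mem (m : ℕ) :
    vertexMonomial k s₁ s₂ s₃ ^ m ∈ coneGrading k s₁ s₂ s₃ m := by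
  have := SetLike.pow_mem_graded m
    (single_mem_coneGrading (k := k) (⟨(1, 0, 0), ⟨(0, 0), by simp [triangle], by simp⟩⟩ :
      coneMonoid s₁ s₂ s₃) 1)
  rwa [smul_eq_mul, mul_one] at this

theorem dehomogenize_vertexMonomial :
    dehomogenize k s₁ s₂ s₃ (vertexMonomial k s₁ s₂ s₃) = 1 := dehomogenize_single _ _

theorem evalOne_eq_zero_iff [CharZero k] {m : ℕ} {F : AddMonoidAlgebra k (coneMonoid s₁ s₂ s₃)}
    (hF : F ∈ coneGrading k s₁ s₂ s₃ m) :
    evalOne k s₁ s₂ s₃ F = 0 ↔ dehomogenize k s₁ s₂ s₃ F ∈ identityIdeal k := by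
  have h : F = ∑ d ∈ F.coeff.support, AddMonoidAlgebra.single d (F.coeff d) :=
    (AddMonoidAlgebra.sum_coeff_single F).symm
  have h1 : evalOne k s₁ s₂ s₃ F =
      AddMonoidAlgebra.single m (∑ d ∈ F.coeff.support, F.coeff d) := by
    conv_lhs => rw [h]
    rw [map_sum]
    change _ = AddMonoidAlgebra.singleAddHom m _
    rw [map_sum]
    refine Finset.sum_congr rfl fun d hd => ?_
    rw [← degree_of_mem_support hF hd]
    exact AddMonoidAlgebra.mapDomain_single
  have h2 : pairing (fun _ => 1) (dehomogenize k s₁ s₂ s₃ F) = ∑ d ∈ F.coeff.support, F.coeff d := by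
    conv_lhs => rw [h]
    rw [map_sum, map_sum]
    refine Finset.sum_congr rfl fun d hd => ?_
    rw [dehomogenize_single, pairing_single, mul_one]
  rw [mem_identityIdeal_iff, h1, h2]
  exact AddMonoidAlgebra.single_eq_zero

end Dehomogenize

/-! ### Points of the toric surface -/

section ToricPoints

variable {k : Type u} [Field k] {s₁ s₂ s₃ : ℚ}

instance isDomain_coneAlgebra : IsDomain (AddMonoidAlgebra k (coneMonoid s₁ s₂ s₃)) := by
  refine Function.Injective.isDomain (AddMonoidAlgebra.mapDomainRingHom k
    (coneMonoid s₁ s₂ s₃).subtype : _ →+* AddMonoidAlgebra k (ℕ × ℤ × ℤ)) ?_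
  exact AddMonoidAlgebra.mapDomain_injective Subtype.val_injective

theorem toricSurface_specializes {p q : toricSurface k s₁ s₂ s₃}
    (h : ∀ m, ∀ F ∈ coneGrading k s₁ s₂ s₃ m, F ∈ p.asHomogeneousIdeal → F ∈ q.asHomogeneousIdeal) :
    p ⤳ q := by
  rw [specializes_iff_mem_closure]
  refine (ProjectiveSpectrum.le_iff_mem_closure _ p q).1 fun F hF => ?_
  refine (Ideal.IsHomogeneous.mem_iff _ q.asHomogeneousIdeal.isHomogeneous).2 fun i => ?_
  exact h i _ (SetLike.coe_mem _) (p.asHomogeneousIdeal.isHomogeneous i hF)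

theorem mem_of_toricSurface_specializes {p q : toricSurface k s₁ s₂ s₃} (h : p ⤳ q)
    {F : AddMonoidAlgebra k (coneMonoid s₁ s₂ s₃)} (hF : F ∈ p.asHomogeneousIdeal) :
    F ∈ q.asHomogeneousIdeal :=
  (ProjectiveSpectrum.le_iff_mem_closure _ p q).2 (specializes_iff_mem_closure.1 h) hF

/-- The point of the toric surface given by a homomorphism to a domain. -/
def conePoint {Q : Type*} [CommRing Q] [IsDomain Q]
    (ψ : AddMonoidAlgebra k (coneMonoid s₁ s₂ s₃) →+* Q)
    (hψ : ∃ m, 0 < m ∧ ∃ F ∈ coneGrading k s₁ s₂ s₃ m, ψ F ≠ 0) : toricSurface k s₁ s₂ s₃ where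
  asHomogeneousIdeal := (RingHom.ker ψ).homogeneousCore (coneGrading k s₁ s₂ s₃)
  isPrime := (RingHom.ker_isPrime ψ).homogeneousCore
  not_irrelevant_le h := by
    obtain ⟨m, hm, F, hF, hne⟩ := hψ
    exact hne (Ideal.toIdeal_homogeneousCore_le _ _ (h (HomogeneousIdeal.mem_irrelevant_of_mem _ hm hF)))

theorem mem_conePoint_iff {Q : Type*} [CommRing Q] [IsDomain Q]
    {ψ : AddMonoidAlgebra k (coneMonoid s₁ s₂ s₃) →+* Q}
    (hψ : ∃ m, 0 < m ∧ ∃ F ∈ coneGrading k s₁ s₂ s₃ m, ψ F ≠ 0) {m : ℕ}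
    {F : AddMonoidAlgebra k (coneMonoid s₁ s₂ s₃)} (hF : F ∈ coneGrading k s₁ s₂ s₃ m) :
    F ∈ (conePoint ψ hψ).asHomogeneousIdeal ↔ ψ F = 0 :=
  ⟨fun h => Ideal.toIdeal_homogeneousCore_le _ _ h,
    fun h => Ideal.mem_homogeneousCore_of_homogeneous_of_mem ⟨m, hF⟩ h⟩

theorem vertexMonomial_mem : vertexMonomial k s₁ s₂ s₃ ∈ coneGrading k s₁ s₂ s₃ 1 := by
  simpa using vertexMonomial_pow_mem (k := k) (s₁ := s₁) (s₂ := s₂) (s₃ := s₃) 1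

/-- The point of the torus given by a prime Laurent polynomial. -/
def torusPoint (s₁ s₂ s₃ : ℚ) {f : AddMonoidAlgebra k (ℤ × ℤ)} (hf : Prime f) :
    toricSurface k s₁ s₂ s₃ :=
  have := (Ideal.span_singleton_prime hf.ne_zero).2 hf
  conePoint ((Ideal.Quotient.mk (Ideal.span {f})).comp (dehomogenize k s₁ s₂ s₃))
    ⟨1, one_pos, _, vertexMonomial_mem, by
      rw [RingHom.comp_apply, dehomogenize_vertexMonomial, map_one]; exact one_ne_zero⟩

theorem mem_torusPoint_iff {f : AddMonoidAlgebra k (ℤ × ℤ)} (hf : Prime f) {m : ℕ}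
    {F : AddMonoidAlgebra k (coneMonoid s₁ s₂ s₃)} (hF : F ∈ coneGrading k s₁ s₂ s₃ m) :
    F ∈ (torusPoint s₁ s₂ s₃ hf).asHomogeneousIdeal ↔ f ∣ dehomogenize k s₁ s₂ s₃ F := by
  have := (Ideal.span_singleton_prime hf.ne_zero).2 hf
  refine (mem_conePoint_iff (ψ := (Ideal.Quotient.mk (Ideal.span {f})).comp
    (dehomogenize k s₁ s₂ s₃)) ⟨1, one_pos, _, vertexMonomial_mem, by
      rw [RingHom.comp_apply, dehomogenize_vertexMonomial, map_one]; exact one_ne_zero⟩ hF).trans ?_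
  rw [RingHom.comp_apply, Ideal.Quotient.eq_zero_iff_mem, Ideal.mem_span_singleton]

/-- The generic point of the toric surface. -/
def toricGenericPoint (k : Type u) [Field k] (s₁ s₂ s₃ : ℚ) : toricSurface k s₁ s₂ s₃ :=
  conePoint (dehomogenize k s₁ s₂ s₃) ⟨1, one_pos, _, vertexMonomial_mem, by
      rw [dehomogenize_vertexMonomial]; exact one_ne_zero⟩

theorem mem_toricGenericPoint_iff {m : ℕ}
    {F : AddMonoidAlgebra k (coneMonoid s₁ s₂ s₃)} (hF : F ∈ coneGrading k s₁ s₂ s₃ m) :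
    F ∈ (toricGenericPoint k s₁ s₂ s₃).asHomogeneousIdeal ↔ F = 0 :=
  (mem_conePoint_iff _ hF).trans (dehomogenize_eq_zero_iff hF)

/-- The projection of the semigroup algebra of a cone to that of a face, on which the nonnegative
linear form `c m + l(v)` vanishes. -/
def faceHom (k : Type u) [Field k] (l : ℤ × ℤ →+ ℤ) (c : ℕ)
    (hl : ∀ z ∈ coneMonoid s₁ s₂ s₃, 0 ≤ c * (z.1 : ℤ) + l z.2) :
    AddMonoidAlgebra k (coneMonoid s₁ s₂ s₃) →+* AddMonoidAlgebra k (coneMonoid s₁ s₂ s₃) :=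
  (AddMonoidAlgebra.lift k (AddMonoidAlgebra k (coneMonoid s₁ s₂ s₃)) (coneMonoid s₁ s₂ s₃)
    { toFun := fun z => if c * (z.toAdd.1.1 : ℤ) + l z.toAdd.1.2 = 0 then
        AddMonoidAlgebra.single z.toAdd 1 else 0
      map_one' := by
        rw [if_pos]
        · rfl
        · change (c : ℤ) * ((0 : ℕ) : ℤ) + l 0 = 0
          simp
      map_mul' := fun z w => by
        have hz := hl _ z.toAdd.2
        have hw := hl _ w.toAdd.2
        have e : c * ((z * w).toAdd.1.1 : ℤ) + l (z * w).toAdd.1.2 =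
            (c * (z.toAdd.1.1 : ℤ) + l z.toAdd.1.2) + (c * (w.toAdd.1.1 : ℤ) + l w.toAdd.1.2) := by
          change c * ((z.toAdd.1.1 + w.toAdd.1.1 : ℕ) : ℤ) + l (z.toAdd.1.2 + w.toAdd.1.2) = _
          rw [map_add]; push_cast; ring
        rw [e]
        by_cases h1 : c * (z.toAdd.1.1 : ℤ) + l z.toAdd.1.2 = 0
        · by_cases h2 : c * (w.toAdd.1.1 : ℤ) + l w.toAdd.1.2 = 0
          · rw [if_pos h1, if_pos h2, if_pos (by omega), AddMonoidAlgebra.single_mul_single, mul_one]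
            rfl
          · rw [if_neg h2, if_neg (by omega), mul_zero]
        · rw [if_neg h1, if_neg (by omega), zero_mul] }).toRingHom

theorem faceHom_single (l : ℤ × ℤ →+ ℤ) (c : ℕ)
    (hl : ∀ z ∈ coneMonoid s₁ s₂ s₃, 0 ≤ c * (z.1 : ℤ) + l z.2) (z : coneMonoid s₁ s₂ s₃) (r : k) :
    faceHom k l c hl (AddMonoidAlgebra.single z r) =
      if c * (z.1.1 : ℤ) + l z.1.2 = 0 then AddMonoidAlgebra.single z r else 0 := by
  refine (AddMonoidAlgebra.lift_single _ _ _).trans ?_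
  simp only [MonoidHom.coe_mk, OneHom.coe_mk, toAdd_ofAdd]
  split_ifs
  · rw [AddMonoidAlgebra.smul_single, smul_eq_mul, mul_one]
  · rw [smul_zero]

theorem coeff_faceHom (l : ℤ × ℤ →+ ℤ) (c : ℕ)
    (hl : ∀ z ∈ coneMonoid s₁ s₂ s₃, 0 ≤ c * (z.1 : ℤ) + l z.2)
    (F : AddMonoidAlgebra k (coneMonoid s₁ s₂ s₃)) (z : coneMonoid s₁ s₂ s₃) :
    (faceHom k l c hl F).coeff z = if c * (z.1.1 : ℤ) + l z.1.2 = 0 then F.coeff z else 0 := by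
  induction F using AddMonoidAlgebra.induction_linear with
  | zero => simp
  | add F G hF hG =>
    rw [map_add, AddMonoidAlgebra.coeff_add, AddMonoidAlgebra.coeff_add, Finsupp.add_apply, hF, hG,
      Finsupp.add_apply]
    split_ifs <;> simp
  | single w r =>
    rw [faceHom_single]
    by_cases hwz : w = z
    · subst hwz
      split_ifs <;> simp
    · have : (AddMonoidAlgebra.single w r).coeff z = 0 := by
        rw [AddMonoidAlgebra.coeff_single, Finsupp.single_eq_of_ne (Ne.symm hwz)]
      rw [this, ite_self]
      split_ifs
      · exact this
      · rfl

theorem faceHom_eq_zero_iff (l : ℤ × ℤ →+ ℤ) (c : ℕ)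
    (hl : ∀ z ∈ coneMonoid s₁ s₂ s₃, 0 ≤ c * (z.1 : ℤ) + l z.2) {m : ℕ}
    {F : AddMonoidAlgebra k (coneMonoid s₁ s₂ s₃)} (hF : F ∈ coneGrading k s₁ s₂ s₃ m) :
    faceHom k l c hl F = 0 ↔
      ∀ v ∈ (dehomogenize k s₁ s₂ s₃ F).coeff.support, 0 < c * (m : ℤ) + l v := by
  rw [← AddMonoidAlgebra.coeff_eq_zero, Finsupp.ext_iff]
  simp only [coeff_faceHom]
  refine ⟨fun h v hv => ?_, fun h z => ?_⟩
  · obtain ⟨z, hz, hzv⟩ := exists_of_mem_support_dehomogenize hF hv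
    have h1 := h z
    have h2 := hl _ z.2
    rw [hzv] at h1 h2
    refine lt_of_le_of_ne h2 fun h3 => ?_
    rw [if_pos h3.symm] at h1
    exact Finsupp.mem_support_iff.1 hz h1
  · split_ifs with h1
    · by_contra h2
      have h3 := degree_of_mem_support hF (Finsupp.mem_support_iff.2 h2)
      have h4 := h z.1.2 (by
        rw [Finsupp.mem_support_iff, coeff_dehomogenize hF z h3]; exact h2)
      rw [h3] at h1
      exact h4.ne' h1
    · rfl

theorem mem_torusIdentity_iff [CharZero k] {m : ℕ} {F : AddMonoidAlgebra k (coneMonoid s₁ s₂ s₃)}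
    (hF : F ∈ coneGrading k s₁ s₂ s₃ m) : F ∈ (torusIdentity k s₁ s₂ s₃).asHomogeneousIdeal ↔
      dehomogenize k s₁ s₂ s₃ F ∈ identityIdeal k :=
  evalOne_eq_zero_iff hF

/-- The identity is a closed point. If a homogeneous `F` of degree `m` in the ideal of `p` had value
`c ≠ 0` at `(1,1)`, then `F - c T^m` with `T` the vertex monomial would be there too, hence `T`.
Subtracting multiples of powers of `T`, all elements of positive degree would follow, which is
excluded in `Proj`. -/
theorem eq_torusIdentity_of_specializes [CharZero k] {p : toricSurface k s₁ s₂ s₃}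
    (h : torusIdentity k s₁ s₂ s₃ ⤳ p) : p = torusIdentity k s₁ s₂ s₃ := by
  refine (Specializes.antisymm (toricSurface_specializes fun m F hF hFp => ?_) h).eq
  rw [mem_torusIdentity_iff hF, mem_identityIdeal_iff]
  by_contra hne
  set c := pairing (fun _ => 1) (dehomogenize k s₁ s₂ s₃ F)
  have hT : vertexMonomial k s₁ s₂ s₃ ∈ p.asHomogeneousIdeal := by
    have h1 : F - algebraMap k _ c * vertexMonomial k s₁ s₂ s₃ ^ m ∈ p.asHomogeneousIdeal := by
      refine mem_of_toricSurface_specializes h ((mem_torusIdentity_iff (m := m) ?_).2 ?_)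
      · refine sub_mem hF ?_
        rw [← Algebra.smul_def]
        exact Submodule.smul_mem _ _ (vertexMonomial_pow_mem m)
      · have e : dehomogenize k s₁ s₂ s₃ (algebraMap k _ c) = AddMonoidAlgebra.single 0 c :=
          dehomogenize_single _ _
        rw [mem_identityIdeal_iff, map_sub, map_mul, map_pow, dehomogenize_vertexMonomial, one_pow,
          mul_one, e, map_sub, pairing_single, mul_one, sub_self]
    have h2 := p.asHomogeneousIdeal.toIdeal.sub_mem hFp h1
    rw [sub_sub_cancel] at h2
    have h3 : vertexMonomial k s₁ s₂ s₃ ^ m ∈ p.asHomogeneousIdeal.toIdeal := by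
      refine (p.isPrime.mem_or_mem h2).resolve_left fun h4 => p.isPrime.ne_top ?_
      exact Ideal.eq_top_of_isUnit_mem _ h4 ((isUnit_iff_ne_zero.2 hne).map _)
    exact p.isPrime.mem_of_pow_mem _ h3
  refine p.not_irrelevant_le fun G hG => ?_
  refine (Ideal.IsHomogeneous.mem_iff _ p.asHomogeneousIdeal.isHomogeneous).2 fun i => ?_
  rcases i.eq_zero_or_pos with rfl | hi
  · rw [HomogeneousIdeal.mem_irrelevant_iff] at hG
    rw [GradedRing.proj_apply] at hG
    rw [hG]
    exact zero_mem _
  · generalize hG' : ((DirectSum.decompose (coneGrading k s₁ s₂ s₃) G i :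
      coneGrading k s₁ s₂ s₃ i) : AddMonoidAlgebra k (coneMonoid s₁ s₂ s₃)) = G'
    have hGi : G' ∈ coneGrading k s₁ s₂ s₃ i := hG' ▸ SetLike.coe_mem _
    set c := pairing (fun _ => 1) (dehomogenize k s₁ s₂ s₃ G')
    have h1 : G' - algebraMap k _ c * vertexMonomial k s₁ s₂ s₃ ^ i ∈ p.asHomogeneousIdeal := by
      refine mem_of_toricSurface_specializes h ((mem_torusIdentity_iff (m := i) ?_).2 ?_)
      · refine sub_mem hGi ?_
        rw [← Algebra.smul_def]
        exact Submodule.smul_mem _ _ (vertexMonomial_pow_mem i)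
      · have e : dehomogenize k s₁ s₂ s₃ (algebraMap k _ c) = AddMonoidAlgebra.single 0 c :=
          dehomogenize_single _ _
        rw [mem_identityIdeal_iff, map_sub, map_mul, map_pow, dehomogenize_vertexMonomial, one_pow,
          mul_one, e, map_sub, pairing_single, mul_one, sub_self]
    have h2 : algebraMap k _ c * vertexMonomial k s₁ s₂ s₃ ^ i ∈ p.asHomogeneousIdeal.toIdeal :=
      Ideal.mul_mem_left _ _ (Ideal.pow_mem_of_mem _ hT _ hi)
    have h3 := p.asHomogeneousIdeal.toIdeal.add_mem h1 h2
    rwa [sub_add_cancel] at h3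

/-- A common monomial turns two Laurent polynomials into homogeneous elements of the same degree, so
their quotient becomes a germ on the toric surface. At points of the torus the choice `m₀ = 2`, `w₀
= (0,1)`, an interior point of `2Δ`, always works. -/
theorem exists_homogenize_translate (h₁₂ : s₁ < s₂) (h₂₃ : s₂ < s₃)
    (F G : AddMonoidAlgebra k (ℤ × ℤ)) (m₀ : ℕ) (w₀ : ℤ × ℤ)
    (h1 : s₁ * w₀.1 < w₀.2 ∨ s₁ * w₀.1 = w₀.2 ∧
      ∀ v ∈ F.coeff.support ∪ G.coeff.support, s₁ * v.1 ≤ v.2)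
    (h3 : s₃ * w₀.1 < w₀.2 ∨ s₃ * w₀.1 = w₀.2 ∧
      ∀ v ∈ F.coeff.support ∪ G.coeff.support, s₃ * v.1 ≤ v.2)
    (h2 : (w₀.2 : ℚ) < m₀ + s₂ * w₀.1 ∨ (w₀.2 : ℚ) = m₀ + s₂ * w₀.1 ∧
      ∀ v ∈ F.coeff.support ∪ G.coeff.support, (v.2 : ℚ) ≤ s₂ * v.1) :
    ∃ N : ℕ, 1 ≤ N ∧ (∃ F' ∈ coneGrading k s₁ s₂ s₃ (N * m₀),
        dehomogenize k s₁ s₂ s₃ F' = AddMonoidAlgebra.single (N • w₀) 1 * F) ∧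
      ∃ G' ∈ coneGrading k s₁ s₂ s₃ (N * m₀),
        dehomogenize k s₁ s₂ s₃ G' = AddMonoidAlgebra.single (N • w₀) 1 * G := by
  classical
  obtain ⟨N, hN, h⟩ := exists_translate_mem_trianglePoints _ m₀ w₀ h1 h3 h2
  have key (H : AddMonoidAlgebra k (ℤ × ℤ))
      (hH : H.coeff.support ⊆ F.coeff.support ∪ G.coeff.support) :
      ∀ v ∈ (AddMonoidAlgebra.single (N • w₀) 1 * H).coeff.support,
        ((N * m₀, v) : ℕ × ℤ × ℤ) ∈ coneMonoid s₁ s₂ s₃ := by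
    intro v hv
    rw [Finsupp.mem_support_iff, AddMonoidAlgebra.coeff_single_mul_apply, one_mul,
      ← Finsupp.mem_support_iff] at hv
    have h4 := h _ (hH hv)
    rw [add_neg_cancel_left] at h4
    exact (mem_coneMonoid_iff h₁₂ h₂₃).2 h4
  exact ⟨N, hN, exists_homogenize (key F Finset.subset_union_left),
    exists_homogenize (key G Finset.subset_union_right)⟩

theorem isUnit_single (v : ℤ × ℤ) :
    IsUnit (AddMonoidAlgebra.single v 1 : AddMonoidAlgebra k (ℤ × ℤ)) := by
  rw [← coe_monomialUnit]
  exact Units.isUnit _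

/-- No prime divides both `x - 1` and `y - 1`: it would be associated to `y - 1`, but `x - 1` does
not vanish on `y = 1`. -/
theorem torusPoint_ne_torusIdentity [CharZero k] (h₁₂ : s₁ < s₂) (h₂₃ : s₂ < s₃)
    {f : AddMonoidAlgebra k (ℤ × ℤ)} (hf : Prime f) :
    torusPoint s₁ s₂ s₃ hf ≠ torusIdentity k s₁ s₂ s₃ := by
  intro h
  have hx : (AddMonoidAlgebra.single (1, 0) 1 - 1 : AddMonoidAlgebra k (ℤ × ℤ)) ∈ identityIdeal k :=
    Ideal.subset_span (by simp)
  have hy : (AddMonoidAlgebra.single (0, 1) 1 - 1 : AddMonoidAlgebra k (ℤ × ℤ)) ∈ identityIdeal k :=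
    Ideal.subset_span (by simp)
  obtain ⟨N, -, ⟨F, hF, hF'⟩, G, hG, hG'⟩ := exists_homogenize_translate h₁₂ h₂₃
    (AddMonoidAlgebra.single (1, 0) 1 - 1 : AddMonoidAlgebra k (ℤ × ℤ))
    (AddMonoidAlgebra.single (0, 1) 1 - 1) 2 (0, 1)
    (Or.inl (by simp)) (Or.inl (by simp)) (Or.inl (by norm_num))
  have hFt := (mem_torusIdentity_iff hF).2 (by rw [hF']; exact Ideal.mul_mem_left _ _ hx)
  have hGt := (mem_torusIdentity_iff hG).2 (by rw [hG']; exact Ideal.mul_mem_left _ _ hy)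
  rw [← h, mem_torusPoint_iff hf hF, hF', (isUnit_single _).dvd_mul_left] at hFt
  rw [← h, mem_torusPoint_iff hf hG, hG', (isUnit_single _).dvd_mul_left] at hGt
  have h1 := (((hf.dvd_prime_iff_associated prime_y_sub_one).1 hGt).symm.dvd.trans hFt)
  have h2 := y_sub_one_dvd_iff.1 h1 1
  simp [columnSum, pairing_single, AddMonoidAlgebra.one_def] at h2

end ToricPoints

/-! ### Fractions of homogeneous elements -/

section ToricFraction

variable {k : Type u} [Field k] {s₁ s₂ s₃ : ℚ}

/-- The germ at a point `p` of the toric surface of a fraction of homogeneous elements of the same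
degree. -/
def toricFraction (p : toricSurface k s₁ s₂ s₃) {m : ℕ}
    {F G : AddMonoidAlgebra k (coneMonoid s₁ s₂ s₃)} (hF : F ∈ coneGrading k s₁ s₂ s₃ m)
    (hG : G ∈ coneGrading k s₁ s₂ s₃ m) (hGp : G ∉ p.asHomogeneousIdeal) :
    (toricSurface k s₁ s₂ s₃).presheaf.stalk p :=
  (Proj.stalkIso' (coneGrading k s₁ s₂ s₃) p).symm
    (HomogeneousLocalization.mk ⟨m, ⟨F, hF⟩, ⟨G, hG⟩, hGp⟩)

variable {p : toricSurface k s₁ s₂ s₃} {m m' : ℕ}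
  {F G F' G' : AddMonoidAlgebra k (coneMonoid s₁ s₂ s₃)}

theorem stalkSpecializes_toricFraction {q : toricSurface k s₁ s₂ s₃} (h : q ⤳ p)
    (hF : F ∈ coneGrading k s₁ s₂ s₃ m) (hG : G ∈ coneGrading k s₁ s₂ s₃ m)
    (hGp : G ∉ p.asHomogeneousIdeal) (hGq : G ∉ q.asHomogeneousIdeal) :
    ((toricSurface k s₁ s₂ s₃).presheaf.stalkSpecializes h).hom (toricFraction p hF hG hGp) =
      toricFraction q hF hG hGq :=
  TopCat.Presheaf.germ_stalkSpecializes_apply (toricSurface k s₁ s₂ s₃).presheaf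
    (U := ProjectiveSpectrum.basicOpen (coneGrading k s₁ s₂ s₃) G) hGp h _

theorem exists_toricFraction_eq (a : (toricSurface k s₁ s₂ s₃).presheaf.stalk p) :
    ∃ (m : ℕ) (F G : AddMonoidAlgebra k (coneMonoid s₁ s₂ s₃)) (hF : F ∈ coneGrading k s₁ s₂ s₃ m)
      (hG : G ∈ coneGrading k s₁ s₂ s₃ m) (hGp : G ∉ p.asHomogeneousIdeal),
      toricFraction p hF hG hGp = a := by
  obtain ⟨⟨m, ⟨F, hF⟩, ⟨G, hG⟩, h⟩, hc⟩ := HomogeneousLocalization.mk_surjective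
    (Proj.stalkIso' (coneGrading k s₁ s₂ s₃) p a)
  refine ⟨m, F, G, hF, hG, h, ?_⟩
  exact (RingEquiv.symm_apply_eq _).2 hc

theorem toricFraction_eq_iff (hF : F ∈ coneGrading k s₁ s₂ s₃ m)
    (hG : G ∈ coneGrading k s₁ s₂ s₃ m) (hGp : G ∉ p.asHomogeneousIdeal)
    (hF' : F' ∈ coneGrading k s₁ s₂ s₃ m') (hG' : G' ∈ coneGrading k s₁ s₂ s₃ m')
    (hGp' : G' ∉ p.asHomogeneousIdeal) :
    toricFraction p hF hG hGp = toricFraction p hF' hG' hGp' ↔ F * G' = F' * G := by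
  refine (RingEquiv.injective _).eq_iff.trans ?_
  have := p.isPrime
  rw [HomogeneousLocalization.ext_iff_val, HomogeneousLocalization.val_mk,
    HomogeneousLocalization.val_mk, Localization.mk_eq_mk_iff, Localization.r_iff_exists]
  constructor
  · rintro ⟨c, hc⟩
    have h0 : (c : AddMonoidAlgebra k (coneMonoid s₁ s₂ s₃)) ≠ 0 := fun h => c.2 (h ▸ zero_mem _)
    have := mul_left_cancel₀ h0 hc
    rw [mul_comm F, mul_comm F']
    exact this
  · intro h
    refine ⟨1, ?_⟩
    change 1 * (G' * F) = 1 * (G * F')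
    rw [mul_comm G', h, mul_comm F']

theorem toricFraction_mul (hF : F ∈ coneGrading k s₁ s₂ s₃ m)
    (hG : G ∈ coneGrading k s₁ s₂ s₃ m) (hGp : G ∉ p.asHomogeneousIdeal)
    (hF' : F' ∈ coneGrading k s₁ s₂ s₃ m') (hG' : G' ∈ coneGrading k s₁ s₂ s₃ m')
    (hGp' : G' ∉ p.asHomogeneousIdeal) :
    toricFraction p hF hG hGp * toricFraction p hF' hG' hGp' =
      toricFraction p (SetLike.mul_mem_graded hF hF') (SetLike.mul_mem_graded hG hG')
        (fun h => (p.isPrime.mem_or_mem h).elim hGp hGp') :=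
  (map_mul (Proj.stalkIso' (coneGrading k s₁ s₂ s₃) p).symm _ _).symm

theorem toricFraction_add (hF : F ∈ coneGrading k s₁ s₂ s₃ m)
    (hG : G ∈ coneGrading k s₁ s₂ s₃ m) (hGp : G ∉ p.asHomogeneousIdeal)
    (hF' : F' ∈ coneGrading k s₁ s₂ s₃ m') (hG' : G' ∈ coneGrading k s₁ s₂ s₃ m')
    (hGp' : G' ∉ p.asHomogeneousIdeal) :
    toricFraction p hF hG hGp + toricFraction p hF' hG' hGp' =
      toricFraction p (add_mem (SetLike.mul_mem_graded hF hG')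
          (add_comm m' m ▸ SetLike.mul_mem_graded hF' hG)) (SetLike.mul_mem_graded hG hG')
        (fun h => (p.isPrime.mem_or_mem h).elim hGp hGp') := by
  refine (map_add (Proj.stalkIso' (coneGrading k s₁ s₂ s₃) p).symm _ _).symm.trans ?_
  refine congrArg _ ?_
  have := p.isPrime
  rw [HomogeneousLocalization.ext_iff_val, HomogeneousLocalization.val_add,
    HomogeneousLocalization.val_mk,
    HomogeneousLocalization.val_mk, HomogeneousLocalization.val_mk, Localization.add_mk]
  congr 1
  change G * F' + G' * F = F * G' + F' * G
  ring

theorem toricFraction_self (hG : G ∈ coneGrading k s₁ s₂ s₃ m) (hGp : G ∉ p.asHomogeneousIdeal) :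
    toricFraction p hG hG hGp = 1 := by
  refine (congrArg (Proj.stalkIso' (coneGrading k s₁ s₂ s₃) p).symm ?_).trans (map_one (Proj.stalkIso' (coneGrading k s₁ s₂ s₃) p).symm)
  have := p.isPrime
  rw [HomogeneousLocalization.ext_iff_val, HomogeneousLocalization.val_mk,
    HomogeneousLocalization.val_one]
  exact Localization.mk_self (⟨G, hGp⟩ : p.asHomogeneousIdeal.toIdeal.primeCompl)

theorem toricFraction_zero (hF : (0 : AddMonoidAlgebra k (coneMonoid s₁ s₂ s₃)) ∈ coneGrading k s₁ s₂ s₃ m)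
    (hG : G ∈ coneGrading k s₁ s₂ s₃ m) (hGp : G ∉ p.asHomogeneousIdeal) :
    toricFraction p hF hG hGp = 0 := by
  refine (congrArg (Proj.stalkIso' (coneGrading k s₁ s₂ s₃) p).symm ?_).trans (map_zero (Proj.stalkIso' (coneGrading k s₁ s₂ s₃) p).symm)
  have := p.isPrime
  rw [HomogeneousLocalization.ext_iff_val, HomogeneousLocalization.val_mk,
    HomogeneousLocalization.val_zero]
  exact Localization.mk_zero _

theorem isUnit_toricFraction_iff (hF : F ∈ coneGrading k s₁ s₂ s₃ m)
    (hG : G ∈ coneGrading k s₁ s₂ s₃ m) (hGp : G ∉ p.asHomogeneousIdeal) :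
    IsUnit (toricFraction p hF hG hGp) ↔ F ∉ p.asHomogeneousIdeal := by
  refine ⟨fun h hFp => ?_, fun h => ?_⟩
  · obtain ⟨b, hb⟩ := h.exists_right_inv
    obtain ⟨m', F', G', hF', hG', hGp', rfl⟩ := exists_toricFraction_eq b
    rw [toricFraction_mul, ← toricFraction_self (p := p) (m := 0) (G := 1) SetLike.GradedOne.one_mem
      (fun h => p.isPrime.ne_top ((Ideal.eq_top_iff_one _).2 h)), toricFraction_eq_iff, mul_one,
      one_mul] at hb
    refine (p.isPrime.mem_or_mem (?_ : G * G' ∈ p.asHomogeneousIdeal.toIdeal)).elim hGp hGp'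
    rw [← hb]
    exact Ideal.mul_mem_right _ _ hFp
  · refine IsUnit.of_mul_eq_one (toricFraction p hG hF h) ?_
    rw [toricFraction_mul, ← toricFraction_self (SetLike.mul_mem_graded hF hG)
      (fun h' => (p.isPrime.mem_or_mem h').elim h hGp), toricFraction_eq_iff]
    ring

/-- A homomorphism on homogeneous elements that inverts those not in `p` extends to the local ring
at `p`. -/
theorem exists_toricStalk_lift {Q : Type*} [CommRing Q]
    (ψ : AddMonoidAlgebra k (coneMonoid s₁ s₂ s₃) →+* Q)
    (hψ : ∀ m, ∀ G ∈ coneGrading k s₁ s₂ s₃ m, G ∉ p.asHomogeneousIdeal → IsUnit (ψ G)) :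
    ∃ θ : (toricSurface k s₁ s₂ s₃).presheaf.stalk p →+* Q,
      ∀ {m : ℕ} {F G : AddMonoidAlgebra k (coneMonoid s₁ s₂ s₃)}
        (hF : F ∈ coneGrading k s₁ s₂ s₃ m) (hG : G ∈ coneGrading k s₁ s₂ s₃ m)
        (hGp : G ∉ p.asHomogeneousIdeal), θ (toricFraction p hF hG hGp) * ψ G = ψ F := by
  choose deg num den hnum hden hdenp heq using exists_toricFraction_eq (p := p)
  -- `Ring.inverse` is `0` at nonunits, but by `hψ` every chosen denominator has invertible image.
  let θ := fun a => ψ (num a) * Ring.inverse (ψ (den a))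
  have key {m : ℕ} {F G : AddMonoidAlgebra k (coneMonoid s₁ s₂ s₃)}
      (hF : F ∈ coneGrading k s₁ s₂ s₃ m) (hG : G ∈ coneGrading k s₁ s₂ s₃ m)
      (hGp : G ∉ p.asHomogeneousIdeal) : θ (toricFraction p hF hG hGp) * ψ G = ψ F := by
    set a := toricFraction p hF hG hGp
    have h1 := (toricFraction_eq_iff _ _ _ _ _ _).1 (heq a)
    refine (hψ _ _ (hden a) (hdenp a)).mul_right_cancel ?_
    have h2 := Ring.inverse_mul_cancel _ (hψ _ _ (hden a) (hdenp a))
    calc _ = ψ (num a) * ψ G * (Ring.inverse (ψ (den a)) * ψ (den a)) := by ring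
      _ = _ := by rw [h2, mul_one, ← map_mul, h1, map_mul]
  have uniq {m : ℕ} {F G : AddMonoidAlgebra k (coneMonoid s₁ s₂ s₃)}
      (hF : F ∈ coneGrading k s₁ s₂ s₃ m) (hG : G ∈ coneGrading k s₁ s₂ s₃ m)
      (hGp : G ∉ p.asHomogeneousIdeal) {z : Q} (hz : z * ψ G = ψ F) :
      θ (toricFraction p hF hG hGp) = z :=
    (hψ _ _ hG hGp).mul_right_cancel ((key hF hG hGp).trans hz.symm)
  have h1p : (1 : AddMonoidAlgebra k (coneMonoid s₁ s₂ s₃)) ∉ p.asHomogeneousIdeal :=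
    fun h => p.isPrime.ne_top ((Ideal.eq_top_iff_one _).2 h)
  refine ⟨{ toFun := θ, map_zero' := ?_, map_one' := ?_, map_add' := ?_, map_mul' := ?_ }, key⟩
  · rw [← toricFraction_self (m := 0) SetLike.GradedOne.one_mem h1p]
    exact uniq _ _ _ (one_mul _)
  · intro a b
    obtain ⟨m, F, G, hF, hG, hGp, rfl⟩ := exists_toricFraction_eq a
    obtain ⟨m', F', G', hF', hG', hGp', rfl⟩ := exists_toricFraction_eq b
    rw [toricFraction_mul]
    refine uniq _ _ _ ?_
    rw [map_mul, map_mul, ← key hF hG hGp, ← key hF' hG' hGp']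
    ring
  · rw [← toricFraction_zero (m := 0) (zero_mem _) SetLike.GradedOne.one_mem h1p]
    exact uniq _ _ _ (by rw [zero_mul, map_zero])
  · intro a b
    obtain ⟨m, F, G, hF, hG, hGp, rfl⟩ := exists_toricFraction_eq a
    obtain ⟨m', F', G', hF', hG', hGp', rfl⟩ := exists_toricFraction_eq b
    rw [toricFraction_add]
    refine uniq _ _ _ ?_
    rw [map_mul, map_add, map_mul, map_mul, ← key hF hG hGp, ← key hF' hG' hGp']
    ring

end ToricFraction

/-! ### Laurent polynomials as rational functions on the blowup -/

theorem appTop_toSpecΓ_germ {Y : Scheme.{u}} {U : Y.Opens} (hU : U = ⊤) {R : CommRingCat.{u}}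
    (g : R ⟶ Γ(Y, U)) (p : Y) :
    (Y.topIso.inv ≫ (Y.isoOfEq hU).inv ≫ U.toSpecΓ ≫ Spec.map g).appTop ≫
      Y.presheaf.germ ⊤ p trivial =
    (Scheme.ΓSpecIso R).hom ≫ g ≫ Y.presheaf.germ U p (hU ▸ trivial) := by
  subst hU
  simp

section LaurentFunctionField

variable {k : Type u} [Field k] {s₁ s₂ s₃ : ℚ} {X : Scheme.{u}} [IsIntegral X]
  (π : X ⟶ toricSurface k s₁ s₂ s₃)

theorem algebraMap_stalkMap_toricFraction (P : X) {m : ℕ}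
    {F G : AddMonoidAlgebra k (coneMonoid s₁ s₂ s₃)} (hF : F ∈ coneGrading k s₁ s₂ s₃ m)
    (hG : G ∈ coneGrading k s₁ s₂ s₃ m) (hGP : G ∉ (π P).asHomogeneousIdeal)
    (hGη : G ∉ (π (genericPoint X)).asHomogeneousIdeal) :
    algebraMap (X.presheaf.stalk P) X.functionField
        ((π.stalkMap P).hom (toricFraction (π P) hF hG hGP)) =
      (π.stalkMap (genericPoint X)).hom (toricFraction (π (genericPoint X)) hF hG hGη) := by
  have h : genericPoint X ⤳ P := genericPoint_specializes P
  have h1 := congrArg (fun f => f.hom (toricFraction (π P) hF hG hGP))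
    (Scheme.Hom.stalkSpecializes_stalkMap π _ _ h)
  have h2 := stalkSpecializes_toricFraction (h.map π.continuous) hF hG hGP hGη
  refine h1.symm.trans ?_
  exact congrArg (π.stalkMap (genericPoint X)).hom h2

variable (hη : ∀ m, ∀ F ∈ coneGrading k s₁ s₂ s₃ m,
  F ∈ (π (genericPoint X)).asHomogeneousIdeal → F = 0)

include hη in
/-- The Laurent polynomials embed in the function field, compatibly with fractions of homogeneous
elements. -/
theorem exists_laurentHom (h₁₂ : s₁ < s₂) (h₂₃ : s₂ < s₃) :
    ∃ φ : AddMonoidAlgebra k (ℤ × ℤ) →+* X.functionField,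
      ∀ {m : ℕ} {F G : AddMonoidAlgebra k (coneMonoid s₁ s₂ s₃)}
        (hF : F ∈ coneGrading k s₁ s₂ s₃ m) (hG : G ∈ coneGrading k s₁ s₂ s₃ m)
        (hGη : G ∉ (π (genericPoint X)).asHomogeneousIdeal),
        (π.stalkMap (genericPoint X)).hom (toricFraction (π (genericPoint X)) hF hG hGη) *
          φ (dehomogenize k s₁ s₂ s₃ G) = φ (dehomogenize k s₁ s₂ s₃ F) := by
  have ex (H : AddMonoidAlgebra k (ℤ × ℤ)) : ∃ (m : ℕ)
      (F G : AddMonoidAlgebra k (coneMonoid s₁ s₂ s₃)) (_ : F ∈ coneGrading k s₁ s₂ s₃ m)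
      (_ : G ∈ coneGrading k s₁ s₂ s₃ m), G ∉ (π (genericPoint X)).asHomogeneousIdeal ∧
      dehomogenize k s₁ s₂ s₃ F = dehomogenize k s₁ s₂ s₃ G * H := by
    obtain ⟨N, -, ⟨F, hF, hF'⟩, G, hG, hG'⟩ := exists_homogenize_translate h₁₂ h₂₃ H 1 2 (0, 1)
      (Or.inl (by simp)) (Or.inl (by simp)) (Or.inl (by norm_num))
    refine ⟨_, F, G, hF, hG, fun h => ?_, by rw [hF', hG', mul_one]⟩
    have h0 := hη _ _ hG h
    rw [h0, map_zero, mul_one] at hG'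
    exact (isUnit_single _).ne_zero hG'.symm
  choose deg num den hnum hden hdenp heq using ex
  let κ := (π.stalkMap (genericPoint X)).hom
  -- The value is independent of the chosen fraction: two fractions with the same dehomogenization
  -- agree by cross multiplication, and the ring axioms follow by choosing convenient ones.
  let φ := fun H => κ (toricFraction _ (hnum H) (hden H) (hdenp H))
  have key {H : AddMonoidAlgebra k (ℤ × ℤ)} {m : ℕ}
      {F G : AddMonoidAlgebra k (coneMonoid s₁ s₂ s₃)} (hF : F ∈ coneGrading k s₁ s₂ s₃ m)
      (hG : G ∈ coneGrading k s₁ s₂ s₃ m) (hGη : G ∉ (π (genericPoint X)).asHomogeneousIdeal)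
      (h : dehomogenize k s₁ s₂ s₃ F = dehomogenize k s₁ s₂ s₃ G * H) :
      φ H = κ (toricFraction _ hF hG hGη) := by
    refine congrArg κ ((toricFraction_eq_iff _ _ _ _ _ _).2 ?_)
    rw [← sub_eq_zero, ← dehomogenize_eq_zero_iff (m := deg H + m)]
    · rw [map_sub, map_mul, map_mul, heq, h]
      ring
    · refine sub_mem (SetLike.mul_mem_graded (hnum H) hG) ?_
      rw [add_comm]
      exact SetLike.mul_mem_graded hF (hden H)
  have h1η : (1 : AddMonoidAlgebra k (coneMonoid s₁ s₂ s₃)) ∉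
      (π (genericPoint X)).asHomogeneousIdeal :=
    fun h => (π (genericPoint X)).isPrime.ne_top ((Ideal.eq_top_iff_one _).2 h)
  have hTη (m : ℕ) : vertexMonomial k s₁ s₂ s₃ ^ m ∉ (π (genericPoint X)).asHomogeneousIdeal := by
    intro h
    have h0 := congrArg (dehomogenize k s₁ s₂ s₃) (hη _ _ (vertexMonomial_pow_mem m) h)
    rw [map_pow, dehomogenize_vertexMonomial, one_pow, map_zero] at h0
    exact one_ne_zero h0
  refine ⟨{ toFun := φ, map_one' := ?_, map_mul' := ?_, map_zero' := ?_, map_add' := ?_ }, ?_⟩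
  · exact (key (H := 1) (m := 0) SetLike.GradedOne.one_mem SetLike.GradedOne.one_mem h1η
      (by rw [map_one, mul_one])).trans ((congrArg κ (toricFraction_self _ _)).trans (map_one κ))
  · intro H H'
    refine (key _ _ (fun h => ?_) ?_).trans ((congrArg κ (toricFraction_mul (hnum H) (hden H) (hdenp H)
      (hnum H') (hden H') (hdenp H')).symm).trans (map_mul κ _ _))
    · exact ((π (genericPoint X)).isPrime.mem_or_mem h).elim (hdenp H) (hdenp H')
    · rw [map_mul, map_mul, heq, heq]
      ring
  · exact (key (H := 0) (m := 0) (zero_mem _) SetLike.GradedOne.one_mem h1η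
      (by rw [map_zero, mul_zero])).trans ((congrArg κ (toricFraction_zero _ _ _)).trans (map_zero κ))
  · intro H H'
    refine (key _ _ (fun h => ?_) ?_).trans ((congrArg κ (toricFraction_add (hnum H) (hden H) (hdenp H)
      (hnum H') (hden H') (hdenp H')).symm).trans (map_add κ _ _))
    · exact ((π (genericPoint X)).isPrime.mem_or_mem h).elim (hdenp H) (hdenp H')
    · rw [map_add, map_mul, map_mul, map_mul, heq, heq]
      ring
  · intro m F G hF hG hGη
    have hT := hTη m
    change κ _ * φ _ = φ _
    rw [key (H := dehomogenize k s₁ s₂ s₃ F) hF (vertexMonomial_pow_mem m) hT (by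
      rw [map_pow, dehomogenize_vertexMonomial, one_pow, one_mul]),
      key (H := dehomogenize k s₁ s₂ s₃ G) hG (vertexMonomial_pow_mem m) hT (by
      rw [map_pow, dehomogenize_vertexMonomial, one_pow, one_mul]), ← map_mul]
    refine congrArg κ ((toricFraction_mul hF hG hGη hG (vertexMonomial_pow_mem m) hT).trans
      ((toricFraction_eq_iff _ _ _ _ _ _).2 ?_))
    ring

/-- The Laurent polynomials as rational functions on an integral scheme over the toric surface. -/
def laurentHom (h₁₂ : s₁ < s₂) (h₂₃ : s₂ < s₃) :
    AddMonoidAlgebra k (ℤ × ℤ) →+* X.functionField :=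
  (exists_laurentHom π hη h₁₂ h₂₃).choose

variable (h₁₂ : s₁ < s₂) (h₂₃ : s₂ < s₃)

theorem laurentHom_spec {m : ℕ} {F G : AddMonoidAlgebra k (coneMonoid s₁ s₂ s₃)}
    (hF : F ∈ coneGrading k s₁ s₂ s₃ m) (hG : G ∈ coneGrading k s₁ s₂ s₃ m)
    (hGη : G ∉ (π (genericPoint X)).asHomogeneousIdeal) :
    (π.stalkMap (genericPoint X)).hom (toricFraction (π (genericPoint X)) hF hG hGη) *
      laurentHom π hη h₁₂ h₂₃ (dehomogenize k s₁ s₂ s₃ G) =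
        laurentHom π hη h₁₂ h₂₃ (dehomogenize k s₁ s₂ s₃ F) :=
  (exists_laurentHom π hη h₁₂ h₂₃).choose_spec hF hG hGη

theorem algebraMap_stalkMap_mul_laurentHom (P : X) {m : ℕ}
    {F G : AddMonoidAlgebra k (coneMonoid s₁ s₂ s₃)} (hF : F ∈ coneGrading k s₁ s₂ s₃ m)
    (hG : G ∈ coneGrading k s₁ s₂ s₃ m) (hGP : G ∉ (π P).asHomogeneousIdeal) :
    algebraMap (X.presheaf.stalk P) X.functionField
        ((π.stalkMap P).hom (toricFraction (π P) hF hG hGP)) *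
      laurentHom π hη h₁₂ h₂₃ (dehomogenize k s₁ s₂ s₃ G) =
        laurentHom π hη h₁₂ h₂₃ (dehomogenize k s₁ s₂ s₃ F) := by
  have hGη : G ∉ (π (genericPoint X)).asHomogeneousIdeal := fun h =>
    hGP (hη _ _ hG h ▸ zero_mem _)
  rw [algebraMap_stalkMap_toricFraction π P hF hG hGP hGη, laurentHom_spec]

omit [IsIntegral X] in
theorem isUnit_stalkMap_toricFraction_iff (P : X) {m : ℕ}
    {F G : AddMonoidAlgebra k (coneMonoid s₁ s₂ s₃)} (hF : F ∈ coneGrading k s₁ s₂ s₃ m)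
    (hG : G ∈ coneGrading k s₁ s₂ s₃ m) (hGP : G ∉ (π P).asHomogeneousIdeal) :
    IsUnit ((π.stalkMap P).hom (toricFraction (π P) hF hG hGP)) ↔
      F ∉ (π P).asHomogeneousIdeal := by
  rw [← isUnit_toricFraction_iff hF hG hGP]
  exact isUnit_map_iff (π.stalkMap P).hom _

theorem laurentHom_injective : Function.Injective (laurentHom π hη h₁₂ h₂₃) := by
  rw [injective_iff_map_eq_zero]
  intro H hH
  obtain ⟨N, -, ⟨F, hF, hF'⟩, G, hG, hG'⟩ := exists_homogenize_translate h₁₂ h₂₃ H 1 2 (0, 1)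
    (Or.inl (by simp)) (Or.inl (by simp)) (Or.inl (by norm_num))
  have hGη : G ∉ (π (genericPoint X)).asHomogeneousIdeal := fun h => by
    rw [hη _ _ hG h, map_zero, mul_one] at hG'
    exact (isUnit_single _).ne_zero hG'.symm
  have h1 := laurentHom_spec π hη h₁₂ h₂₃ hF hG hGη
  rw [hF', hG', map_mul _ _ H, hH, mul_zero, mul_one] at h1
  have h2 := (mul_eq_zero.1 h1).resolve_right ((isUnit_single _).map _).ne_zero
  have h3 : F ∈ (π (genericPoint X)).asHomogeneousIdeal := by
    by_contra h
    exact ((isUnit_stalkMap_toricFraction_iff π _ hF hG hGη).2 h).ne_zero h2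
  rw [hη _ _ hF h3, map_zero] at hF'
  exact ((isUnit_single _).mul_right_eq_zero.1 hF'.symm)

/-- The structure morphism is unwound on the basic open set of `1`, which is the whole surface. This
makes the embedding of Laurent polynomials compatible with the `k`-algebra structure of the function
field. -/
theorem germ_toricSurfaceOver_appTop (p : toricSurface k s₁ s₂ s₃) (c : k)
    (hc : algebraMap k _ c ∈ coneGrading k s₁ s₂ s₃ 0) (h1 : 1 ∈ coneGrading k s₁ s₂ s₃ 0)
    (h1p : 1 ∉ p.asHomogeneousIdeal) : 
    ((Scheme.ΓSpecIso (.of k)).inv ≫ (toricSurfaceOver k s₁ s₂ s₃).appTop ≫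
      (toricSurface k s₁ s₂ s₃).presheaf.germ ⊤ p trivial).hom c = toricFraction p hc h1 h1p := by
  have h := appTop_toSpecΓ_germ (Proj.basicOpen_one (coneGrading k s₁ s₂ s₃)) ((CommRingCat.ofHom (algebraMap k (coneGrading k s₁ s₂ s₃ 0))) ≫ (CommRingCat.ofHom (HomogeneousLocalization.fromZeroRingHom (coneGrading k s₁ s₂ s₃) (.powers 1))) ≫ Proj.awayToSection (coneGrading k s₁ s₂ s₃) 1) p
  have h4 : toricSurfaceOver k s₁ s₂ s₃ = (toricSurface k s₁ s₂ s₃).topIso.inv ≫ (Scheme.isoOfEq _ (Proj.basicOpen_one (coneGrading k s₁ s₂ s₃))).inv ≫ Scheme.Opens.toSpecΓ _ ≫ Spec.map ((CommRingCat.ofHom (algebraMap k (coneGrading k s₁ s₂ s₃ 0))) ≫ (CommRingCat.ofHom (HomogeneousLocalization.fromZeroRingHom (coneGrading k s₁ s₂ s₃) (.powers 1))) ≫ Proj.awayToSection (coneGrading k s₁ s₂ s₃) 1) := by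
    rw [Spec.map_comp, Spec.map_comp, toricSurfaceOver, Proj.toSpecZero, Proj.basicOpenToSpec]
    simp only [Category.assoc]
  rw [h4, h, Iso.inv_hom_id_assoc]
  have h5 := ProjectiveSpectrum.Proj.awayToSection_germ (coneGrading k s₁ s₂ s₃) 1 p (by exact h1p)
  have h6 := congrArg (fun f => f.hom (HomogeneousLocalization.fromZeroRingHom (coneGrading k s₁ s₂ s₃) (.powers 1) (algebraMap k (coneGrading k s₁ s₂ s₃ 0) c))) h5
  exact h6
theorem laurentHom_algebraMap (c : k) :
    laurentHom π hη h₁₂ h₂₃ (algebraMap k _ c) =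
      @algebraMap k X.functionField _ _ (functionFieldAlgebra (π ≫ toricSurfaceOver k s₁ s₂ s₃)) c := by
  have h1η : (1 : AddMonoidAlgebra k (coneMonoid s₁ s₂ s₃)) ∉
      (π (genericPoint X)).asHomogeneousIdeal :=
    fun h => (π (genericPoint X)).isPrime.ne_top ((Ideal.eq_top_iff_one _).2 h)
  have hc : algebraMap k (AddMonoidAlgebra k (coneMonoid s₁ s₂ s₃)) c ∈
    coneGrading k s₁ s₂ s₃ 0 := SetLike.algebraMap_mem_graded _ _
  have h1 := laurentHom_spec π hη h₁₂ h₂₃ hc SetLike.GradedOne.one_mem h1η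
  have e : dehomogenize k s₁ s₂ s₃ (algebraMap k _ c) = algebraMap k _ c :=
    dehomogenize_single _ _
  rw [map_one, map_one, mul_one, e] at h1
  rw [← h1, ← germ_toricSurfaceOver_appTop]
  change _ = ((Scheme.ΓSpecIso (.of k)).inv ≫ (π ≫ toricSurfaceOver k s₁ s₂ s₃).appTop ≫
    X.presheaf.germ ⊤ (genericPoint X) trivial).hom c
  have h2 : (toricSurface k s₁ s₂ s₃).presheaf.germ ⊤ (π (genericPoint X)) trivial ≫ π.stalkMap (genericPoint X) = π.appTop ≫ X.presheaf.germ ⊤ (genericPoint X) trivial :=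
    Scheme.Hom.germ_stalkMap π ⊤ (genericPoint X) trivial
  rw [Scheme.Hom.comp_appTop, Category.assoc, ← h2]
  rfl

end LaurentFunctionField

/-! ### Prime divisors of the blowup over the toric surface -/

/-- An embedding of the Laurent polynomials into the function field that is compatible with fractions
of homogeneous elements. -/
structure IsLaurentHom {k : Type u} [Field k] {s₁ s₂ s₃ : ℚ} {X : Scheme.{u}} [IsIntegral X]
    (π : X ⟶ toricSurface k s₁ s₂ s₃) (φ : AddMonoidAlgebra k (ℤ × ℤ) →+* X.functionField) : Prop where
  injective : Function.Injective φ
  stalkMap_mul : ∀ (P : X) {m : ℕ} {F G : AddMonoidAlgebra k (coneMonoid s₁ s₂ s₃)}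
    (hF : F ∈ coneGrading k s₁ s₂ s₃ m) (hG : G ∈ coneGrading k s₁ s₂ s₃ m)
    (hGP : G ∉ (π P).asHomogeneousIdeal),
    algebraMap (X.presheaf.stalk P) X.functionField
        ((π.stalkMap P).hom (toricFraction (π P) hF hG hGP)) * φ (dehomogenize k s₁ s₂ s₃ G) =
      φ (dehomogenize k s₁ s₂ s₃ F)

/-- A facet of the cone over the triangle, given by a primitive linear form `const * m + form v`, with
a lattice point `(degree, base)` in its relative interior. -/
structure ToricFacet (s₁ s₂ s₃ : ℚ) where
  form : ℤ × ℤ →+ ℤ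
  const : ℕ
  degree : ℕ
  base : ℤ × ℤ
  vec : ℤ × ℤ
  nonneg : ∀ z ∈ coneMonoid s₁ s₂ s₃, 0 ≤ const * (z.1 : ℤ) + form z.2
  degree_pos : 0 < degree
  base_eq : const * (degree : ℤ) + form base = 0
  form_vec : form vec = 1
  translate : ∀ A : Finset (ℤ × ℤ), (∀ v ∈ A, 0 ≤ form v) → ∃ N : ℕ, 1 ≤ N ∧
    ∀ v ∈ A, N • base + v ∈ trianglePoints s₁ s₂ s₃ ((N * degree : ℕ) : ℤ)

/-! ### Torus invariant curves -/

section ToricFacet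

variable {k : Type u} [Field k] {s₁ s₂ s₃ : ℚ} (h₁₂ : s₁ < s₂) (h₂₃ : s₂ < s₃)
  (W : ToricFacet s₁ s₂ s₃)

include h₁₂ h₂₃ in
theorem ToricFacet.exists_homogenize (F : AddMonoidAlgebra k (ℤ × ℤ))
    (G : AddMonoidAlgebra k (ℤ × ℤ)) (hF : ∀ v ∈ F.coeff.support, 0 ≤ W.form v)
    (hG : ∀ v ∈ G.coeff.support, 0 ≤ W.form v) :
    ∃ N : ℕ, 1 ≤ N ∧ (∃ F' ∈ coneGrading k s₁ s₂ s₃ (N * W.degree),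
        dehomogenize k s₁ s₂ s₃ F' = AddMonoidAlgebra.single (N • W.base) 1 * F) ∧
      ∃ G' ∈ coneGrading k s₁ s₂ s₃ (N * W.degree),
        dehomogenize k s₁ s₂ s₃ G' = AddMonoidAlgebra.single (N • W.base) 1 * G := by
  classical
  obtain ⟨N, hN, h⟩ := W.translate (F.coeff.support ∪ G.coeff.support) (fun v hv =>
    (Finset.mem_union.1 hv).elim (hF v) (hG v))
  have key (H : AddMonoidAlgebra k (ℤ × ℤ))
      (hH : H.coeff.support ⊆ F.coeff.support ∪ G.coeff.support) :
      ∀ v ∈ (AddMonoidAlgebra.single (N • W.base) 1 * H).coeff.support,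
        ((N * W.degree, v) : ℕ × ℤ × ℤ) ∈ coneMonoid s₁ s₂ s₃ := by
    intro v hv
    rw [Finsupp.mem_support_iff, AddMonoidAlgebra.coeff_single_mul_apply, one_mul,
      ← Finsupp.mem_support_iff] at hv
    have h4 := h _ (hH hv)
    rw [add_neg_cancel_left] at h4
    exact (mem_coneMonoid_iff h₁₂ h₂₃).2 h4
  exact ⟨N, hN, _root_.exists_homogenize (key F Finset.subset_union_left),
    _root_.exists_homogenize (key G Finset.subset_union_right)⟩

theorem ToricFacet.forall_pos_iff {F : AddMonoidAlgebra k (ℤ × ℤ)} {N : ℕ} :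
    (∀ v ∈ (AddMonoidAlgebra.single (N • W.base) 1 * F).coeff.support,
      0 < W.const * ((N * W.degree : ℕ) : ℤ) + W.form v) ↔ ∀ v ∈ F.coeff.support, 0 < W.form v := by
  have h0 (v : ℤ × ℤ) : W.const * ((N * W.degree : ℕ) : ℤ) + W.form (N • W.base + v) = W.form v := by
    rw [map_add, map_nsmul, nsmul_eq_mul]
    have := W.base_eq
    push_cast
    linear_combination (N : ℤ) * this
  simp only [Finsupp.mem_support_iff, AddMonoidAlgebra.coeff_single_mul_apply, one_mul]
  refine ⟨fun h v hv => ?_, fun h v hv => ?_⟩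
  · rw [← h0]
    exact h _ (by rwa [neg_add_cancel_left])
  · have := h _ hv
    rwa [← h0, add_neg_cancel_left] at this

include h₁₂ h₂₃ in
theorem ToricFacet.exists_faceHom_ne_zero : ∃ m, 0 < m ∧ ∃ F ∈ coneGrading k s₁ s₂ s₃ m,
    faceHom k W.form W.const W.nonneg F ≠ 0 := by
  obtain ⟨N, hN, ⟨F, hF, hF'⟩, -⟩ := W.exists_homogenize h₁₂ h₂₃ (1 : AddMonoidAlgebra k (ℤ × ℤ)) 1
    (by simp [AddMonoidAlgebra.one_def]) (by simp [AddMonoidAlgebra.one_def])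
  refine ⟨_, Nat.mul_pos hN W.degree_pos, F, hF, fun h => ?_⟩
  rw [faceHom_eq_zero_iff _ _ _ hF, hF', W.forall_pos_iff] at h
  simpa using h 0 (by simp [AddMonoidAlgebra.one_def])

/-- The generic point of the torus invariant curve of a facet. -/
def ToricFacet.point (k : Type u) [Field k] (h₁₂ : s₁ < s₂) (h₂₃ : s₂ < s₃)
    (W : ToricFacet s₁ s₂ s₃) : toricSurface k s₁ s₂ s₃ :=
  conePoint (faceHom k W.form W.const W.nonneg) (W.exists_faceHom_ne_zero h₁₂ h₂₃)

theorem ToricFacet.mem_point_iff {m : ℕ} {F : AddMonoidAlgebra k (coneMonoid s₁ s₂ s₃)}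
    (hF : F ∈ coneGrading k s₁ s₂ s₃ m) : F ∈ (W.point k h₁₂ h₂₃).asHomogeneousIdeal ↔
      ∀ v ∈ (dehomogenize k s₁ s₂ s₃ F).coeff.support, 0 < W.const * (m : ℤ) + W.form v :=
  (mem_conePoint_iff _ hF).trans (faceHom_eq_zero_iff _ _ _ hF)

/-- A translate of the monomial with exponent `vec` vanishes on the curve of the facet but has value
`1` at the identity. -/
theorem ToricFacet.point_ne_torusIdentity [CharZero k] :
    W.point k h₁₂ h₂₃ ≠ torusIdentity k s₁ s₂ s₃ := by
  intro h
  obtain ⟨N, hN, ⟨F, hF, hF'⟩, -⟩ := W.exists_homogenize h₁₂ h₂₃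
    (AddMonoidAlgebra.single W.vec 1 : AddMonoidAlgebra k (ℤ × ℤ)) (.single W.vec 1)
    (by simp [W.form_vec]) (by simp [W.form_vec])
  have h1 : F ∈ (W.point k h₁₂ h₂₃).asHomogeneousIdeal := by
    rw [W.mem_point_iff _ _ hF, hF', W.forall_pos_iff]
    simp [W.form_vec]
  rw [h, mem_torusIdentity_iff hF, mem_identityIdeal_iff, hF', AddMonoidAlgebra.single_mul_single,
    pairing_single] at h1
  simp at h1

end ToricFacet

/-! ### Local rings and orders along curves away from the identity -/

section DivisorsAwayFromIdentity

variable {k : Type u} [Field k] {s₁ s₂ s₃ : ℚ} {X : Scheme.{u}} [IsIntegral X]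
  {π : X ⟶ toricSurface k s₁ s₂ s₃} {φ : AddMonoidAlgebra k (ℤ × ℤ) →+* X.functionField}
  (hφ : IsLaurentHom π φ)

include hφ

theorem IsLaurentHom.ne_zero {F : AddMonoidAlgebra k (ℤ × ℤ)} (hF : F ≠ 0) : φ F ≠ 0 :=
  (map_ne_zero_iff _ hφ.injective).2 hF

theorem IsLaurentHom.exists_stalk (P : X) {F G : AddMonoidAlgebra k (ℤ × ℤ)} {w : ℤ × ℤ} {m : ℕ}
    {F' G' : AddMonoidAlgebra k (coneMonoid s₁ s₂ s₃)}
    (hF : F' ∈ coneGrading k s₁ s₂ s₃ m) (hG : G' ∈ coneGrading k s₁ s₂ s₃ m)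
    (hF' : dehomogenize k s₁ s₂ s₃ F' = AddMonoidAlgebra.single w 1 * F)
    (hG' : dehomogenize k s₁ s₂ s₃ G' = AddMonoidAlgebra.single w 1 * G)
    (hGP : G' ∉ (π P).asHomogeneousIdeal) :
    ∃ a : X.presheaf.stalk P, algebraMap _ X.functionField a * φ G = φ F ∧
      (IsUnit a ↔ F' ∉ (π P).asHomogeneousIdeal) := by
  refine ⟨_, ?_, isUnit_stalkMap_toricFraction_iff π P hF hG hGP⟩
  have h := hφ.stalkMap_mul P hF hG hGP
  rw [hF', hG', map_mul, map_mul, mul_left_comm] at h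
  exact mul_left_cancel₀ ((isUnit_single w).map φ).ne_zero h

theorem IsLaurentHom.ord_eq_of_isUnit [IsLocallyNoetherian X] {P : X} {F G : AddMonoidAlgebra k (ℤ × ℤ)} (hG : G ≠ 0)
    {a : X.presheaf.stalk P} (ha : algebraMap _ X.functionField a * φ G = φ F) (hu : IsUnit a) :
    Scheme.ord (φ F) P = Scheme.ord (φ G) P := by
  rw [← ha, Scheme.ord_mul _ (hφ.ne_zero hG), ord_algebraMap_eq_zero hu, zero_add]
  exact (hu.map _).ne_zero

/-- The maximal ideal of a local ring is generated by `a` if `a` divides all nonunits that are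
fractions of homogeneous elements. -/
theorem IsLaurentHom.maximalIdeal_eq_span {P : X} (hs : Function.Surjective (π.stalkMap P))
    {a : X.presheaf.stalk P} (ha : ¬ IsUnit a)
    (H : ∀ m, ∀ F ∈ coneGrading k s₁ s₂ s₃ m, ∀ G ∈ coneGrading k s₁ s₂ s₃ m,
      F ∈ (π P).asHomogeneousIdeal → G ∉ (π P).asHomogeneousIdeal →
      ∃ b, algebraMap _ X.functionField (a * b) * φ (dehomogenize k s₁ s₂ s₃ G) =
        φ (dehomogenize k s₁ s₂ s₃ F)) :
    IsLocalRing.maximalIdeal (X.presheaf.stalk P) = Ideal.span {a} := by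
  refine le_antisymm (fun c hc => ?_) ((Ideal.span_singleton_le_iff_mem _).2 ha)
  obtain ⟨c, rfl⟩ := hs c
  obtain ⟨m, F, G, hF, hG, hGP, rfl⟩ := exists_toricFraction_eq c
  have hFP : F ∈ (π P).asHomogeneousIdeal := by
    by_contra h
    exact hc ((isUnit_stalkMap_toricFraction_iff π P hF hG hGP).2 h)
  obtain ⟨b, hb⟩ := H m F hF G hG hFP hGP
  refine Ideal.mem_span_singleton.2 ⟨b, algebraMap_stalk_injective P ?_⟩
  refine mul_right_cancel₀ (hφ.ne_zero ?_) ((hφ.stalkMap_mul P hF hG hGP).trans hb.symm)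
  rw [ne_eq, dehomogenize_eq_zero_iff hG]
  rintro rfl
  exact hGP (zero_mem _)

variable (h₁₂ : s₁ < s₂) (h₂₃ : s₂ < s₃)

/-- Laurent polynomials with the same minimal weight at a facet differ by a unit there. -/
theorem IsLaurentHom.exists_stalk_of_facet {W : ToricFacet s₁ s₂ s₃} {P : X}
    (hP : π P = W.point k h₁₂ h₂₃) {F G : AddMonoidAlgebra k (ℤ × ℤ)} {e : ℤ}
    (hF : ∀ v ∈ F.coeff.support, e ≤ W.form v) (hG : ∀ v ∈ G.coeff.support, e ≤ W.form v)
    (hG0 : ∃ v ∈ G.coeff.support, W.form v = e) :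
    ∃ a : X.presheaf.stalk P, algebraMap _ X.functionField a * φ G = φ F ∧
      (IsUnit a ↔ ∃ v ∈ F.coeff.support, W.form v = e) := by
  obtain ⟨v₀, hv₀, rfl⟩ := hG0
  have key (H : AddMonoidAlgebra k (ℤ × ℤ)) (v : ℤ × ℤ) :
      v ∈ (AddMonoidAlgebra.single (-v₀) 1 * H).coeff.support ↔ v₀ + v ∈ H.coeff.support := by
    rw [Finsupp.mem_support_iff, AddMonoidAlgebra.coeff_single_mul_apply, one_mul, neg_neg,
      Finsupp.mem_support_iff]
  have key2 (H : AddMonoidAlgebra k (ℤ × ℤ)) :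
      (∀ v ∈ (AddMonoidAlgebra.single (-v₀) 1 * H).coeff.support, 0 < W.form v) ↔
        ∀ v ∈ H.coeff.support, W.form v₀ < W.form v := by
    simp only [key]
    refine ⟨fun h v hv => ?_, fun h v hv => ?_⟩
    · have := h (-v₀ + v) (by rwa [add_neg_cancel_left])
      rw [map_add, map_neg] at this
      omega
    · have := h _ hv
      rw [map_add] at this
      omega
  have pos {H : AddMonoidAlgebra k (ℤ × ℤ)} (hH : ∀ v ∈ H.coeff.support, W.form v₀ ≤ W.form v) :
      ∀ v ∈ (AddMonoidAlgebra.single (-v₀) 1 * H).coeff.support, 0 ≤ W.form v := by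
    intro v hv
    have := hH _ ((key H v).1 hv)
    rw [map_add] at this
    omega
  obtain ⟨N, -, ⟨F', hF', eF⟩, G', hG', eG⟩ := W.exists_homogenize h₁₂ h₂₃ _ _ (pos hF) (pos hG)
  have hmem {H : AddMonoidAlgebra k (ℤ × ℤ)} {H' : AddMonoidAlgebra k (coneMonoid s₁ s₂ s₃)}
      (hH' : H' ∈ coneGrading k s₁ s₂ s₃ (N * W.degree)) (hH : dehomogenize k s₁ s₂ s₃ H' =
        AddMonoidAlgebra.single (N • W.base) 1 * (AddMonoidAlgebra.single (-v₀) 1 * H)) :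
      H' ∈ (π P).asHomogeneousIdeal ↔ ∀ v ∈ H.coeff.support, W.form v₀ < W.form v := by
    rw [hP, W.mem_point_iff h₁₂ h₂₃ hH', hH, W.forall_pos_iff, key2]
  obtain ⟨a, ha, ha'⟩ := hφ.exists_stalk P hF' hG' (F := F) (G := G) (w := N • W.base + -v₀)
    (by rw [eF, ← mul_assoc, AddMonoidAlgebra.single_mul_single, one_mul])
    (by rw [eG, ← mul_assoc, AddMonoidAlgebra.single_mul_single, one_mul])
    (fun h => lt_irrefl _ ((hmem hG' eG).1 h v₀ hv₀))
  refine ⟨a, ha, ha'.trans ?_⟩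
  rw [hmem hF' eF]
  push Not
  exact ⟨fun ⟨v, hv, h⟩ => ⟨v, hv, h.antisymm (hF v hv)⟩, fun ⟨v, hv, h⟩ => ⟨v, hv, h.le⟩⟩

include h₁₂ h₂₃

/-- Laurent polynomials not divisible by a prime are units at it. -/
theorem IsLaurentHom.exists_stalk_of_prime {f : AddMonoidAlgebra k (ℤ × ℤ)} (hf : Prime f) {P : X}
    (hP : π P = torusPoint s₁ s₂ s₃ hf) (F : AddMonoidAlgebra k (ℤ × ℤ))
    {G : AddMonoidAlgebra k (ℤ × ℤ)} (hG : ¬ f ∣ G) :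
    ∃ a : X.presheaf.stalk P, algebraMap _ X.functionField a * φ G = φ F ∧
      (IsUnit a ↔ ¬ f ∣ F) := by
  obtain ⟨N, -, ⟨F', hF', eF⟩, G', hG', eG⟩ := exists_homogenize_translate h₁₂ h₂₃ F G 2 (0, 1)
    (Or.inl (by simp)) (Or.inl (by simp)) (Or.inl (by norm_num))
  have hmem {H : AddMonoidAlgebra k (ℤ × ℤ)} {H' : AddMonoidAlgebra k (coneMonoid s₁ s₂ s₃)}
      (hH' : H' ∈ coneGrading k s₁ s₂ s₃ (N * 2)) (hH : dehomogenize k s₁ s₂ s₃ H' =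
        AddMonoidAlgebra.single (N • (0, 1)) 1 * H) :
      H' ∈ (π P).asHomogeneousIdeal ↔ f ∣ H := by
    rw [hP, mem_torusPoint_iff hf hH', hH, (isUnit_single _).dvd_mul_left]
  obtain ⟨a, ha, ha'⟩ := hφ.exists_stalk P hF' hG' eF eG (fun h => hG ((hmem hG' eG).1 h))
  exact ⟨a, ha, ha'.trans (hmem hF' eF).not⟩

variable [IsLocallyNoetherian X]

/-- The monomial with exponent `vec` generates the maximal ideal: a numerator vanishing on the curve
has weight at least one above the minimum, so that monomial can be divided off. -/
theorem IsLaurentHom.coheight_eq_one_of_facet {W : ToricFacet s₁ s₂ s₃} {P : X}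
    (hP : π P = W.point k h₁₂ h₂₃) (hs : Function.Surjective (π.stalkMap P)) :
    coheight P = 1 := by
  have h1 : ∃ v ∈ (1 : AddMonoidAlgebra k (ℤ × ℤ)).coeff.support, W.form v = 0 :=
    ⟨0, by simp [AddMonoidAlgebra.one_def], map_zero _⟩
  obtain ⟨a, ha, hau⟩ := hφ.exists_stalk_of_facet h₁₂ h₂₃ hP
    (F := AddMonoidAlgebra.single W.vec 1) (G := 1) (e := 0) (by simp [W.form_vec])
    (by simp [AddMonoidAlgebra.one_def]) h1
  rw [map_one, mul_one] at ha
  refine coheight_eq_one_of_maximalIdeal_eq_span (a := a) ?_ (hφ.maximalIdeal_eq_span hs ?_ ?_)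
  · rintro rfl
    rw [map_zero] at ha
    exact ((isUnit_single W.vec).map φ).ne_zero ha.symm
  · rw [hau]
    simp [W.form_vec]
  · intro m F hF G hG hFP hGP
    rw [hP, W.mem_point_iff h₁₂ h₂₃ hF] at hFP
    rw [hP, W.mem_point_iff h₁₂ h₂₃ hG] at hGP
    push Not at hGP
    obtain ⟨v, hv, hv'⟩ := hGP
    have hGn : ∀ v ∈ (dehomogenize k s₁ s₂ s₃ G).coeff.support, -(W.const * (m : ℤ)) ≤ W.form v := by
      intro v hv
      obtain ⟨z, -, hz⟩ := exists_of_mem_support_dehomogenize hG hv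
      have := W.nonneg _ z.2
      rw [hz] at this
      simp only at this
      omega
    obtain ⟨b, hb, -⟩ := hφ.exists_stalk_of_facet h₁₂ h₂₃ hP
      (F := AddMonoidAlgebra.single (-W.vec) 1 * dehomogenize k s₁ s₂ s₃ F)
      (G := dehomogenize k s₁ s₂ s₃ G) (e := -(W.const * (m : ℤ))) (fun w hw => by
        rw [Finsupp.mem_support_iff, AddMonoidAlgebra.coeff_single_mul_apply, one_mul, neg_neg,
          ← Finsupp.mem_support_iff] at hw
        have := hFP _ hw
        rw [map_add, W.form_vec] at this
        omega) hGn ⟨v, hv, le_antisymm (by omega) (hGn v hv)⟩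
    refine ⟨b, ?_⟩
    rw [map_mul, mul_assoc, hb, ha, ← map_mul, ← mul_assoc, AddMonoidAlgebra.single_mul_single,
      add_neg_cancel, one_mul, ← AddMonoidAlgebra.one_def, one_mul]

/-- Up to a unit, `F` of minimal weight `e` is the `e`-th power of the monomial with exponent `vec`.
The constant `o` is the order of that monomial; only its positivity matters. -/
theorem IsLaurentHom.exists_ord_eq_of_facet {W : ToricFacet s₁ s₂ s₃} {P : X}
    (hP : π P = W.point k h₁₂ h₂₃) (hs : Function.Surjective (π.stalkMap P)) :
    ∃ o : ℤ, 0 < o ∧ ∀ (F : AddMonoidAlgebra k (ℤ × ℤ)) (e : ℤ),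
      (∀ v ∈ F.coeff.support, e ≤ W.form v) → (∃ v ∈ F.coeff.support, W.form v = e) →
      Scheme.ord (φ F) P = e * o := by
  have hc := hφ.coheight_eq_one_of_facet h₁₂ h₂₃ hP hs
  have h1 : ∃ v ∈ (1 : AddMonoidAlgebra k (ℤ × ℤ)).coeff.support, W.form v = 0 :=
    ⟨0, by simp [AddMonoidAlgebra.one_def], map_zero _⟩
  obtain ⟨a, ha, hau⟩ := hφ.exists_stalk_of_facet h₁₂ h₂₃ hP
    (F := AddMonoidAlgebra.single W.vec 1) (G := 1) (e := 0) (by simp [W.form_vec])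
    (by simp [AddMonoidAlgebra.one_def]) h1
  rw [map_one, mul_one] at ha
  have ha0 : a ≠ 0 := by
    rintro rfl
    rw [map_zero] at ha
    exact ((isUnit_single W.vec).map φ).ne_zero ha.symm
  refine ⟨Scheme.ord (φ (.single W.vec 1)) P, ?_, fun F e hF hF0 => ?_⟩
  · rw [← ha]
    exact ord_algebraMap_pos hc ha0 (by rw [hau]; simp [W.form_vec])
  · have hev : W.form (e • W.vec) = e := by rw [map_zsmul, W.form_vec, smul_eq_mul, mul_one]
    have hs : (AddMonoidAlgebra.single (e • W.vec) 1 :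
        AddMonoidAlgebra k (ℤ × ℤ)).coeff.support = {e • W.vec} := by
      rw [AddMonoidAlgebra.coeff_single, Finsupp.support_single _ one_ne_zero]
    obtain ⟨b, hb, hbu⟩ := hφ.exists_stalk_of_facet h₁₂ h₂₃ hP
      (F := F) (G := AddMonoidAlgebra.single (e • W.vec) 1) (e := e) hF
      (by rw [hs]; simp only [Finset.mem_singleton, forall_eq]; exact hev.ge)
      ⟨e • W.vec, by rw [hs]; exact Finset.mem_singleton_self _, hev⟩
    rw [hφ.ord_eq_of_isUnit (isUnit_single _).ne_zero hb (hbu.2 hF0)]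
    have h2 : φ (AddMonoidAlgebra.single (e • W.vec) 1) =
        φ (AddMonoidAlgebra.single W.vec 1) ^ e := by
      rw [← coe_monomialUnit, ← coe_monomialUnit, ofAdd_zsmul, map_zpow]
      exact (Units.coe_map φ.toMonoidHom _).symm.trans (by
        rw [map_zpow, Units.val_zpow_eq_zpow_val]; rfl)
    rw [h2, ord_zpow (hφ.ne_zero (isUnit_single _).ne_zero)]

/-- Here `f` itself generates the maximal ideal, since Laurent polynomials not divisible by `f`
become units. -/
theorem IsLaurentHom.coheight_eq_one_of_prime {f : AddMonoidAlgebra k (ℤ × ℤ)} (hf : Prime f) {P : X}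
    (hP : π P = torusPoint s₁ s₂ s₃ hf) (hs : Function.Surjective (π.stalkMap P)) :
    coheight P = 1 := by
  have h1 : ¬ f ∣ 1 := fun h => hf.not_isUnit (isUnit_of_dvd_one h)
  obtain ⟨a, ha, hau⟩ := hφ.exists_stalk_of_prime h₁₂ h₂₃ hf hP f h1
  rw [map_one, mul_one] at ha
  refine coheight_eq_one_of_maximalIdeal_eq_span (a := a) ?_ (hφ.maximalIdeal_eq_span hs ?_ ?_)
  · rintro rfl
    rw [map_zero] at ha
    exact hφ.ne_zero hf.ne_zero ha.symm
  · rw [hau, not_not]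
  · intro m F hF G hG hFP hGP
    rw [hP, mem_torusPoint_iff hf hF] at hFP
    rw [hP, mem_torusPoint_iff hf hG] at hGP
    obtain ⟨H, hH⟩ := hFP
    obtain ⟨b, hb, -⟩ := hφ.exists_stalk_of_prime h₁₂ h₂₃ hf hP H hGP
    exact ⟨b, by rw [map_mul, mul_assoc, hb, ha, ← map_mul, ← hH]⟩

theorem IsLaurentHom.ord_pos_iff_of_prime {f : AddMonoidAlgebra k (ℤ × ℤ)} (hf : Prime f) {P : X}
    (hP : π P = torusPoint s₁ s₂ s₃ hf) (hs : Function.Surjective (π.stalkMap P))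
    {F : AddMonoidAlgebra k (ℤ × ℤ)} (hF : F ≠ 0) :
    0 < Scheme.ord (φ F) P ↔ f ∣ F := by
  have h1 : ¬ f ∣ 1 := fun h => hf.not_isUnit (isUnit_of_dvd_one h)
  obtain ⟨a, ha, hau⟩ := hφ.exists_stalk_of_prime h₁₂ h₂₃ hf hP F h1
  rw [map_one, mul_one] at ha
  rw [← ha]
  refine ⟨fun h => ?_, fun h => ?_⟩
  · by_contra h2
    exact h.ne' (ord_algebraMap_eq_zero (hau.2 h2))
  · refine ord_algebraMap_pos (hφ.coheight_eq_one_of_prime h₁₂ h₂₃ hf hP hs) ?_ (by rwa [hau, not_not])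
    rintro rfl
    rw [map_zero] at ha
    exact hφ.ne_zero hF ha.symm

end DivisorsAwayFromIdentity

/-! ### The exceptional divisor -/

section ExceptionalDivisor

variable {k : Type u} [Field k] [CharZero k] {s₁ s₂ s₃ : ℚ} (h₁₂ : s₁ < s₂) (h₂₃ : s₂ < s₃)

theorem one_notMem_identityIdeal : (1 : AddMonoidAlgebra k (ℤ × ℤ)) ∉ identityIdeal k := by
  rw [← isUnit_arc_iff, map_one]
  exact isUnit_one

theorem mul_notMem_identityIdeal {F G : AddMonoidAlgebra k (ℤ × ℤ)} (hF : F ∉ identityIdeal k)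
    (hG : G ∉ identityIdeal k) : F * G ∉ identityIdeal k := by
  rw [← isUnit_arc_iff, map_mul]
  exact (isUnit_arc_iff.2 hF).mul (isUnit_arc_iff.2 hG)

theorem exists_stalk_arc (p : toricSurface k s₁ s₂ s₃) (hp : p = torusIdentity k s₁ s₂ s₃) :
    ∃ θ : (toricSurface k s₁ s₂ s₃).presheaf.stalk p →+* PowerSeries (RatFunc k),
      ∀ {m : ℕ} {F G : AddMonoidAlgebra k (coneMonoid s₁ s₂ s₃)}
        (hF : F ∈ coneGrading k s₁ s₂ s₃ m) (hG : G ∈ coneGrading k s₁ s₂ s₃ m)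
        (hGp : G ∉ p.asHomogeneousIdeal),
        θ (toricFraction p hF hG hGp) * arc k (dehomogenize k s₁ s₂ s₃ G) =
          arc k (dehomogenize k s₁ s₂ s₃ F) := by
  refine exists_toricStalk_lift ((arc k).toRingHom.comp (dehomogenize k s₁ s₂ s₃)) ?_
  intro m G hG hGp
  rw [hp, mem_torusIdentity_iff hG] at hGp
  exact isUnit_arc_iff.2 hGp

/-- The local homomorphism from the local ring at the identity of the torus that is given by the
family of arcs `x = 1 + s`, `y = 1 + ts`. -/
def stalkArc (p : toricSurface k s₁ s₂ s₃) (hp : p = torusIdentity k s₁ s₂ s₃) :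
    (toricSurface k s₁ s₂ s₃).presheaf.stalk p ⟶ CommRingCat.of (PowerSeries (RatFunc k)) :=
  CommRingCat.ofHom (exists_stalk_arc p hp).choose

theorem stalkArc_mul {p : toricSurface k s₁ s₂ s₃} (hp : p = torusIdentity k s₁ s₂ s₃) {m : ℕ}
    {F G : AddMonoidAlgebra k (coneMonoid s₁ s₂ s₃)} (hF : F ∈ coneGrading k s₁ s₂ s₃ m)
    (hG : G ∈ coneGrading k s₁ s₂ s₃ m) (hGp : G ∉ p.asHomogeneousIdeal) :
    (stalkArc p hp).hom (toricFraction p hF hG hGp) * arc k (dehomogenize k s₁ s₂ s₃ G) =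
      arc k (dehomogenize k s₁ s₂ s₃ F) :=
  (exists_stalk_arc p hp).choose_spec hF hG hGp

include h₁₂ h₂₃ in
theorem exists_homogenize_at_identity (p : toricSurface k s₁ s₂ s₃)
    (hp : p = torusIdentity k s₁ s₂ s₃) (F : AddMonoidAlgebra k (ℤ × ℤ)) :
    ∃ (m : ℕ) (w : ℤ × ℤ) (F' G' : AddMonoidAlgebra k (coneMonoid s₁ s₂ s₃))
      (_ : F' ∈ coneGrading k s₁ s₂ s₃ m) (_ : G' ∈ coneGrading k s₁ s₂ s₃ m),
      G' ∉ p.asHomogeneousIdeal ∧ (F' ∈ p.asHomogeneousIdeal ↔ F ∈ identityIdeal k) ∧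
      dehomogenize k s₁ s₂ s₃ F' = AddMonoidAlgebra.single w 1 * F ∧
      dehomogenize k s₁ s₂ s₃ G' = AddMonoidAlgebra.single w 1 * 1 := by
  obtain ⟨N, -, ⟨F', hF', eF⟩, G', hG', eG⟩ := exists_homogenize_translate h₁₂ h₂₃ F 1 2 (0, 1)
    (Or.inl (by simp)) (Or.inl (by simp)) (Or.inl (by norm_num))
  refine ⟨N * 2, N • (0, 1), F', G', hF', hG', fun h => ?_, ?_, eF, eG⟩
  · rw [hp, mem_torusIdentity_iff hG', eG, Ideal.unit_mul_mem_iff_mem _ (isUnit_single _)] at h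
    exact one_notMem_identityIdeal h
  · rw [hp, mem_torusIdentity_iff hF', eF, Ideal.unit_mul_mem_iff_mem _ (isUnit_single _)]

theorem isUnit_stalkArc_iff {p : toricSurface k s₁ s₂ s₃} (hp : p = torusIdentity k s₁ s₂ s₃)
    (c : (toricSurface k s₁ s₂ s₃).presheaf.stalk p) :
    IsUnit ((stalkArc p hp).hom c) ↔ IsUnit c := by
  refine ⟨fun h => ?_, fun h => h.map _⟩
  obtain ⟨m, F, G, hF, hG, hGp, rfl⟩ := exists_toricFraction_eq c
  rw [isUnit_toricFraction_iff, hp, mem_torusIdentity_iff hF, ← isUnit_arc_iff,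
    ← stalkArc_mul hp hF hG hGp]
  rw [hp, mem_torusIdentity_iff hG, ← isUnit_arc_iff] at hGp
  exact h.mul hGp

include h₁₂ h₂₃ in
-- The ideal of the identity pulls back to the principal ideal of the arc parameter, reached by `x -
-- 1`. Hence the family of arcs lifts to the blowup.
theorem map_stalkArc_maximalIdeal {p : toricSurface k s₁ s₂ s₃}
    (hp : p = torusIdentity k s₁ s₂ s₃) :
    (IsLocalRing.maximalIdeal ((toricSurface k s₁ s₂ s₃).presheaf.stalk p)).map
      (stalkArc p hp).hom = Ideal.span {(PowerSeries.X : PowerSeries (RatFunc k))} := by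
  refine le_antisymm (Ideal.map_le_iff_le_comap.2 fun c hc => ?_)
    ((Ideal.span_singleton_le_iff_mem _).2 ?_)
  · rw [Ideal.mem_comap, Ideal.mem_span_singleton]
    have h1 : ¬ IsUnit ((stalkArc p hp).hom c) := fun h => hc ((isUnit_stalkArc_iff hp c).1 h)
    rw [PowerSeries.isUnit_iff_constantCoeff, isUnit_iff_ne_zero, not_not] at h1
    exact PowerSeries.X_dvd_iff.2 h1
  · obtain ⟨m, w, F, G, hF, hG, hGp, hFp, eF, eG⟩ := exists_homogenize_at_identity h₁₂ h₂₃ p hp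
      (AddMonoidAlgebra.single (1, 0) 1 - 1)
    have h1 := stalkArc_mul hp hF hG hGp
    rw [eF, eG, map_mul, map_mul, arc_x_sub_one, map_one, mul_one, mul_comm] at h1
    rw [← ((isUnit_single w).map (arc k)).mul_left_cancel h1]
    refine Ideal.mem_map_of_mem _ ?_
    rw [IsLocalRing.mem_maximalIdeal, mem_nonunits_iff, isUnit_toricFraction_iff, not_not, hFp]
    exact Ideal.subset_span (by simp)

theorem SpecMap_stalkArc_fromSpecStalk {p q : toricSurface k s₁ s₂ s₃}
    (hp : p = torusIdentity k s₁ s₂ s₃) (hq : q = torusIdentity k s₁ s₂ s₃) :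
    Spec.map (stalkArc p hp) ≫ (toricSurface k s₁ s₂ s₃).fromSpecStalk p =
      Spec.map (stalkArc q hq) ≫ (toricSurface k s₁ s₂ s₃).fromSpecStalk q := by
  subst hp
  subst hq
  rfl

variable {X : Scheme.{u}} {π : X ⟶ toricSurface k s₁ s₂ s₃}
  (hπ : IsBlowup π (pointIdeal (torusIdentity k s₁ s₂ s₃)))

include h₁₂ h₂₃ hπ in
/-- The blowup has a point over the identity whose local ring maps to the power series ring, such that
the family of arcs lifts. -/
theorem exists_exceptionalPoint : ∃ (E : X) (hE : π E = torusIdentity k s₁ s₂ s₃)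
    (σ : X.presheaf.stalk E ⟶ CommRingCat.of (PowerSeries (RatFunc k))),
    IsLocalHom σ.hom ∧ π.stalkMap E ≫ σ = stalkArc (π E) hE := by
  obtain ⟨h, hh⟩ := (hπ.existsUnique_lift _ (inverseImageIsInvertible_SpecMap rfl
    (stalkArc (torusIdentity k s₁ s₂ s₃) rfl)
    (mem_nonZeroDivisors_of_ne_zero PowerSeries.X_ne_zero)
    (map_stalkArc_maximalIdeal h₁₂ h₂₃ rfl))).exists
  have hloc : IsLocalHom (stalkArc (torusIdentity k s₁ s₂ s₃) rfl).hom :=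
    ⟨fun c hc => (isUnit_stalkArc_iff rfl c).1 hc⟩
  -- The point `E` is the image of the closed point under the lifted arc.
  have hE : π (h (IsLocalRing.closedPoint (PowerSeries (RatFunc k)))) =
      torusIdentity k s₁ s₂ s₃ := by
    have h1 := congrArg (fun f : Spec (.of (PowerSeries (RatFunc k))) ⟶ toricSurface k s₁ s₂ s₃ =>
      f (IsLocalRing.closedPoint (PowerSeries (RatFunc k)))) hh
    refine h1.trans ?_
    refine (congrArg ((toricSurface k s₁ s₂ s₃).fromSpecStalk (torusIdentity k s₁ s₂ s₃))
      (IsLocalRing.comap_closedPoint (stalkArc (torusIdentity k s₁ s₂ s₃) rfl).hom)).trans ?_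
    exact Scheme.fromSpecStalk_closedPoint
  refine ⟨_, hE, Scheme.stalkClosedPointTo h, inferInstance, ?_⟩
  refine Spec.map_injective ?_
  rw [← cancel_mono ((toricSurface k s₁ s₂ s₃).fromSpecStalk _),
    SpecMap_stalkArc_fromSpecStalk hE rfl, ← hh, Spec.map_comp, Category.assoc,
    Scheme.SpecMap_stalkMap_fromSpecStalk, ← Category.assoc,
    Scheme.Spec_stalkClosedPointTo_fromSpecStalk]

end ExceptionalDivisor

/-! ### Local equations of the exceptional divisor -/

section PointsOverIdentity

variable {k : Type u} [Field k] [CharZero k] {s₁ s₂ s₃ : ℚ} (h₁₂ : s₁ < s₂) (h₂₃ : s₂ < s₃)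
  {X : Scheme.{u}} [IsIntegral X] {π : X ⟶ toricSurface k s₁ s₂ s₃}
  {φ : AddMonoidAlgebra k (ℤ × ℤ) →+* X.functionField} (hφ : IsLaurentHom π φ)

include hφ h₁₂ h₂₃

theorem IsLaurentHom.exists_germ {P : X} (hP : π P = torusIdentity k s₁ s₂ s₃)
    (F : AddMonoidAlgebra k (ℤ × ℤ)) :
    ∃ c : (toricSurface k s₁ s₂ s₃).presheaf.stalk (π P),
      algebraMap _ X.functionField ((π.stalkMap P).hom c) = φ F ∧
      (IsUnit c ↔ F ∉ identityIdeal k) ∧ (stalkArc (π P) hP).hom c = arc k F := by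
  obtain ⟨m, w, F', G', hF, hG, hGp, hFp, eF, eG⟩ := exists_homogenize_at_identity h₁₂ h₂₃ _ hP F
  refine ⟨toricFraction (π P) hF hG hGp, ?_, ?_, ?_⟩
  · have h1 := hφ.stalkMap_mul P hF hG hGp
    rw [eF, eG, map_mul, map_mul φ _ F, map_one, mul_one, mul_comm] at h1
    exact ((isUnit_single w).map φ).mul_left_cancel h1
  · rw [isUnit_toricFraction_iff, hFp]
  · have h1 := stalkArc_mul hP hF hG hGp
    rw [eF, eG, map_mul, map_mul _ _ F, map_one, mul_one, mul_comm] at h1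
    exact ((isUnit_single w).map (arc k)).mul_left_cancel h1

theorem IsLaurentHom.exists_unit_germ {P : X} (hP : π P = torusIdentity k s₁ s₂ s₃)
    {F : AddMonoidAlgebra k (ℤ × ℤ)} (hF : F ∉ identityIdeal k) :
    ∃ c : (X.presheaf.stalk P)ˣ, algebraMap _ X.functionField (c : X.presheaf.stalk P) = φ F := by
  obtain ⟨c, hc, hcu, -⟩ := hφ.exists_germ h₁₂ h₂₃ hP F
  exact ⟨((hcu.2 hF).map (π.stalkMap P).hom).unit, hc⟩

/-- At a point over the identity, one of `x - 1`, `y - 1` divides the ideal of the identity. -/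
theorem IsLaurentHom.exists_generator
    (hπ : InverseImageIsInvertible (pointIdeal (torusIdentity k s₁ s₂ s₃)) π) {P : X}
    (hP : π P = torusIdentity k s₁ s₂ s₃) :
    ∃ ξ ∈ identityIdeal k, (∃ u, IsUnit u ∧ arc k ξ = u * PowerSeries.X) ∧
      ∀ n, ∀ F ∈ identityIdeal k ^ n,
        ∃ b : X.presheaf.stalk P, algebraMap _ X.functionField b * φ ξ ^ n = φ F := by
  obtain ⟨a, ha, hspan⟩ := hπ.exists_map_stalkMap_eq hP
  have hxI : (AddMonoidAlgebra.single (1, 0) 1 - 1 : AddMonoidAlgebra k (ℤ × ℤ)) ∈ identityIdeal k :=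
    Ideal.subset_span (by simp)
  have hyI : (AddMonoidAlgebra.single (0, 1) 1 - 1 : AddMonoidAlgebra k (ℤ × ℤ)) ∈ identityIdeal k :=
    Ideal.subset_span (by simp)
  have mem {F : AddMonoidAlgebra k (ℤ × ℤ)} (hF : F ∈ identityIdeal k) :
      ∃ b : X.presheaf.stalk P, algebraMap _ X.functionField (b * a) = φ F := by
    obtain ⟨c, hc, hcu, -⟩ := hφ.exists_germ h₁₂ h₂₃ hP F
    have h1 : (π.stalkMap P).hom c ∈ Ideal.span {a} := by
      rw [← hspan]
      exact Ideal.mem_map_of_mem _ (fun h => hcu.1 h hF)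
    obtain ⟨b, hb⟩ := Ideal.mem_span_singleton'.1 h1
    exact ⟨b, by rw [hb, hc]⟩
  obtain ⟨u, hu⟩ := mem hxI
  obtain ⟨v, hv⟩ := mem hyI
  -- The pulled back ideal is generated by `x - 1 = ua` and `y - 1 = va`, and also by `a`. So `ru +
  -- sv = 1` for some `r`, `s`, and in a local ring `u` or `v` is a unit.
  have hle : (IsLocalRing.maximalIdeal ((toricSurface k s₁ s₂ s₃).presheaf.stalk (π P))).map
      (π.stalkMap P).hom ≤ Ideal.span {u * a, v * a} := by
    rw [Ideal.map_le_iff_le_comap]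
    intro c hc
    obtain ⟨m, F, G, hF, hG, hGp, rfl⟩ := exists_toricFraction_eq c
    rw [IsLocalRing.mem_maximalIdeal, mem_nonunits_iff, isUnit_toricFraction_iff, not_not, hP,
      mem_torusIdentity_iff hF, identityIdeal, Ideal.mem_span_pair] at hc
    obtain ⟨A, B, hAB⟩ := hc
    have hGp' := hGp
    rw [hP, mem_torusIdentity_iff hG] at hGp'
    obtain ⟨g, hg⟩ := hφ.exists_unit_germ h₁₂ h₂₃ hP hGp'
    obtain ⟨A', hA, -⟩ := hφ.exists_germ h₁₂ h₂₃ hP A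
    obtain ⟨B', hB, -⟩ := hφ.exists_germ h₁₂ h₂₃ hP B
    have h1 := hφ.stalkMap_mul P hF hG hGp
    rw [← hAB, map_add, map_mul, map_mul, ← hu, ← hv, ← hg, ← hA, ← hB, ← map_mul, ← map_mul,
      ← map_mul, ← map_add] at h1
    have h2 := algebraMap_stalk_injective P h1
    rw [Ideal.mem_comap]
    refine (Ideal.mul_unit_mem_iff_mem _ g.isUnit).1 ?_
    rw [h2]
    exact Ideal.mem_span_pair.2 ⟨_, _, rfl⟩
  have huv : IsUnit u ∨ IsUnit v := by
    have h1 : a ∈ Ideal.span {u * a, v * a} := hle (hspan ▸ Ideal.mem_span_singleton_self a)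
    obtain ⟨r, s, hrs⟩ := Ideal.mem_span_pair.1 h1
    have h2 : (r * u + s * v) * a = 1 * a := by rw [one_mul]; linear_combination hrs
    have h3 : r * u + s * v = 1 := (mul_cancel_right_mem_nonZeroDivisors ha).1 h2
    rcases IsLocalRing.isUnit_or_isUnit_of_add_one h3 with h | h
    · exact Or.inl (isUnit_of_mul_isUnit_right h)
    · exact Or.inr (isUnit_of_mul_isUnit_right h)
  obtain ⟨ξ, hξI, hξarc, w, hw, hwξ⟩ : ∃ ξ ∈ identityIdeal k,
      (∃ u, IsUnit u ∧ arc k ξ = u * PowerSeries.X) ∧ ∃ w : X.presheaf.stalk P, IsUnit w ∧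
        algebraMap _ X.functionField (w * a) = φ ξ := by
    rcases huv with h | h
    · exact ⟨_, hxI, ⟨1, isUnit_one, by rw [arc_x_sub_one, one_mul]⟩, u, h, hu⟩
    · exact ⟨_, hyI, ⟨_, (isUnit_iff_ne_zero.2 RatFunc.X_ne_zero).map _, arc_y_sub_one⟩, v, h, hv⟩
  refine ⟨ξ, hξI, hξarc, fun n => ?_⟩
  -- The Laurent polynomials divisible by `ξ^n` in the local ring form an ideal; divisibility is
  -- multiplicative, so the case `n = 1` gives all powers.
  let J (n : ℕ) : Ideal (AddMonoidAlgebra k (ℤ × ℤ)) :=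
    { carrier := {F | ∃ b : X.presheaf.stalk P, algebraMap _ X.functionField b * φ ξ ^ n = φ F}
      zero_mem' := ⟨0, by simp⟩
      add_mem' := by
        rintro F G ⟨b, hb⟩ ⟨c, hc⟩
        exact ⟨b + c, by rw [map_add, map_add, add_mul, hb, hc]⟩
      smul_mem' := by
        rintro F G ⟨b, hb⟩
        obtain ⟨c, hc, -⟩ := hφ.exists_germ h₁₂ h₂₃ hP F
        exact ⟨(π.stalkMap P).hom c * b, by rw [map_mul, mul_assoc, hb, hc, smul_eq_mul, map_mul]⟩ }
  have h1 : identityIdeal k ≤ J 1 := by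
    intro F hF
    obtain ⟨b, hb⟩ := mem hF
    obtain ⟨w, rfl⟩ := hw
    refine ⟨b * ((w⁻¹ : (X.presheaf.stalk P)ˣ) : X.presheaf.stalk P), ?_⟩
    rw [pow_one, ← hwξ, ← hb, ← map_mul]
    have := w.inv_mul
    congr 1
    linear_combination (b * a) * this
  suffices identityIdeal k ^ n ≤ J n from fun F hF => this hF
  induction n with
  | zero =>
    intro F _
    obtain ⟨c, hc, -⟩ := hφ.exists_germ h₁₂ h₂₃ hP F
    exact ⟨(π.stalkMap P).hom c, by rw [pow_zero, mul_one, hc]⟩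
  | succ n ih =>
    rw [pow_succ]
    refine Ideal.mul_le.2 fun F hF G hG => ?_
    obtain ⟨b, hb⟩ := ih hF
    obtain ⟨c, hc⟩ := h1 hG
    rw [pow_one] at hc
    exact ⟨b * c, by rw [map_mul, map_mul, ← hb, ← hc]; ring⟩

omit h₁₂ h₂₃ [CharZero k] in
-- One point with surjective stalk map is enough, because the function field is the fraction field
-- of every local ring. A point outside the exceptional divisor will serve.
theorem IsLaurentHom.exists_eq_div {P : X} (hs : Function.Surjective (π.stalkMap P))
    (f : X.functionField) : ∃ F G : AddMonoidAlgebra k (ℤ × ℤ), G ≠ 0 ∧ f * φ G = φ F := by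
  have key (c : X.presheaf.stalk P) : ∃ F G : AddMonoidAlgebra k (ℤ × ℤ), G ≠ 0 ∧
      algebraMap _ X.functionField c * φ G = φ F := by
    obtain ⟨c, rfl⟩ := hs c
    obtain ⟨m, F, G, hF, hG, hGp, rfl⟩ := exists_toricFraction_eq c
    refine ⟨dehomogenize k s₁ s₂ s₃ F, dehomogenize k s₁ s₂ s₃ G, ?_, hφ.stalkMap_mul P hF hG hGp⟩
    rw [ne_eq, dehomogenize_eq_zero_iff hG]
    rintro rfl
    exact hGp (zero_mem _)
  obtain ⟨a, b, hb, rfl⟩ := IsFractionRing.div_surjective (A := X.presheaf.stalk P) f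
  obtain ⟨F, G, hG, h1⟩ := key a
  obtain ⟨F', G', hG', h2⟩ := key b
  have hb0 : algebraMap (X.presheaf.stalk P) X.functionField b ≠ 0 :=
    (map_ne_zero_iff _ (algebraMap_stalk_injective P)).2 (nonZeroDivisors.ne_zero hb)
  refine ⟨F * G', G * F', mul_ne_zero hG fun h => ?_, ?_⟩
  · rw [h, map_zero] at h2
    exact mul_ne_zero hb0 (hφ.ne_zero hG') h2
  · rw [map_mul, map_mul, ← h1, ← h2]
    field_simp

end PointsOverIdentity

/-! ### The order along the exceptional divisor is the multiplicity at the identity -/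

section ExceptionalOrder

variable {k : Type u} [Field k] [CharZero k] {s₁ s₂ s₃ : ℚ} (h₁₂ : s₁ < s₂) (h₂₃ : s₂ < s₃)
  {X : Scheme.{u}} [IsIntegral X] {π : X ⟶ toricSurface k s₁ s₂ s₃}
  {φ : AddMonoidAlgebra k (ℤ × ℤ) →+* X.functionField} (hφ : IsLaurentHom π φ)

theorem exists_mem_identityIdeal_pow {F : AddMonoidAlgebra k (ℤ × ℤ)} (hF : F ≠ 0) :
    ∃ n, F ∈ identityIdeal k ^ n ∧ F ∉ identityIdeal k ^ (n + 1) := by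
  classical
  have h : ∃ n, F ∉ identityIdeal k ^ n := by
    by_contra! h
    exact hF (eq_zero_of_forall_vanishesToOrder fun b => mem_identityIdeal_pow_iff.1 (h b))
  obtain ⟨n, hn⟩ : ∃ n, Nat.find h = n + 1 := by
    refine Nat.exists_eq_succ_of_ne_zero fun h0 => ?_
    have := Nat.find_spec h
    rw [h0, pow_zero, Ideal.one_eq_top] at this
    exact this Submodule.mem_top
  refine ⟨n, ?_, hn ▸ Nat.find_spec h⟩
  by_contra h'
  have := Nat.find_min' h h'
  omega

variable {E : X} (hE : π E = torusIdentity k s₁ s₂ s₃)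
    {σ : X.presheaf.stalk E ⟶ CommRingCat.of (PowerSeries (RatFunc k))}
    (hσ : IsLocalHom σ.hom) (hσE : π.stalkMap E ≫ σ = stalkArc (π E) hE)

include hφ h₁₂ h₂₃ hσE

theorem IsLaurentHom.arc_mul {a : X.presheaf.stalk E} {F G : AddMonoidAlgebra k (ℤ × ℤ)}
    (ha : algebraMap _ X.functionField a * φ G = φ F) : σ.hom a * arc k G = arc k F := by
  obtain ⟨f, hf, -, hf'⟩ := hφ.exists_germ h₁₂ h₂₃ hE F
  obtain ⟨g, hg, -, hg'⟩ := hφ.exists_germ h₁₂ h₂₃ hE G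
  rw [← hf, ← hg, ← map_mul] at ha
  have h1 := algebraMap_stalk_injective E ha
  rw [← hf', ← hg', ← hσE]
  change σ.hom a * σ.hom ((π.stalkMap E).hom g) = σ.hom ((π.stalkMap E).hom f)
  rw [← h1, map_mul]

include hσ

/-- Along the arc `ξ` has order one, so `b = F / ξ^n` has constant term zero iff the arc order of
`F` exceeds `n`; the local homomorphism `σ` detects units. -/
theorem IsLaurentHom.isUnit_iff_of_mul_pow {ξ : AddMonoidAlgebra k (ℤ × ℤ)}
    (hξ : ∃ u, IsUnit u ∧ arc k ξ = u * PowerSeries.X) {n : ℕ} {F : AddMonoidAlgebra k (ℤ × ℤ)}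
    {b : X.presheaf.stalk E} (hb : algebraMap _ X.functionField b * φ ξ ^ n = φ F) :
    IsUnit b ↔ F ∉ identityIdeal k ^ (n + 1) := by
  obtain ⟨u, hu, hξ⟩ := hξ
  rw [← map_pow] at hb
  have h1 := hφ.arc_mul h₁₂ h₂₃ hE hσE hb
  rw [mem_identityIdeal_pow_iff, ← X_pow_dvd_arc_iff, ← h1, map_pow, hξ, mul_pow,
    ← isUnit_map_iff σ.hom b, pow_succ' (PowerSeries.X : PowerSeries (RatFunc k)), ← mul_assoc,
    mul_dvd_mul_iff_right (pow_ne_zero n PowerSeries.X_ne_zero), (hu.pow n).dvd_mul_right,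
    PowerSeries.X_dvd_iff]
  exact PowerSeries.isUnit_iff_constantCoeff.trans isUnit_iff_ne_zero

variable (hπ : InverseImageIsInvertible (pointIdeal (torusIdentity k s₁ s₂ s₃)) π)
  {Q : X} (hQ : Function.Surjective (π.stalkMap Q))

include hπ hQ

theorem IsLaurentHom.exists_maximalIdeal_eq_span : ∃ (ξ : AddMonoidAlgebra k (ℤ × ℤ))
    (a : X.presheaf.stalk E), a ≠ 0 ∧ algebraMap _ X.functionField a = φ ξ ∧
      IsLocalRing.maximalIdeal (X.presheaf.stalk E) = Ideal.span {a} ∧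
      ∀ n, ∀ F ∈ identityIdeal k ^ n, ∃ b : X.presheaf.stalk E,
        algebraMap _ X.functionField b * φ ξ ^ n = φ F ∧
          (IsUnit b ↔ F ∉ identityIdeal k ^ (n + 1)) := by
  obtain ⟨ξ, hξI, hξ, hpow⟩ := hφ.exists_generator h₁₂ h₂₃ hπ hE
  have hpow' : ∀ n, ∀ F ∈ identityIdeal k ^ n, ∃ b : X.presheaf.stalk E,
        algebraMap _ X.functionField b * φ ξ ^ n = φ F ∧
          (IsUnit b ↔ F ∉ identityIdeal k ^ (n + 1)) := fun n F hF => by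
    obtain ⟨b, hb⟩ := hpow n F hF
    exact ⟨b, hb, hφ.isUnit_iff_of_mul_pow h₁₂ h₂₃ hE hσ hσE hξ hb⟩
  have hξ0 : ξ ≠ 0 := by
    rintro rfl
    obtain ⟨u, hu, h⟩ := hξ
    rw [map_zero] at h
    exact mul_ne_zero hu.ne_zero PowerSeries.X_ne_zero h.symm
  obtain ⟨c, hc, hcu, -⟩ := hφ.exists_germ h₁₂ h₂₃ hE ξ
  refine ⟨ξ, (π.stalkMap E).hom c, ?_, hc, ?_, hpow'⟩
  · intro h
    rw [h, map_zero] at hc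
    exact hφ.ne_zero hξ0 hc.symm
  · refine le_antisymm (fun z hz => ?_) ((Ideal.span_singleton_le_iff_mem _).2 ?_)
    -- Write a nonunit as `F / G` with `G` of multiplicity exactly `n`. Then `F` has multiplicity at
    -- least `n + 1`, so `F = f ξ^(n+1)` and `G = g ξ^n` with `g` a unit, and `ξ` divides the
    -- quotient.
    · obtain ⟨F, G, hG, hFG⟩ := hφ.exists_eq_div hQ (algebraMap _ X.functionField z)
      obtain ⟨n, hn, hn'⟩ := exists_mem_identityIdeal_pow hG
      have hF : F ∈ identityIdeal k ^ (n + 1) := by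
        rw [mem_identityIdeal_pow_iff, ← X_pow_dvd_arc_iff, ← hφ.arc_mul h₁₂ h₂₃ hE hσE hFG, pow_succ']
        refine mul_dvd_mul ?_ (X_pow_dvd_arc hn)
        have h1 : ¬ IsUnit (σ.hom z) := fun h => hz ((isUnit_map_iff σ.hom z).1 h)
        rw [PowerSeries.X_dvd_iff]
        by_contra h2
        exact h1 (PowerSeries.isUnit_iff_constantCoeff.2 (isUnit_iff_ne_zero.2 h2))
      obtain ⟨f, hf, -⟩ := hpow' _ F hF
      obtain ⟨g, hg, hgu⟩ := hpow' n G hn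
      obtain ⟨g, rfl⟩ := hgu.2 hn'
      refine Ideal.mem_span_singleton.2 ⟨f * ((g⁻¹ : (X.presheaf.stalk E)ˣ) : X.presheaf.stalk E), ?_⟩
      rw [← mul_assoc, Units.eq_mul_inv_iff_mul_eq]
      refine algebraMap_stalk_injective E (mul_right_cancel₀ (pow_ne_zero n (hφ.ne_zero hξ0)) ?_)
      rw [map_mul, mul_assoc, hg, hFG, ← hf, map_mul, hc]
      ring
    · exact fun h => hcu.1 ((isUnit_of_map_unit (π.stalkMap E).hom _ h)) hξI

variable [IsLocallyNoetherian X]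

theorem IsLaurentHom.coheight_exceptional : coheight E = 1 := by
  obtain ⟨ξ, a, ha, -, h, -⟩ := hφ.exists_maximalIdeal_eq_span h₁₂ h₂₃ hE hσ hσE hπ hQ
  exact coheight_eq_one_of_maximalIdeal_eq_span ha h

theorem IsLaurentHom.exists_ord_exceptional : ∃ e : ℤ, 0 < e ∧ ∀ F, F ≠ 0 → ∀ n : ℕ,
    VanishesToOrder n F ↔ n * e ≤ Scheme.ord (φ F) E := by
  obtain ⟨ξ, a, ha, haξ, h, hpow⟩ := hφ.exists_maximalIdeal_eq_span h₁₂ h₂₃ hE hσ hσE hπ hQ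
  have hpos : 0 < Scheme.ord (φ ξ) E := by
    rw [← haξ]
    refine ord_algebraMap_pos (coheight_eq_one_of_maximalIdeal_eq_span ha h) ha fun hu => ?_
    exact (h ▸ Ideal.mem_span_singleton_self a : a ∈ IsLocalRing.maximalIdeal _) hu
  refine ⟨_, hpos, fun F hF n => ?_⟩
  obtain ⟨N, hN, hN'⟩ := exists_mem_identityIdeal_pow hF
  obtain ⟨b, hb, hbu⟩ := hpow N F hN
  have hξ0 : φ ξ ≠ 0 := haξ ▸ (map_ne_zero_iff _ (algebraMap_stalk_injective E)).2 ha
  have hord : Scheme.ord (φ F) E = N * Scheme.ord (φ ξ) E := by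
    rw [← hb, Scheme.ord_mul ((hbu.2 hN').map _).ne_zero (pow_ne_zero _ hξ0),
      ord_algebraMap_eq_zero (hbu.2 hN'), zero_add, ord_pow hξ0]
  rw [hord, mul_le_mul_iff_of_pos_right hpos, Nat.cast_le, ← mem_identityIdeal_pow_iff]
  refine ⟨fun h1 => ?_, fun h1 => Ideal.pow_le_pow_right h1 hN⟩
  by_contra h2
  exact hN' (Ideal.pow_le_pow_right (by omega) h1)

end ExceptionalOrder

/-! ### Uniqueness of the prime divisor over the identity -/

section UniqueExceptional

theorem exists_stalk_lift {X : Scheme.{u}} [IsIntegral X] (P : X) (B : Subring X.functionField)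
    (hB : ∀ z ∈ B, ∃ b : X.presheaf.stalk P, algebraMap _ X.functionField b = z) :
    ∃ β : B →+* X.presheaf.stalk P, ∀ z, algebraMap _ X.functionField (β z) = z := by
  choose β hβ using fun z : B => hB z z.2
  have inj := algebraMap_stalk_injective P
  exact ⟨{ toFun := β
           map_one' := inj (by rw [hβ, map_one]; rfl)
           map_zero' := inj (by rw [hβ, map_zero]; rfl)
           map_mul' := fun x y => inj (by rw [hβ, map_mul, hβ, hβ]; rfl)
           map_add' := fun x y => inj (by rw [hβ, map_add, hβ, hβ]; rfl) }, hβ⟩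

variable {k : Type u} [Field k] [CharZero k] {s₁ s₂ s₃ : ℚ} (h₁₂ : s₁ < s₂) (h₂₃ : s₂ < s₃)
  {X : Scheme.{u}} [IsIntegral X] {π : X ⟶ toricSurface k s₁ s₂ s₃}
  {φ : AddMonoidAlgebra k (ℤ × ℤ) →+* X.functionField} (hφ : IsLaurentHom π φ)

/-- An affine chart of the blowup, in the local ring of a point of the exceptional divisor, as a
subring of the function field. -/
def blowupChart (φ : AddMonoidAlgebra k (ℤ × ℤ) →+* X.functionField) (ξ : AddMonoidAlgebra k (ℤ × ℤ)) :
    Subring X.functionField where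
  carrier := {z | ∃ (n : ℕ) (F G : AddMonoidAlgebra k (ℤ × ℤ)), F ∈ identityIdeal k ^ n ∧
    G ∉ identityIdeal k ∧ z * (φ G * φ ξ ^ n) = φ F}
  zero_mem' := ⟨0, 0, 1, zero_mem _, one_notMem_identityIdeal, by simp⟩
  one_mem' := ⟨0, 1, 1, by simp, one_notMem_identityIdeal, by simp⟩
  mul_mem' := by
    rintro z z' ⟨n, F, G, hF, hG, h⟩ ⟨n', F', G', hF', hG', h'⟩
    refine ⟨n + n', F * F', G * G', pow_add (identityIdeal k) n n' ▸ Ideal.mul_mem_mul hF hF',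
      mul_notMem_identityIdeal hG hG', ?_⟩
    rw [map_mul, map_mul, ← h, ← h']
    ring
  add_mem' := by
    rintro z z' ⟨n, F, G, hF, hG, h⟩ ⟨n', F', G', hF', hG', h'⟩
    -- If `ξ` is in the ideal, a common denominator keeps the numerators in the right power;
    -- otherwise powers of `ξ` may be absorbed in `G`, and exponent `0` works.
    by_cases hξ : ξ ∈ identityIdeal k
    · refine ⟨n + n', F * (G' * ξ ^ n') + F' * (G * ξ ^ n), G * G', add_mem ?_ ?_,
        mul_notMem_identityIdeal hG hG', ?_⟩
      · rw [pow_add]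
        exact Ideal.mul_mem_mul hF (Ideal.mul_mem_left _ _ (Ideal.pow_mem_pow hξ _))
      · rw [add_comm, pow_add]
        exact Ideal.mul_mem_mul hF' (Ideal.mul_mem_left _ _ (Ideal.pow_mem_pow hξ _))
      · simp only [map_add, map_mul, map_pow, ← h, ← h']
        ring
    · have key (j : ℕ) : ξ ^ j ∉ identityIdeal k := by
        rw [← isUnit_arc_iff, map_pow]
        exact (isUnit_arc_iff.2 hξ).pow j
      refine ⟨0, F * (G' * ξ ^ n') + F' * (G * ξ ^ n), (G * ξ ^ n) * (G' * ξ ^ n'), by simp,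
        mul_notMem_identityIdeal (mul_notMem_identityIdeal hG (key _))
          (mul_notMem_identityIdeal hG' (key _)), ?_⟩
      simp only [map_add, map_mul, map_pow, ← h, ← h']
      ring
  neg_mem' := by
    rintro z ⟨n, F, G, hF, hG, h⟩
    exact ⟨n, -F, G, neg_mem hF, hG, by rw [map_neg, ← h, neg_mul]⟩

include hφ h₁₂ h₂₃

theorem IsLaurentHom.exists_of_mem_blowupChart {P : X} (hP : π P = torusIdentity k s₁ s₂ s₃)
    {ξ : AddMonoidAlgebra k (ℤ × ℤ)} (hξ0 : ξ ≠ 0)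
    (hpow : ∀ n, ∀ F ∈ identityIdeal k ^ n,
        ∃ b : X.presheaf.stalk P, algebraMap _ X.functionField b * φ ξ ^ n = φ F)
    {z : X.functionField} {n : ℕ} {F G : AddMonoidAlgebra k (ℤ × ℤ)} (hF : F ∈ identityIdeal k ^ n)
    (hG : G ∉ identityIdeal k) (hz : z * (φ G * φ ξ ^ n) = φ F) :
    ∃ b g : X.presheaf.stalk P, IsUnit g ∧ algebraMap _ X.functionField b * φ ξ ^ n = φ F ∧
      z = algebraMap _ X.functionField (b * g) := by
  obtain ⟨b, hb⟩ := hpow n F hF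
  obtain ⟨g, hg⟩ := hφ.exists_unit_germ h₁₂ h₂₃ hP hG
  refine ⟨b, ((g⁻¹ : (X.presheaf.stalk P)ˣ) : X.presheaf.stalk P), Units.isUnit _, hb, ?_⟩
  refine mul_right_cancel₀ (mul_ne_zero ((g.isUnit.map (algebraMap _ X.functionField)).ne_zero)
    (pow_ne_zero n (hφ.ne_zero hξ0))) ?_
  rw [hg, hz, ← hg, ← hb, ← mul_assoc, ← map_mul, mul_assoc b, Units.inv_mul, mul_one]

variable {E : X} (hE : π E = torusIdentity k s₁ s₂ s₃)
    {σ : X.presheaf.stalk E ⟶ CommRingCat.of (PowerSeries (RatFunc k))}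
    (hσ : IsLocalHom σ.hom) (hσE : π.stalkMap E ≫ σ = stalkArc (π E) hE)
  (hπ : IsBlowup π (pointIdeal (torusIdentity k s₁ s₂ s₃)))

include hπ hσ hσE

/-- Thus `E` is the generic point of the fibre, and the only prime divisor over the identity. With
`ξ` a local equation at `P`, the chart of the fractions `F / (G ξ^n)` maps to the local rings of `P`
and `E`. A fraction that is a nonunit at `E` has `F` in the `(n+1)`-st power of the ideal, so it is
`ξ` times a regular germ at `P`, a nonunit there as well: the centers are nested. -/
theorem IsLaurentHom.exceptional_specializes {P : X} (hP : π P = torusIdentity k s₁ s₂ s₃) :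
    E ⤳ P := by
  obtain ⟨ξ, hξI, hξ, hpow⟩ := hφ.exists_generator h₁₂ h₂₃ hπ.invertible hP
  have hξ0 : ξ ≠ 0 := by
    rintro rfl
    obtain ⟨u, hu, h⟩ := hξ
    rw [map_zero] at h
    exact mul_ne_zero hu.ne_zero PowerSeries.X_ne_zero h.symm
  have hφξ := hφ.ne_zero hξ0
  -- The equation `ξ` found at `P` serves at `E` too: it is a unit times the one found at `E`, since
  -- its arc order is exactly one.
  have hpowE : ∀ n, ∀ F ∈ identityIdeal k ^ n, ∃ b : X.presheaf.stalk E,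
      algebraMap _ X.functionField b * φ ξ ^ n = φ F := by
    obtain ⟨ξ', hξ'I, hξ', hpow'⟩ := hφ.exists_generator h₁₂ h₂₃ hπ.invertible hE
    obtain ⟨c, hc⟩ := hpow' 1 ξ (by rwa [pow_one])
    have hcu : IsUnit c := by
      rw [hφ.isUnit_iff_of_mul_pow h₁₂ h₂₃ hE hσ hσE hξ' hc]
      obtain ⟨u, hu, h⟩ := hξ
      rw [mem_identityIdeal_pow_iff, ← X_pow_dvd_arc_iff, h, hu.dvd_mul_left, pow_succ, pow_one]
      intro hd
      have h2 : (PowerSeries.X : PowerSeries (RatFunc k)) ∣ 1 :=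
        (mul_dvd_mul_iff_right PowerSeries.X_ne_zero).1 (by rwa [one_mul])
      exact PowerSeries.X_prime.not_isUnit (isUnit_of_dvd_one h2)
    obtain ⟨c, rfl⟩ := hcu
    intro n F hF
    obtain ⟨b, hb⟩ := hpow' n F hF
    refine ⟨b * ((c⁻¹ : (X.presheaf.stalk E)ˣ) : X.presheaf.stalk E) ^ n, ?_⟩
    rw [← hc, ← hb, pow_one, mul_pow, ← map_pow _ (c : X.presheaf.stalk E), ← mul_assoc, ← map_mul,
      mul_assoc b, ← mul_pow, Units.inv_mul, one_pow, mul_one]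
  have lift {R : X} (hR : π R = torusIdentity k s₁ s₂ s₃)
      (hpowR : ∀ n, ∀ F ∈ identityIdeal k ^ n, ∃ b : X.presheaf.stalk R,
        algebraMap _ X.functionField b * φ ξ ^ n = φ F) :
      ∃ β : blowupChart φ ξ →+* X.presheaf.stalk R, ∀ z, algebraMap _ X.functionField (β z) = z := by
    refine exists_stalk_lift R _ ?_
    rintro z ⟨n, F, G, hF, hG, hz⟩
    obtain ⟨b, g, -, -, h⟩ := hφ.exists_of_mem_blowupChart h₁₂ h₂₃ hR hξ0 hpowR hF hG hz
    exact ⟨_, h.symm⟩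
  obtain ⟨βP, hβP⟩ := lift hP hpow
  obtain ⟨βE, hβE⟩ := lift hE hpowE
  let α : (toricSurface k s₁ s₂ s₃).presheaf.stalk (π P) →+* blowupChart φ ξ :=
    ((algebraMap (X.presheaf.stalk P) X.functionField).comp (π.stalkMap P).hom).codRestrict
      (blowupChart φ ξ) (fun c => by
        obtain ⟨m, F, G, hF, hG, hGp, rfl⟩ := exists_toricFraction_eq c
        have h1 := hφ.stalkMap_mul P hF hG hGp
        rw [hP, mem_torusIdentity_iff hG] at hGp
        exact ⟨0, _, _, by simp, hGp, by rw [pow_zero, mul_one]; exact h1⟩)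
  have hα (c) : ((α c : blowupChart φ ξ) : X.functionField) =
    algebraMap _ X.functionField ((π.stalkMap P).hom c) := rfl
  have hξB : φ ξ ∈ blowupChart φ ξ :=
    ⟨0, ξ, 1, by simp, one_notMem_identityIdeal, by simp⟩
  have hαξ : (IsLocalRing.maximalIdeal ((toricSurface k s₁ s₂ s₃).presheaf.stalk (π P))).map α =
      Ideal.span {(⟨φ ξ, hξB⟩ : blowupChart φ ξ)} := by
    refine le_antisymm (Ideal.map_le_iff_le_comap.2 fun c hc => ?_)
      ((Ideal.span_singleton_le_iff_mem _).2 ?_)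
    · obtain ⟨m, F, G, hF, hG, hGp, rfl⟩ := exists_toricFraction_eq c
      rw [IsLocalRing.mem_maximalIdeal, mem_nonunits_iff, isUnit_toricFraction_iff, not_not, hP,
        mem_torusIdentity_iff hF] at hc
      have h1 := hφ.stalkMap_mul P hF hG hGp
      have hGp' := hGp
      rw [hP, mem_torusIdentity_iff hG] at hGp'
      have hG0 : φ (dehomogenize k s₁ s₂ s₃ G) ≠ 0 := hφ.ne_zero fun h => hGp' (h ▸ zero_mem _)
      refine Ideal.mem_span_singleton.2 ⟨⟨φ (dehomogenize k s₁ s₂ s₃ F) /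
        (φ (dehomogenize k s₁ s₂ s₃ G) * φ ξ ^ 1), 1, _, _, by rwa [pow_one], hGp',
          div_mul_cancel₀ _ (mul_ne_zero hG0 (pow_ne_zero _ hφξ))⟩, Subtype.ext ?_⟩
      rw [hα]
      change _ = φ ξ * (_ / _)
      refine mul_right_cancel₀ hG0 (h1.trans ?_)
      field_simp
    · obtain ⟨c, hc, hcu, -⟩ := hφ.exists_germ h₁₂ h₂₃ hP ξ
      have h1 : α c = ⟨φ ξ, hξB⟩ := Subtype.ext hc
      rw [← h1]
      exact Ideal.mem_map_of_mem _ fun h => hcu.1 h hξI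
  have hne {R : X} {β : blowupChart φ ξ →+* X.presheaf.stalk R}
      (hβ : ∀ z, algebraMap _ X.functionField (β z) = z) :
      β ⟨φ ξ, hξB⟩ ∈ nonZeroDivisors (X.presheaf.stalk R) := by
    refine mem_nonZeroDivisors_of_ne_zero fun h => hφξ ?_
    have := hβ ⟨φ ξ, hξB⟩
    rw [h, map_zero] at this
    exact this.symm
  have hspec : π E ⤳ π P := by rw [hE, hP]
  have hαE : CommRingCat.ofHom α ≫ CommRingCat.ofHom βE =
      (toricSurface k s₁ s₂ s₃).presheaf.stalkSpecializes hspec ≫ π.stalkMap E := by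
    ext c
    refine algebraMap_stalk_injective E ((hβE _).trans ((hα c).trans ?_))
    obtain ⟨m, F, G, hF, hG, hGp, rfl⟩ := exists_toricFraction_eq c
    have hGE : G ∉ (π E).asHomogeneousIdeal := by rwa [hE, ← hP]
    have hG0 : dehomogenize k s₁ s₂ s₃ G ≠ 0 := by
      rw [ne_eq, dehomogenize_eq_zero_iff hG]
      rintro rfl
      exact hGp (zero_mem _)
    refine mul_right_cancel₀ (hφ.ne_zero hG0) ((hφ.stalkMap_mul P hF hG hGp).trans ?_)
    refine (hφ.stalkMap_mul E hF hG hGE).symm.trans ?_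
    rw [← stalkSpecializes_toricFraction hspec hF hG hGp hGE]
    rfl
  have h := hπ.specializes_of_comap_le hP (B := .of (blowupChart φ ξ)) (CommRingCat.ofHom α) hαξ
    (mem_nonZeroDivisors_of_ne_zero fun h => hφξ (congrArg Subtype.val h)) (CommRingCat.ofHom βP)
    (by
      ext c
      exact algebraMap_stalk_injective P (hβP _)) (hne hβP) (CommRingCat.ofHom βE) (hne hβE)
    (X.fromSpecStalk E) (by
      refine Eq.trans ?_ (congrArg (fun f => Spec.map f ≫
        (toricSurface k s₁ s₂ s₃).fromSpecStalk (π P)) hαE).symm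
      rw [Spec.map_comp, Category.assoc, Scheme.SpecMap_stalkSpecializes_fromSpecStalk,
        Scheme.SpecMap_stalkMap_fromSpecStalk]) (by
      rintro ⟨z, hz⟩ hzE hzP
      refine hzE ?_
      obtain ⟨n, F, G, hF, hG, hz'⟩ := id hz
      obtain ⟨b, g, hg, hb, hbg⟩ := hφ.exists_of_mem_blowupChart h₁₂ h₂₃ hE hξ0 hpowE hF hG hz'
      obtain ⟨b', g', hg', hb', hbg'⟩ := hφ.exists_of_mem_blowupChart h₁₂ h₂₃ hP hξ0 hpow hF hG hz'
      have e1 : βE ⟨z, hz⟩ = b * g := algebraMap_stalk_injective E ((hβE _).trans hbg)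
      have e2 : βP ⟨z, hz⟩ = b' * g' := algebraMap_stalk_injective P ((hβP _).trans hbg')
      change IsUnit (βP ⟨z, hz⟩) at hzP
      change IsUnit (βE ⟨z, hz⟩)
      rw [e2] at hzP
      rw [e1]
      refine IsUnit.mul ?_ hg
      rw [hφ.isUnit_iff_of_mul_pow h₁₂ h₂₃ hE hσ hσE hξ hb]
      intro hF'
      obtain ⟨d, hd⟩ := hpow _ F hF'
      obtain ⟨x, hx, hxu, -⟩ := hφ.exists_germ h₁₂ h₂₃ hP ξ
      have e3 : b' = d * (π.stalkMap P).hom x := by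
        refine algebraMap_stalk_injective P (mul_right_cancel₀ (pow_ne_zero n hφξ) ?_)
        rw [hb', ← hd, map_mul, hx, pow_succ]
        ring
      have h1 := isUnit_of_mul_isUnit_left hzP
      rw [e3] at h1
      exact hxu.1 (isUnit_of_map_unit (π.stalkMap P).hom _ (isUnit_of_mul_isUnit_right h1)) hξI)
  rwa [Scheme.fromSpecStalk_closedPoint] at h

end UniqueExceptional

/-! ### The sides of the triangle -/

section Sides

variable {s₁ s₂ s₃ : ℚ}

/-- The primitive linear form that is nonnegative above the line through the origin of slope `s`. -/
def slopeForm (s : ℚ) : ℤ × ℤ →+ ℤ where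
  toFun v := s.den * v.2 - s.num * v.1
  map_zero' := by simp
  map_add' v w := by simp only [Prod.snd_add, Prod.fst_add]; ring

theorem slopeForm_apply (s : ℚ) (v : ℤ × ℤ) : slopeForm s v = s.den * v.2 - s.num * v.1 := rfl

theorem cast_slopeForm (s : ℚ) (v : ℤ × ℤ) : (slopeForm s v : ℚ) = s.den * (v.2 - s * v.1) := by
  rw [slopeForm_apply]
  push_cast
  rw [← Rat.mul_den_eq_num s]
  ring

theorem slopeForm_nonneg_iff (s : ℚ) (v : ℤ × ℤ) : 0 ≤ slopeForm s v ↔ s * v.1 ≤ v.2 := by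
  have h : (0 : ℚ) < s.den := by exact_mod_cast s.den_pos
  rw [← Int.cast_nonneg_iff (R := ℚ), cast_slopeForm, mul_nonneg_iff_of_pos_left h, sub_nonneg]

theorem exists_slopeForm_eq_one (s : ℚ) : ∃ v, slopeForm s v = 1 := by
  have h : IsCoprime (s.num) (s.den : ℤ) := by
    rw [Int.isCoprime_iff_gcd_eq_one]
    exact s.reduced
  obtain ⟨a, b, hab⟩ := h
  exact ⟨(-a, b), by rw [slopeForm_apply]; linear_combination hab⟩

/-- Common to the two sides through the origin: `base` lies on one of them and strictly above the
line of the other. -/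
theorem exists_facet_of_slope (h₁₂ : s₁ < s₂) (h₂₃ : s₂ < s₃) {s : ℚ} {base : ℤ × ℤ}
    (hs : ∀ v a, v ∈ trianglePoints s₁ s₂ s₃ a → s * v.1 ≤ v.2)
    (hb : slopeForm s base = 0)
    (h1 : (s₁ * base.1 < base.2) ∨ (s₁ * base.1 = base.2 ∧ s = s₁))
    (h3 : (s₃ * base.1 < base.2) ∨ (s₃ * base.1 = base.2 ∧ s = s₃)) :
    ∃ W : ToricFacet s₁ s₂ s₃, W.form = slopeForm s ∧ W.const = 0 := by
  obtain ⟨vec, hvec⟩ := exists_slopeForm_eq_one s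
  -- A degree large enough to put `base` strictly below the top side of `dΔ`.
  obtain ⟨d, hd⟩ := exists_nat_gt (max 0 (base.2 - s₂ * base.1 : ℚ))
  refine ⟨{ form := slopeForm s
            const := 0
            degree := d
            base := base
            vec := vec
            nonneg := fun z hz => ?_
            degree_pos := ?_
            base_eq := by simp [hb]
            form_vec := hvec
            translate := fun A hA => exists_translate_mem_trianglePoints A d base ?_ ?_ ?_ }, rfl, rfl⟩
  · rw [Nat.cast_zero, zero_mul, zero_add, slopeForm_nonneg_iff]
    exact hs _ _ ((mem_coneMonoid_iff h₁₂ h₂₃).1 hz)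
  · exact_mod_cast (le_max_left _ _).trans_lt hd
  · exact h1.imp_right fun h => ⟨h.1, fun v hv => by
      rw [← h.2]; exact (slopeForm_nonneg_iff _ _).1 (hA v hv)⟩
  · exact h3.imp_right fun h => ⟨h.1, fun v hv => by
      rw [← h.2]; exact (slopeForm_nonneg_iff _ _).1 (hA v hv)⟩
  · left
    have := (le_max_right _ _).trans_lt hd
    linarith

theorem exists_facet_left (h₁₂ : s₁ < s₂) (h₂₃ : s₂ < s₃) :
    ∃ W : ToricFacet s₁ s₂ s₃, W.form = slopeForm s₁ ∧ W.const = 0 := by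
  have h : (0 : ℚ) < s₁.den := by exact_mod_cast s₁.den_pos
  have hnum := (Rat.mul_den_eq_num s₁).symm
  refine exists_facet_of_slope h₁₂ h₂₃ (base := (-s₁.den, -s₁.num)) (fun v a hv => hv.1)
    (by rw [slopeForm_apply]; ring) (Or.inr ⟨?_, rfl⟩) (Or.inl ?_)
  · push_cast
    rw [hnum]
    ring
  · push_cast
    rw [hnum]
    nlinarith

theorem exists_facet_right (h₁₂ : s₁ < s₂) (h₂₃ : s₂ < s₃) :
    ∃ W : ToricFacet s₁ s₂ s₃, W.form = slopeForm s₃ ∧ W.const = 0 := by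
  have h : (0 : ℚ) < s₃.den := by exact_mod_cast s₃.den_pos
  have hnum := (Rat.mul_den_eq_num s₃).symm
  refine exists_facet_of_slope h₁₂ h₂₃ (base := (s₃.den, s₃.num)) (fun v a hv => hv.2.1)
    (by rw [slopeForm_apply]; ring) (Or.inl ?_) (Or.inr ⟨?_, rfl⟩)
  · push_cast
    rw [hnum]
    nlinarith
  · push_cast
    rw [hnum]

theorem exists_facet_top (h₁₂ : s₁ < s₂) (h₂₃ : s₂ < s₃) :
    ∃ W : ToricFacet s₁ s₂ s₃, W.form = -slopeForm s₂ ∧ W.const = s₂.den := by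
  obtain ⟨vec, hvec⟩ := exists_slopeForm_eq_one s₂
  have h : (0 : ℚ) < s₂.den := by exact_mod_cast s₂.den_pos
  refine ⟨{ form := -slopeForm s₂
            const := s₂.den
            degree := 1
            base := (0, 1)
            vec := -vec
            nonneg := fun z hz => ?_
            degree_pos := one_pos
            base_eq := by simp [slopeForm_apply]
            form_vec := by rw [AddMonoidHom.neg_apply, map_neg, neg_neg, hvec]
            translate := fun A hA => exists_translate_mem_trianglePoints A 1 (0, 1) (Or.inl (by simp))
              (Or.inl (by simp)) (Or.inr ⟨by simp, fun v hv => ?_⟩) }, rfl, rfl⟩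
  · have h1 := ((mem_coneMonoid_iff h₁₂ h₂₃).1 hz).2.2
    rw [← Int.cast_nonneg_iff (R := ℚ), AddMonoidHom.neg_apply]
    push_cast
    rw [cast_slopeForm]
    push_cast at h1
    nlinarith
  · have := hA v hv
    rw [← Int.cast_nonneg_iff (R := ℚ), AddMonoidHom.neg_apply, Int.cast_neg, cast_slopeForm] at this
    nlinarith

end Sides

/-! ### Sections of divisors on the blowup -/

section Sections

variable {k : Type u} [Field k] [CharZero k] {s₁ s₂ s₃ : ℚ} (h₁₂ : s₁ < s₂) (h₂₃ : s₂ < s₃)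
  {X : Scheme.{u}} [IsIntegral X] {π : X ⟶ toricSurface k s₁ s₂ s₃}
  (hπ : IsBlowup π (pointIdeal (torusIdentity k s₁ s₂ s₃)))

include h₁₂ h₂₃ in
theorem toricGenericPoint_ne_torusIdentity :
    toricGenericPoint k s₁ s₂ s₃ ≠ torusIdentity k s₁ s₂ s₃ := by
  intro h
  have hx : (AddMonoidAlgebra.single (1, 0) 1 - 1 : AddMonoidAlgebra k (ℤ × ℤ)) ∈ identityIdeal k :=
    Ideal.subset_span (by simp)
  obtain ⟨m, w, F, G, hF, hG, -, hFI, eF, -⟩ := exists_homogenize_at_identity h₁₂ h₂₃ _ rfl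
    (AddMonoidAlgebra.single (1, 0) 1 - 1 : AddMonoidAlgebra k (ℤ × ℤ))
  have h1 := hFI.2 hx
  rw [← h, mem_toricGenericPoint_iff hF, ← dehomogenize_eq_zero_iff hF, eF,
    (isUnit_single w).mul_right_eq_zero] at h1
  have h2 := congrArg (arc k) h1
  rw [arc_x_sub_one, map_zero] at h2
  exact PowerSeries.X_ne_zero h2

include h₁₂ h₂₃ hπ in
-- Some point of `X` lies over the generic point of the toric surface, since that point differs from
-- the centre; the generic point of `X` specializes to it.
theorem IsBlowup.eq_zero_of_mem_genericPoint (m : ℕ) (F : AddMonoidAlgebra k (coneMonoid s₁ s₂ s₃))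
    (hF : F ∈ coneGrading k s₁ s₂ s₃ m) (h : F ∈ (π (genericPoint X)).asHomogeneousIdeal) :
    F = 0 := by
  obtain ⟨P, hP⟩ := hπ.exists_eq (fun _ h => eq_torusIdentity_of_specializes h)
    (toricGenericPoint_ne_torusIdentity (k := k) h₁₂ h₂₃)
  have h1 : π (genericPoint X) ⤳ toricGenericPoint k s₁ s₂ s₃ :=
    hP ▸ (genericPoint_specializes P).map π.continuous
  exact (mem_toricGenericPoint_iff hF).1 (mem_of_toricSurface_specializes h1 h)

include h₁₂ h₂₃ hπ in
theorem IsBlowup.exists_isLaurentHom : ∃ φ, IsLaurentHom π φ ∧ ∀ r, φ (algebraMap k _ r) =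
    @algebraMap k X.functionField _ _
      (functionFieldAlgebra (π ≫ toricSurfaceOver k s₁ s₂ s₃)) r := by
  have hη := hπ.eq_zero_of_mem_genericPoint h₁₂ h₂₃
  exact ⟨laurentHom π hη h₁₂ h₂₃, ⟨laurentHom_injective π hη h₁₂ h₂₃, fun P _ _ _ hF hG hGP =>
    algebraMap_stalkMap_mul_laurentHom π hη h₁₂ h₂₃ P hF hG hGP⟩, laurentHom_algebraMap π hη h₁₂ h₂₃⟩

omit [CharZero k] in
/-- A point at which the monomial of the vertex vanishes lies on the curve of the opposite side. -/
theorem point_specializes_of_vertexMonomial_mem {W : ToricFacet s₁ s₂ s₃}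
    (hW : W.form = -slopeForm s₂) (hW' : W.const = s₂.den) {p : toricSurface k s₁ s₂ s₃}
    (hp : vertexMonomial k s₁ s₂ s₃ ∈ p.asHomogeneousIdeal) : W.point k h₁₂ h₂₃ ⤳ p := by
  refine toricSurface_specializes fun m F hF hFW => ?_
  have hmono (z : coneMonoid s₁ s₂ s₃) (r : k) (hz : 0 < W.const * (z.1.1 : ℤ) + W.form z.1.2) :
      AddMonoidAlgebra.single z r ∈ p.asHomogeneousIdeal := by
    have hz1 := (mem_coneMonoid_iff h₁₂ h₂₃).1 z.2
    have hq : (0 : ℚ) < z.1.1 + s₂ * z.1.2.1 - z.1.2.2 := by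
      have h : (0 : ℚ) < s₂.den := by exact_mod_cast s₂.den_pos
      rw [hW, hW', AddMonoidHom.neg_apply, ← Int.cast_pos (R := ℚ)] at hz
      push_cast at hz
      rw [cast_slopeForm] at hz
      by_contra hneg
      nlinarith
    -- A monomial strictly below the top side has a power with slack at least `1`; that power is
    -- divisible by the vertex monomial, so the monomial lies in the ideal of `p`.
    obtain ⟨N, hN⟩ := Archimedean.arch (1 : ℚ) hq
    rw [nsmul_eq_mul] at hN
    have hm : 1 ≤ N * z.1.1 := by
      by_contra h0
      have h0' : (N : ℚ) * z.1.1 = 0 := by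
        have : N * z.1.1 = 0 := by omega
        exact_mod_cast this
      obtain ⟨h4, h5, h6⟩ := hz1
      have hN0 : (0 : ℚ) ≤ N := Nat.cast_nonneg N
      have h7 : (N : ℚ) * (z.1.2.2 - s₂ * z.1.2.1) ≤ -1 := by linarith
      rcases le_total 0 z.1.2.1 with h8 | h8
      · have h8' : (0 : ℚ) ≤ z.1.2.1 := by exact_mod_cast h8
        have : (0 : ℚ) ≤ z.1.2.2 - s₂ * z.1.2.1 := by nlinarith
        nlinarith
      · have h8' : (z.1.2.1 : ℚ) ≤ 0 := by exact_mod_cast h8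
        have : (0 : ℚ) ≤ z.1.2.2 - s₂ * z.1.2.1 := by nlinarith
        nlinarith
    have hmem : ((N * z.1.1 - 1, N • z.1.2) : ℕ × ℤ × ℤ) ∈ coneMonoid s₁ s₂ s₃ := by
      refine (mem_coneMonoid_iff h₁₂ h₂₃).2 ?_
      obtain ⟨h4, h5, h6⟩ := hz1
      have hN0 : (0 : ℚ) ≤ N := Nat.cast_nonneg N
      refine ⟨?_, ?_, ?_⟩
      · change s₁ * ((N • z.1.2.1 : ℤ) : ℚ) ≤ ((N • z.1.2.2 : ℤ) : ℚ)
        rw [nsmul_eq_mul, nsmul_eq_mul]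
        push_cast
        linarith [mul_le_mul_of_nonneg_left h4 hN0]
      · change s₃ * ((N • z.1.2.1 : ℤ) : ℚ) ≤ ((N • z.1.2.2 : ℤ) : ℚ)
        rw [nsmul_eq_mul, nsmul_eq_mul]
        push_cast
        linarith [mul_le_mul_of_nonneg_left h5 hN0]
      · change ((N • z.1.2.2 : ℤ) : ℚ) ≤ (((N * z.1.1 - 1 : ℕ) : ℤ) : ℚ) +
          s₂ * ((N • z.1.2.1 : ℤ) : ℚ)
        rw [nsmul_eq_mul, nsmul_eq_mul]
        push_cast [hm]
        linarith
    have hpow : AddMonoidAlgebra.single z r ^ N =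
        AddMonoidAlgebra.single (⟨_, hmem⟩ : coneMonoid s₁ s₂ s₃) (r ^ N) *
          vertexMonomial k s₁ s₂ s₃ := by
      rw [AddMonoidAlgebra.single_pow, vertexMonomial, AddMonoidAlgebra.single_mul_single, mul_one]
      congr 1
      refine Subtype.ext (Prod.ext ?_ ?_)
      · change N • z.1.1 = N * z.1.1 - 1 + 1
        rw [smul_eq_mul]
        omega
      · change N • z.1.2 = N • z.1.2 + 0
        rw [add_zero]
    exact p.isPrime.mem_of_pow_mem N (hpow ▸ Ideal.mul_mem_left _ _ hp)
  rw [W.mem_point_iff h₁₂ h₂₃ hF] at hFW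
  rw [← AddMonoidAlgebra.sum_coeff_single F]
  refine Submodule.sum_mem p.asHomogeneousIdeal.toIdeal fun z hz => hmono z _ ?_
  have hd := degree_of_mem_support hF hz
  rw [hd]
  refine hFW _ ?_
  rw [Finsupp.mem_support_iff, coeff_dehomogenize hF z hd]
  exact Finsupp.mem_support_iff.1 hz

variable {φ : AddMonoidAlgebra k (ℤ × ℤ) →+* X.functionField} (hφ : IsLaurentHom π φ)

omit [CharZero k] in
theorem trianglePoints_eq_empty (h₁₂ : s₁ < s₂) (h₂₃ : s₂ < s₃) {a : ℤ} (ha : a < 0) (v : ℤ × ℤ) :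
    v ∉ trianglePoints s₁ s₂ s₃ a := by
  rintro ⟨h1, h3, h2⟩
  have ha' : (a : ℚ) < 0 := by exact_mod_cast ha
  rcases le_total 0 v.1 with h | h
  · have h' : (0 : ℚ) ≤ v.1 := by exact_mod_cast h
    nlinarith
  · have h' : (v.1 : ℚ) ≤ 0 := by exact_mod_cast h
    nlinarith

include hφ h₁₂ h₂₃ in
omit [CharZero k] in
/-- A Laurent polynomial with support in a multiple of the triangle is regular away from the side
opposite the vertex. -/
theorem IsLaurentHom.exists_stalk_of_vertexMonomial_notMem {P : X}
    (hP : vertexMonomial k s₁ s₂ s₃ ∉ (π P).asHomogeneousIdeal) {a : ℤ} (ha : 0 ≤ a)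
    {F : AddMonoidAlgebra k (ℤ × ℤ)} (hF : ∀ v ∈ F.coeff.support, v ∈ trianglePoints s₁ s₂ s₃ a) :
    ∃ z : X.presheaf.stalk P, algebraMap _ X.functionField z = φ F := by
  lift a to ℕ using ha
  obtain ⟨F', hF', rfl⟩ := exists_homogenize (m := a) (fun v hv =>
    (mem_coneMonoid_iff h₁₂ h₂₃).2 (hF v hv))
  have h := hφ.stalkMap_mul P hF' (vertexMonomial_pow_mem a)
    (fun h => hP ((π P).isPrime.mem_of_pow_mem _ h))
  rw [map_pow, dehomogenize_vertexMonomial, one_pow, map_one, mul_one] at h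
  exact ⟨_, h⟩

include hπ hφ h₁₂ h₂₃

variable [IsLocallyNoetherian X]

/-- Prime divisors of the blowup that are relevant for the sections of the divisors pulled back from
the triangle. -/
theorem IsLaurentHom.mem_divisorSections_iff {W₁ W₂ W₃ : ToricFacet s₁ s₂ s₃}
    (hW₁ : W₁.form = slopeForm s₁) (hW₁' : W₁.const = 0)
    (hW₂ : W₂.form = -slopeForm s₂) (hW₂' : W₂.const = s₂.den)
    (hW₃ : W₃.form = slopeForm s₃) (hW₃' : W₃.const = 0)
    {H E : PrimeDivisor X} (hH : π H.1 = W₂.point k h₁₂ h₂₃)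
    (hE : π E.1 = torusIdentity k s₁ s₂ s₃)
    (hEuniq : ∀ P : PrimeDivisor X, π P.1 = torusIdentity k s₁ s₂ s₃ → P = E)
    {o e : ℤ} (ho : 0 < o) (ho' : ∀ (F : AddMonoidAlgebra k (ℤ × ℤ)) (e : ℤ),
      (∀ v ∈ F.coeff.support, e ≤ W₂.form v) → (∃ v ∈ F.coeff.support, W₂.form v = e) →
      Scheme.ord (φ F) H.1 = e * o)
    (he : 0 < e) (he' : ∀ F, F ≠ 0 → ∀ n : ℕ, VanishesToOrder n F ↔ n * e ≤ Scheme.ord (φ F) E.1)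
    (a b : ℤ) (f : X.functionField) :
    f ∈ divisorSections (Finsupp.single H (a * (s₂.den * o)) - Finsupp.single E (b * e)) ↔
      ∃ F, f = φ F ∧ (∀ v ∈ F.coeff.support, v ∈ trianglePoints s₁ s₂ s₃ a) ∧
        VanishesToOrder b.toNat F := by
  classical
  have ht (y : toricSurface k s₁ s₂ s₃) (h : torusIdentity k s₁ s₂ s₃ ⤳ y) :
    y = torusIdentity k s₁ s₂ s₃ := eq_torusIdentity_of_specializes h
  have hHE : H ≠ E := by
    rintro rfl
    exact W₂.point_ne_torusIdentity h₁₂ h₂₃ (hH.symm.trans hE)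
  have hd : (0 : ℚ) < s₂.den := by exact_mod_cast s₂.den_pos
  have hform2 (v : ℤ × ℤ) (c : ℤ) : -(c * s₂.den) ≤ W₂.form v ↔ (v.2 : ℚ) ≤ c + s₂ * v.1 := by
    rw [hW₂, AddMonoidHom.neg_apply, neg_le_neg_iff, ← Int.cast_le (R := ℚ), cast_slopeForm]
    push_cast
    rw [mul_comm (c : ℚ), mul_le_mul_iff_of_pos_left hd, sub_le_iff_le_add]
  have hTH : vertexMonomial k s₁ s₂ s₃ ∈ (π H.1).asHomogeneousIdeal := by
    rw [hH, W₂.mem_point_iff h₁₂ h₂₃ vertexMonomial_mem, dehomogenize_vertexMonomial]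
    intro v hv
    have : v = 0 := by simpa [AddMonoidAlgebra.one_def, Finsupp.single_apply] using hv
    rw [this, map_zero, hW₂']
    simpa using s₂.den_pos
  have hmin (l : ℤ × ℤ →+ ℤ) {F : AddMonoidAlgebra k (ℤ × ℤ)} (hF : F ≠ 0) :
      ∃ e, (∀ v ∈ F.coeff.support, e ≤ l v) ∧ ∃ v ∈ F.coeff.support, l v = e := by
    obtain ⟨v, hv, hv'⟩ := F.coeff.support.exists_min_image l
      (Finsupp.support_nonempty_iff.2 (AddMonoidAlgebra.coeff_eq_zero.not.2 hF))
    exact ⟨l v, hv', v, hv, rfl⟩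
  have hHs : (Finsupp.single H (a * (s₂.den * o)) - Finsupp.single E (b * e)) H =
      a * (s₂.den * o) := by
    rw [Finsupp.sub_apply, Finsupp.single_eq_same, Finsupp.single_eq_of_ne hHE, sub_zero]
  have hEs : (Finsupp.single H (a * (s₂.den * o)) - Finsupp.single E (b * e)) E = -(b * e) := by
    rw [Finsupp.sub_apply, Finsupp.single_eq_same, Finsupp.single_eq_of_ne hHE.symm, zero_sub]
  have hPs {P : PrimeDivisor X} (h1 : P ≠ H) (h2 : P ≠ E) :
      (Finsupp.single H (a * (s₂.den * o)) - Finsupp.single E (b * e)) P = 0 := by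
    rw [Finsupp.sub_apply, Finsupp.single_eq_of_ne h1, Finsupp.single_eq_of_ne h2, sub_zero]
  constructor
  · intro hf
    by_cases hf0 : f = 0
    · exact ⟨0, by rw [hf0, map_zero], by simp, fun _ _ _ => by simp⟩
    have hf := hf hf0
    have hregular {P : PrimeDivisor X} (hP : vertexMonomial k s₁ s₂ s₃ ∉ (π P.1).asHomogeneousIdeal)
        (hP' : π P.1 ≠ torusIdentity k s₁ s₂ s₃) : 0 ≤ Scheme.ord f P.1 := by
      have := hf P
      rwa [hPs (by rintro rfl; exact hP hTH) (by rintro rfl; exact hP' hE), add_zero] at this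
    obtain ⟨F, rfl⟩ : ∃ F, f = φ F := by
      obtain ⟨F₀, G₀, hG₀, hFG₀⟩ := hφ.exists_eq_div (hπ.stalkMap_surjective ht
        (P := H.1) (hH ▸ W₂.point_ne_torusIdentity h₁₂ h₂₃)) f
      obtain ⟨G, F, c, hrel, rfl, rfl⟩ :=
        UniqueFactorizationMonoid.exists_reduced_factors G₀ hG₀ F₀
      have hc0 := hφ.ne_zero (left_ne_zero_of_mul hG₀)
      have hG0 := right_ne_zero_of_mul hG₀
      have hFG : f * φ G = φ F := by
        refine mul_left_cancel₀ hc0 ?_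
        rw [← map_mul, ← hFG₀, map_mul]
        ring
      have hF0 : F ≠ 0 := by
        rintro rfl
        rw [map_zero] at hFG
        exact mul_ne_zero hf0 (hφ.ne_zero hG0) hFG
      -- An irreducible factor `g` of the reduced denominator defines a curve in the torus along
      -- which `f` has no pole. Comparing orders there, `g` would also divide the numerator.
      have hGu : IsUnit G := by
        by_contra hGu
        obtain ⟨g, hg, hgG⟩ := WfDvdMonoid.exists_irreducible_factor hGu hG0
        have hg := UniqueFactorizationMonoid.irreducible_iff_prime.1 hg
        have hgt := torusPoint_ne_torusIdentity h₁₂ h₂₃ hg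
        obtain ⟨P, hP⟩ := hπ.exists_eq ht hgt
        have hPs := hπ.stalkMap_surjective ht (P := P) (hP ▸ hgt)
        have hPc := hφ.coheight_eq_one_of_prime h₁₂ h₂₃ hg hP hPs
        have h1 := hregular (P := ⟨P, hPc⟩) (fun h => by
          change _ ∈ (π P).asHomogeneousIdeal at h
          rw [hP, mem_torusPoint_iff hg vertexMonomial_mem, dehomogenize_vertexMonomial] at h
          exact hg.not_isUnit (isUnit_of_dvd_one h)) (fun h => hgt (hP.symm.trans h))
        have h2 := (hφ.ord_pos_iff_of_prime h₁₂ h₂₃ hg hP hPs hG0).2 hgG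
        have h3 := congrArg (fun z => Scheme.ord z P) hFG
        simp only [Scheme.ord_mul hf0 (hφ.ne_zero hG0)] at h3
        have h4 := (hφ.ord_pos_iff_of_prime h₁₂ h₂₃ hg hP hPs hF0).1 (by
          rw [← h3]; exact add_pos_of_nonneg_of_pos h1 h2)
        exact hg.not_isUnit (hrel hgG h4)
      obtain ⟨G, rfl⟩ := hGu
      refine ⟨F * ((G⁻¹ : (AddMonoidAlgebra k (ℤ × ℤ))ˣ) : AddMonoidAlgebra k (ℤ × ℤ)), ?_⟩
      rw [map_mul, ← hFG, mul_assoc, ← map_mul, Units.mul_inv, map_one, mul_one]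
    have hF0 : F ≠ 0 := fun h => hf0 (by rw [h, map_zero])
    refine ⟨F, rfl, ?_, ?_⟩
    -- Regularity along the curves of the two sides through the vertex, where the divisor has
    -- coefficient zero, gives their inequalities; the coefficient at `H` gives the third one.
    · have hside {W : ToricFacet s₁ s₂ s₃} {s : ℚ} (hW : W.form = slopeForm s) (hW' : W.const = 0) :
          ∀ v ∈ F.coeff.support, s * v.1 ≤ v.2 := by
        have hne := W.point_ne_torusIdentity (k := k) h₁₂ h₂₃
        obtain ⟨P, hP⟩ := hπ.exists_eq ht hne
        have hPs := hπ.stalkMap_surjective ht (P := P) (hP ▸ hne)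
        have hPc := hφ.coheight_eq_one_of_facet h₁₂ h₂₃ hP hPs
        obtain ⟨o', ho1, ho2⟩ := hφ.exists_ord_eq_of_facet h₁₂ h₂₃ hP hPs
        obtain ⟨e', he1, he2⟩ := hmin W.form hF0
        have h1 := hregular (P := ⟨P, hPc⟩) (fun h => by
          change _ ∈ (π P).asHomogeneousIdeal at h
          rw [hP, W.mem_point_iff h₁₂ h₂₃ vertexMonomial_mem, dehomogenize_vertexMonomial] at h
          have := h 0 (by simp [AddMonoidAlgebra.one_def])
          rw [hW', map_zero] at this
          simp at this) (fun h => hne (hP.symm.trans h))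
        simp only at h1
        rw [ho2 F e' he1 he2] at h1
        intro v hv
        rw [← slopeForm_nonneg_iff, ← hW]
        exact (nonneg_of_mul_nonneg_left h1 ho1).trans (he1 v hv)
      intro v hv
      refine ⟨hside hW₁ hW₁' v hv, hside hW₃ hW₃' v hv, ?_⟩
      obtain ⟨e', he1, he2⟩ := hmin W₂.form hF0
      have h1 := hf H
      rw [hHs, ho' F e' he1 he2, ← mul_assoc, ← add_mul] at h1
      have h2 := nonneg_of_mul_nonneg_left h1 ho
      rw [← hform2]
      exact le_trans (by linarith) (he1 v hv)
    · have h1 := hf E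
      rw [hEs] at h1
      rcases le_total 0 b with hb | hb
      · rw [he' F hF0, Int.toNat_of_nonneg hb]
        linarith
      -- Allowing a pole along `E` adds no sections, as the order of a Laurent polynomial there is
      -- never negative; so `b.toNat = 0` is the right truncation.
      · rw [Int.toNat_of_nonpos hb, ← mem_identityIdeal_pow_iff]
        simp
  · rintro ⟨F, rfl, hF, hFb⟩ hf0 P
    have hF0 : F ≠ 0 := fun h => hf0 (by rw [h, map_zero])
    by_cases hPE : P = E
    · rw [hPE, hEs]
      have h1 := (he' F hF0 _).1 hFb
      have h2 := Int.self_le_toNat b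
      nlinarith
    by_cases hPH : P = H
    · rw [hPH, hHs]
      obtain ⟨e', he1, v, hv, he2⟩ := hmin W₂.form hF0
      rw [ho' F e' he1 ⟨v, hv, he2⟩, ← mul_assoc, ← add_mul]
      refine mul_nonneg ?_ ho.le
      have := (hform2 v a).2 (hF v hv).2.2
      linarith
    rw [hPs hPH hPE, add_zero]
    have hPt : π P.1 ≠ torusIdentity k s₁ s₂ s₃ := fun h => hPE (hEuniq P h)
    have hT : vertexMonomial k s₁ s₂ s₃ ∉ (π P.1).asHomogeneousIdeal := by
      -- Otherwise `π P` lies on the curve of the top side, whose generic point lifts only to `H`;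
      -- then `H` specializes to `P`, and both have codimension one.
      intro h
      obtain ⟨Q, hQ, hQP⟩ := hπ.exists_specializes ht hPt
        (point_specializes_of_vertexMonomial_mem h₁₂ h₂₃ hW₂ hW₂' h)
      have hQH : Q = H.1 := hπ.eq_of_eq ht (hQ ▸ W₂.point_ne_torusIdentity h₁₂ h₂₃)
        (hQ.trans hH.symm)
      subst hQH
      exact hPH (Subtype.ext (eq_of_specializes_of_coheight hQP P.2 H.2))
    have ha : 0 ≤ a := by
      by_contra ha
      obtain ⟨e', he1, v, hv, he2⟩ := hmin W₂.form hF0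
      exact trianglePoints_eq_empty h₁₂ h₂₃ (not_le.1 ha) v (hF v hv)
    obtain ⟨z, hz⟩ := hφ.exists_stalk_of_vertexMonomial_notMem h₁₂ h₂₃ hT ha hF
    rw [← hz]
    exact ord_algebraMap_nonneg P.1 z

end Sections

/-! ### Sections on the blowup as Laurent polynomials -/

section Divisors

variable {k : Type u} [Field k] [CharZero k] {s₁ s₂ s₃ : ℚ} {X : Scheme.{u}} [IsIntegral X]
  [IsLocallyNoetherian X]

/-- The sections of the divisors spanned by the curve of the side opposite the vertex and the
exceptional divisor are the Laurent polynomials supported in multiples of the triangle that vanish at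
the identity. Their restriction to the curve `y = 1` is given by the column sums. -/
theorem exists_divisors (h₁₂ : s₁ < s₂) (h₂₃ : s₂ < s₃) (π : X ⟶ toricSurface k s₁ s₂ s₃)
    (hπ : IsBlowup π (pointIdeal (torusIdentity k s₁ s₂ s₃))) :
    ∃ (φ : AddMonoidAlgebra k (ℤ × ℤ) →+* X.functionField) (H E : PrimeDivisor X) (c e : ℤ),
      Function.Injective φ ∧
      (∀ r, φ (algebraMap k _ r) = @algebraMap k X.functionField _ _
        (functionFieldAlgebra (π ≫ toricSurfaceOver k s₁ s₂ s₃)) r) ∧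
      ∀ (a b : ℤ) (f : X.functionField),
        f ∈ divisorSections (Finsupp.single H (a * c) - Finsupp.single E (b * e)) ↔
          ∃ F, f = φ F ∧ (∀ v ∈ F.coeff.support, v ∈ trianglePoints s₁ s₂ s₃ a) ∧
            VanishesToOrder b.toNat F := by
  have ht (y : toricSurface k s₁ s₂ s₃) (h : torusIdentity k s₁ s₂ s₃ ⤳ y) :
    y = torusIdentity k s₁ s₂ s₃ := eq_torusIdentity_of_specializes h
  obtain ⟨φ, hφ, hφk⟩ := hπ.exists_isLaurentHom h₁₂ h₂₃
  obtain ⟨W₁, hW₁, hW₁'⟩ := exists_facet_left h₁₂ h₂₃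
  obtain ⟨W₂, hW₂, hW₂'⟩ := exists_facet_top h₁₂ h₂₃
  obtain ⟨W₃, hW₃, hW₃'⟩ := exists_facet_right h₁₂ h₂₃
  have hneH := W₂.point_ne_torusIdentity (k := k) h₁₂ h₂₃
  obtain ⟨H, hH⟩ := hπ.exists_eq ht hneH
  have hHs := hπ.stalkMap_surjective ht (P := H) (hH ▸ hneH)
  have hHc := hφ.coheight_eq_one_of_facet h₁₂ h₂₃ hH hHs
  obtain ⟨o, ho, ho'⟩ := hφ.exists_ord_eq_of_facet h₁₂ h₂₃ hH hHs
  obtain ⟨E, hE, σ, hσ, hσE⟩ := exists_exceptionalPoint h₁₂ h₂₃ hπ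
  have hEc := hφ.coheight_exceptional h₁₂ h₂₃ hE hσ hσE hπ.invertible hHs
  obtain ⟨e, he, he'⟩ := hφ.exists_ord_exceptional h₁₂ h₂₃ hE hσ hσE hπ.invertible hHs
  have hd : (0 : ℤ) < s₂.den := by exact_mod_cast s₂.den_pos
  refine ⟨φ, ⟨H, hHc⟩, ⟨E, hEc⟩, s₂.den * o, e, hφ.injective, hφk,
    fun a b f => ?_⟩
  exact hφ.mem_divisorSections_iff h₁₂ h₂₃ hπ hW₁ hW₁' hW₂ hW₂' hW₃ hW₃' (H := ⟨H, hHc⟩)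
      (E := ⟨E, hEc⟩) hH hE (fun P hP => Subtype.ext
        (eq_of_specializes_of_coheight
          (hφ.exceptional_specializes h₁₂ h₂₃ hE hσ hσE hπ hP) P.2 hEc)) ho ho' he he' a b f

end Divisors

/-! ### The slopes of sections without the factor `y - 1` -/

section Slopes

variable {k : Type u} [Field k] {s₁ s₂ s₃ : ℚ}

theorem add_mem_trianglePoints {a b : ℤ} {v w : ℤ × ℤ} (hv : v ∈ trianglePoints s₁ s₂ s₃ a)
    (hw : w ∈ trianglePoints s₁ s₂ s₃ b) : v + w ∈ trianglePoints s₁ s₂ s₃ (a + b) := by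
  obtain ⟨h1, h2, h3⟩ := hv
  obtain ⟨h1', h2', h3'⟩ := hw
  refine ⟨?_, ?_, ?_⟩ <;> push_cast [Prod.fst_add, Prod.snd_add] <;> linarith

theorem mem_trianglePoints_of_mem_support_pow {a : ℤ} {F : AddMonoidAlgebra k (ℤ × ℤ)}
    (hF : ∀ v ∈ F.coeff.support, v ∈ trianglePoints s₁ s₂ s₃ a) (q : ℕ) :
    ∀ v ∈ (F ^ q).coeff.support, v ∈ trianglePoints s₁ s₂ s₃ (q * a) := by
  classical
  induction q with
  | zero =>
    intro v hv
    rw [pow_zero, AddMonoidAlgebra.one_def, AddMonoidAlgebra.coeff_single] at hv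
    obtain rfl := Finset.mem_singleton.1 (Finsupp.support_single_subset hv)
    simp [trianglePoints]
  | succ q ih =>
    intro v hv
    rw [pow_succ] at hv
    obtain ⟨x, hx, y, hy, rfl⟩ := Finset.mem_add.1 (AddMonoidAlgebra.support_coeff_mul_subset _ _ hv)
    have := add_mem_trianglePoints (ih x hx) (hF y hy)
    rwa [show ((q + 1 : ℕ) : ℤ) * a = q * a + a by push_cast; ring]

theorem trianglePoints_zero (h₁₂ : s₁ < s₂) (h₂₃ : s₂ < s₃) {v : ℤ × ℤ}
    (hv : v ∈ trianglePoints s₁ s₂ s₃ 0) : v = 0 := by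
  obtain ⟨h1, h3, h2⟩ := hv
  push_cast at h2
  have hx : (v.1 : ℚ) = 0 := le_antisymm (by nlinarith) (by nlinarith)
  rw [hx] at h1 h2
  have hy : (v.2 : ℚ) = 0 := le_antisymm (by linarith) (by linarith)
  exact Prod.ext (by exact_mod_cast hx) (by exact_mod_cast hy)

/-- A Laurent polynomial supported in `aΔ` that is not divisible by `y - 1` vanishes to order less
than `w a` at `(1,1)`, unless it is constant. -/
theorem order_lt_of_not_dvd [CharZero k] (h₁₂ : s₁ < s₂) (h₂₃ : s₂ < s₃)
    (hw : 1 / (s₂ - s₁) + 1 / (s₃ - s₂) < 1)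
    {n : ℕ} (hn : n = {z : ℤ | s₁ ≤ z ∧ (z : ℚ) ≤ s₂}.ncard)
    (hcol : {z : ℤ | ((n : ℚ) - 1) * s₂ ≤ z ∧ (z : ℚ) ≤ ((n : ℚ) - 1) * s₃}.ncard = n)
    (hns : ¬ ∃ z : ℤ, (n : ℚ) * s₂ = z) {a b : ℤ} {F : AddMonoidAlgebra k (ℤ × ℤ)}
    (hsupp : ∀ v ∈ F.coeff.support, v ∈ trianglePoints s₁ s₂ s₃ a)
    (hF : VanishesToOrder b.toNat F) (hd : ¬ AddMonoidAlgebra.single (0, 1) 1 - 1 ∣ F) :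
    0 ≤ a ∧ ((a = 0 ∧ b ≤ 0) ∨ (b : ℚ) < (1 / (s₂ - s₁) + 1 / (s₃ - s₂)) * a) := by
  have hF0 : F.coeff.support.Nonempty := by
    rw [Finsupp.support_nonempty_iff]
    intro h
    exact hd (by simp [show F = 0 by simpa using h])
  obtain ⟨v, hv⟩ := hF0
  have ha : 0 ≤ a := by
    by_contra ha
    exact trianglePoints_eq_empty h₁₂ h₂₃ (not_le.1 ha) v (hsupp v hv)
  refine ⟨ha, ?_⟩
  rcases ha.eq_or_lt with rfl | ha
  · refine .inl ⟨rfl, ?_⟩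
    by_contra! hb
    have h := hF 0 0 (by omega)
    rw [pairing_apply, Finset.sum_eq_single_of_mem v hv fun w hw hne => absurd
      ((trianglePoints_zero h₁₂ h₂₃ (hsupp w hw)).trans
        (trianglePoints_zero h₁₂ h₂₃ (hsupp v hv)).symm) hne] at h
    simp at h
    exact Finsupp.mem_support_iff.1 hv h
  · refine .inr ?_
    by_contra! hb
    set w := 1 / (s₂ - s₁) + 1 / (s₃ - s₂) with hwdef
    have hw0 : 0 < w := add_pos (one_div_pos.2 (by linarith)) (one_div_pos.2 (by linarith))
    obtain ⟨p, hp⟩ := Int.eq_ofNat_of_zero_le (Rat.num_nonneg.2 hw0.le)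
    obtain ⟨a, rfl⟩ := Int.eq_ofNat_of_zero_le ha.le
    have hp0 : 0 < p := by
      have := Rat.num_pos.2 hw0
      omega
    have hwp : w * w.den = p := by
      rw [Rat.mul_den_eq_num, hp]; rfl
    -- Passing to `F^q` makes `wqa` an integer, and the factor `n + 1` makes it larger than `n`, so
    -- `F^q` is a section on the orthogonal ray. As `y - 1` is prime, its dividing `F^q` suffices.
    obtain ⟨q, hq⟩ : ∃ q, q = w.den * (n + 1) := ⟨_, rfl⟩
    have hM : ((p * (n + 1) * a : ℕ) : ℚ) = w * ((q * (a : ℤ) : ℤ) : ℚ) := by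
      rw [hq]
      push_cast
      rw [← hwp]
      ring
    have hle : p * (n + 1) * a ≤ b.toNat * q := by
      have h1 : (b : ℚ) ≤ (b.toNat : ℚ) := by exact_mod_cast Int.self_le_toNat b
      have h2 : ((p * (n + 1) * a : ℕ) : ℚ) ≤ ((b.toNat * q : ℕ) : ℚ) := by
        rw [hM]
        push_cast
        push_cast at hb
        have : (0 : ℚ) ≤ q := by positivity
        nlinarith
      exact_mod_cast h2
    have hlt : n < p * (n + 1) * a := by
      have : 0 < a := by omega
      have h1 : 1 ≤ p * a := Nat.mul_pos hp0 this
      nlinarith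
    have hFq : VanishesToOrder (p * (n + 1) * a) (F ^ q) := by
      rw [← mem_identityIdeal_pow_iff] at hF ⊢
      refine Ideal.pow_le_pow_right hle ?_
      rw [pow_mul]
      exact Ideal.pow_mem_pow hF q
    refine hd ((prime_y_sub_one (k := k)).dvd_of_dvd_pow (n := q) (y_sub_one_dvd_iff.2 fun x => ?_))
    exact columnSum_eq_zero_of_orthogonal h₁₂ h₂₃ hw hn hcol hns hM hlt
      (mem_trianglePoints_of_mem_support_pow hsupp q) hFq x

end Slopes

/-! ### Finitely generated monoids -/

/-- If the good elements of a finitely generated monoid, closed under taking summands, have slopes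
`B / A` less than `w`, then the slopes stay away from `w`. -/
theorem AddSubmonoid.FG.exists_slope_le {M : Type*} [AddCommMonoid M] {Λ : AddSubmonoid M}
    (hΛ : Λ.FG) {good : M → Prop}
    (hgood : ∀ x ∈ Λ, ∀ y ∈ Λ, good (x + y) → good x ∧ good y) (A B : M →+ ℤ) (w : ℚ)
    (h : ∀ x ∈ Λ, good x → 0 ≤ A x ∧ ((A x = 0 ∧ B x ≤ 0) ∨ (B x : ℚ) < w * A x)) :
    ∃ δ : ℚ, 0 < δ ∧ ∀ x ∈ Λ, good x → (B x : ℚ) ≤ (w - δ) * A x := by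
  classical
  obtain ⟨T, rfl⟩ := hΛ
  have key (S : Finset M) (hS : S ⊆ T) :
      ∃ δ : ℚ, 0 < δ ∧ ∀ x ∈ S, good x → (B x : ℚ) ≤ (w - δ) * A x := by
    induction S using Finset.induction with
    | empty => exact ⟨1, one_pos, by simp⟩
    | insert x S _ ih =>
      obtain ⟨δ, hδ, hS'⟩ := ih ((Finset.subset_insert _ _).trans hS)
      have hx' (y) (hy : y ∈ insert x S) := h y (AddSubmonoid.subset_closure (hS hy))
      obtain ⟨ε, hε, hx⟩ : ∃ ε : ℚ, 0 < ε ∧ (good x → (B x : ℚ) ≤ (w - ε) * A x) := by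
        by_cases hg : good x
        · obtain ⟨h0, ⟨hA, hB⟩ | hlt⟩ := hx' x (Finset.mem_insert_self _ _) hg
          · exact ⟨1, one_pos, fun _ => by rw [hA]; simpa using hB⟩
          · have h0' : (0 : ℚ) ≤ A x := by exact_mod_cast h0
            -- The slack divided by `A x + 1` instead of `A x`, which may be zero.
            refine ⟨(w * A x - B x) / (A x + 1), by apply div_pos <;> linarith, fun _ => ?_⟩
            have : (w * A x - B x) / (A x + 1) * A x ≤ w * A x - B x := by
              rw [div_mul_eq_mul_div, div_le_iff₀ (by linarith)]
              nlinarith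
            linarith
        · exact ⟨1, one_pos, fun h => absurd h hg⟩
      refine ⟨min δ ε, lt_min hδ hε, fun y hy hg => ?_⟩
      have h0' : (0 : ℚ) ≤ A y := by exact_mod_cast (hx' y hy hg).1
      rcases Finset.mem_insert.1 hy with rfl | hy
      · exact (hx hg).trans (mul_le_mul_of_nonneg_right (by linarith [min_le_right δ ε]) h0')
      · exact (hS' y hy hg).trans (mul_le_mul_of_nonneg_right (by linarith [min_le_left δ ε]) h0')
  obtain ⟨δ, hδ, hT⟩ := key T subset_rfl
  refine ⟨δ, hδ, fun x hx => ?_⟩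
  induction hx using AddSubmonoid.closure_induction with
  | mem x hx => exact hT x hx
  | zero => simp
  | add x y hx hy ihx ihy =>
    intro hg
    obtain ⟨hgx, hgy⟩ := hgood x hx y hy hg
    have h1 := ihx hgx
    have h2 := ihy hgy
    rw [map_add, map_add]
    push_cast
    linarith

/-! ### Finitely generated multisection rings -/

/-- Each of finitely many generators involves only finitely many elements of `S`. For a multisection
ring this supplies homogeneous generators. -/
theorem exists_finset_adjoin_eq_of_fg {R A : Type*} [CommSemiring R] [CommSemiring A] [Algebra R A]
    {S : Set A} (h : (Algebra.adjoin R S).FG) :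
    ∃ T : Finset A, (T : Set A) ⊆ S ∧ Algebra.adjoin R (T : Set A) = Algebra.adjoin R S := by
  classical
  obtain ⟨U, hU⟩ := h
  have key (x : A) (hx : x ∈ Algebra.adjoin R S) :
      ∃ T : Finset A, (T : Set A) ⊆ S ∧ x ∈ Algebra.adjoin R (T : Set A) := by
    induction hx using Algebra.adjoin_induction with
    | mem x hx => exact ⟨{x}, by simpa using hx, Algebra.subset_adjoin (by simp)⟩
    | algebraMap r => exact ⟨∅, by simp, Subalgebra.algebraMap_mem _ r⟩
    | add x y _ _ hx hy =>
      obtain ⟨T, hT, hx⟩ := hx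
      obtain ⟨T', hT', hy⟩ := hy
      exact ⟨T ∪ T', by simp [hT, hT'], add_mem (Algebra.adjoin_mono (by simp) hx)
        (Algebra.adjoin_mono (by simp) hy)⟩
    | mul x y _ _ hx hy =>
      obtain ⟨T, hT, hx⟩ := hx
      obtain ⟨T', hT', hy⟩ := hy
      exact ⟨T ∪ T', by simp [hT, hT'], mul_mem (Algebra.adjoin_mono (by simp) hx)
        (Algebra.adjoin_mono (by simp) hy)⟩
  have hmem (x : A) (hx : x ∈ U) : x ∈ Algebra.adjoin R S := hU ▸ Algebra.subset_adjoin hx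
  choose! T hT hxT using fun x hx => key x (hmem x hx)
  refine ⟨U.biUnion T, by simpa using hT, le_antisymm (Algebra.adjoin_mono (by simpa using hT)) ?_⟩
  rw [← hU, Algebra.adjoin_le_iff]
  exact fun x hx => Algebra.adjoin_mono (by exact_mod_cast Finset.subset_biUnion_of_mem T hx)
    (hxT x hx)

/-- A homogeneous element of an algebra generated by homogeneous elements is a linear combination of
monomials of its degree in the generators. -/
theorem exists_eq_sum_of_single_mem_adjoin {k K G ι : Type*} [CommRing k] [CommRing K] [Algebra k K]
    [AddCommMonoid G] [Fintype ι] (μ : ι → G) (f : ι → K) {m : G} {g : K}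
    (h : AddMonoidAlgebra.single m g ∈
      Algebra.adjoin k (Set.range fun t => AddMonoidAlgebra.single (μ t) (f t))) :
    ∃ (I : Finset (ι →₀ ℕ)) (c : (ι →₀ ℕ) → k), (∀ d ∈ I, ∑ t, d t • μ t = m) ∧
      g = ∑ d ∈ I, algebraMap k K (c d) * ∏ t, f t ^ d t := by
  classical
  rw [Algebra.adjoin_range_eq_range_aeval] at h
  obtain ⟨p, hp⟩ := h
  have hp : MvPolynomial.aeval (fun t => AddMonoidAlgebra.single (μ t) (f t)) p =
    AddMonoidAlgebra.single m g := hp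
  refine ⟨p.support.filter fun d => ∑ t, d t • μ t = m, fun d => p.coeff d, by simp, ?_⟩
  rw [MvPolynomial.aeval_def, MvPolynomial.eval₂_eq'] at hp
  have hterm (d : ι →₀ ℕ) : algebraMap k (AddMonoidAlgebra K G) (p.coeff d) *
      ∏ t, (AddMonoidAlgebra.single (μ t) (f t)) ^ d t =
      AddMonoidAlgebra.single (∑ t, d t • μ t) (algebraMap k K (p.coeff d) * ∏ t, f t ^ d t) := by
    have h1 : ∏ t, (AddMonoidAlgebra.single (μ t) (f t)) ^ d t =
        AddMonoidAlgebra.single (∑ t, d t • μ t) (∏ t, f t ^ d t) := by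
      simp only [AddMonoidAlgebra.single_pow]
      induction (Finset.univ : Finset ι) using Finset.induction with
      | empty => simp [AddMonoidAlgebra.one_def]
      | insert t s ht ih =>
        rw [Finset.prod_insert ht, ih, Finset.sum_insert ht, Finset.prod_insert ht,
          AddMonoidAlgebra.single_mul_single]
    rw [h1, ← Algebra.smul_def, AddMonoidAlgebra.smul_single, Algebra.smul_def]
  simp only [hterm] at hp
  have := congrArg (fun F => AddMonoidAlgebra.coeff F m) hp
  simp only [AddMonoidAlgebra.coeff_sum, AddMonoidAlgebra.coeff_single, Finsupp.finsetSum_apply,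
    Finsupp.single_apply, if_true] at this
  rw [← this, Finset.sum_filter]

/-! ### Products of sections and linear equivalence -/

section Sections

variable {X : Scheme.{u}} [IsIntegral X] [IsLocallyNoetherian X]

theorem mul_mem_divisorSections {D D' : WeilDivisor X} {f g : X.functionField}
    (hf : f ∈ divisorSections D) (hg : g ∈ divisorSections D') :
    f * g ∈ divisorSections (D + D') := by
  intro h P
  obtain ⟨hf0, hg0⟩ := mul_ne_zero_iff.1 h
  have h1 := hf hf0 P
  have h2 := hg hg0 P
  rw [Scheme.ord_mul hf0 hg0, Finsupp.add_apply]
  omega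

theorem one_mem_divisorSections : (1 : X.functionField) ∈ divisorSections 0 := by
  intro _ P
  have := ord_pow (P := P.1) (one_ne_zero (α := X.functionField)) 0
  simp at this
  simp [this]

theorem pow_mem_divisorSections {D : WeilDivisor X} {f : X.functionField}
    (hf : f ∈ divisorSections D) (n : ℕ) : f ^ n ∈ divisorSections (n • D) := by
  induction n with
  | zero => simpa using one_mem_divisorSections
  | succ n ih =>
    rw [pow_succ, succ_nsmul]
    exact mul_mem_divisorSections ih hf

theorem prod_pow_mem_divisorSections {ι : Type*} (s : Finset ι) {D : ι → WeilDivisor X}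
    {f : ι → X.functionField} (hf : ∀ t, f t ∈ divisorSections (D t)) (d : ι → ℕ) :
    ∏ t ∈ s, f t ^ d t ∈ divisorSections (∑ t ∈ s, d t • D t) := by
  classical
  induction s using Finset.induction with
  | empty => simpa using one_mem_divisorSections
  | insert t s ht ih =>
    rw [Finset.prod_insert ht, Finset.sum_insert ht]
    exact mul_mem_divisorSections (pow_mem_divisorSections (hf t) (d t)) ih

theorem mem_divisorSections_of_ord_eq {D : WeilDivisor X} {f : X.functionField}
    (h : ∀ P : PrimeDivisor X, Scheme.ord f P.1 + D P = 0) : f ∈ divisorSections D :=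
  fun _ P => (h P).ge

theorem ord_inv {P : X} {f : X.functionField} (hf : f ≠ 0) :
    Scheme.ord f⁻¹ P = -Scheme.ord f P := by
  simpa using ord_zpow (P := P) hf (-1)

theorem exists_isDivisorOf_of_mem_closure {A : WeilDivisor X}
    (h : A ∈ AddSubgroup.closure {D : WeilDivisor X | ∃ f, IsDivisorOf D f}) :
    ∃ f, IsDivisorOf A f := by
  induction h using AddSubgroup.closure_induction with
  | mem D hD => exact hD
  | zero =>
    exact ⟨1, one_ne_zero, fun P => by
      simpa using (ord_pow (P := P.1) (one_ne_zero (α := X.functionField)) 0).symm⟩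
  | add D D' _ _ h h' =>
    obtain ⟨f, hf, hD⟩ := h
    obtain ⟨f', hf', hD'⟩ := h'
    exact ⟨f * f', mul_ne_zero hf hf', fun P => by
      rw [Scheme.ord_mul hf hf', ← hD, ← hD', Finsupp.add_apply]⟩
  | neg D _ h =>
    obtain ⟨f, hf, hD⟩ := h
    exact ⟨f⁻¹, inv_ne_zero hf, fun P => by rw [ord_inv hf, ← hD, Finsupp.neg_apply]⟩

/-- If the classes of the `D i` span `Cl(X) ⊗ ℚ`, then a positive multiple of any divisor is linearly
equivalent to an integral combination of the `D i`. -/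
theorem SpansRationalClassGroup.exists_ord_eq {r : ℕ} {D : Fin r → WeilDivisor X}
    (hD : SpansRationalClassGroup D) (A : WeilDivisor X) :
    ∃ (N : ℕ) (m : Fin r → ℤ) (f : X.functionField), 0 < N ∧ f ≠ 0 ∧
      ∀ P : PrimeDivisor X, Scheme.ord f P.1 + (∑ i, m i • D i + (N : ℤ) • A) P = 0 := by
  have key (x : ℚ ⊗[ℤ] WeilClassGroup X) (hx : x ∈ Submodule.span ℚ (Set.range fun i : Fin r =>
      ((1 : ℚ) ⊗ₜ[ℤ] (QuotientAddGroup.mk (D i) : WeilClassGroup X) : ℚ ⊗[ℤ] WeilClassGroup X))) :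
      ∃ (N : ℕ) (m : Fin r → ℤ), 0 < N ∧ (N : ℤ) • x = (1 : ℚ) ⊗ₜ[ℤ] ∑ i, m i •
        (QuotientAddGroup.mk (D i) : WeilClassGroup X) := by
    induction hx using Submodule.span_induction with
    | mem x hx =>
      obtain ⟨i, rfl⟩ := hx
      exact ⟨1, Pi.single i 1, one_pos, by simp [Pi.single_apply, ite_smul]⟩
    | zero => exact ⟨1, 0, one_pos, by simp⟩
    | add x y _ _ hx hy =>
      obtain ⟨N, m, hN, hx⟩ := hx
      obtain ⟨N', m', hN', hy⟩ := hy
      refine ⟨N * N', (N' : ℤ) • m + (N : ℤ) • m', Nat.mul_pos hN hN', ?_⟩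
      have e : ((N * N' : ℕ) : ℤ) • (x + y) = (N' : ℤ) • (N : ℤ) • x + (N : ℤ) • (N' : ℤ) • y := by
        simp only [smul_smul, smul_add]
        push_cast
        rw [mul_comm (N' : ℤ)]
      rw [e, hx, hy, ← TensorProduct.tmul_smul, ← TensorProduct.tmul_smul,
        ← TensorProduct.tmul_add]
      congr 1
      rw [Finset.smul_sum, Finset.smul_sum, ← Finset.sum_add_distrib]
      refine Finset.sum_congr rfl fun i _ => ?_
      rw [smul_smul, smul_smul]
      exact (add_zsmul _ _ _).symm
    | smul c x _ hx =>
      obtain ⟨N, m, hN, hx⟩ := hx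
      refine ⟨c.den * N, c.num • m, Nat.mul_pos c.den_pos hN, ?_⟩
      have e : ((c.den * N : ℕ) : ℤ) • c • x = c.num • (N : ℤ) • x := by
        rw [← Int.cast_smul_eq_zsmul ℚ, ← Int.cast_smul_eq_zsmul ℚ c.num,
          ← Int.cast_smul_eq_zsmul ℚ (N : ℤ), smul_smul, smul_smul]
        congr 1
        rw [← Rat.den_mul_eq_num c]
        push_cast
        ring
      rw [e, hx, ← TensorProduct.tmul_smul]
      congr 1
      rw [Finset.smul_sum]
      refine Finset.sum_congr rfl fun i _ => ?_
      rw [smul_smul]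
      rfl
  obtain ⟨N, m, hN, h⟩ := key ((1 : ℚ) ⊗ₜ[ℤ] (QuotientAddGroup.mk A : WeilClassGroup X))
    (by rw [show _ = ⊤ from hD]; trivial)
  set cl : WeilDivisor X →+ WeilClassGroup X := QuotientAddGroup.mk' _ with hcl
  have h0 : TensorProduct.mk ℤ ℚ (WeilClassGroup X) 1 (cl ((N : ℤ) • A - ∑ i, m i • D i)) = 0 := by
    rw [map_sub cl, map_zsmul cl, map_sum cl, map_sub, sub_eq_zero, map_zsmul]
    simp only [map_zsmul cl]
    exact h
  -- The kernel of `Cl(X) → Cl(X) ⊗ ℚ` is torsion, so a nonzero integer multiple of the difference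
  -- is a principal divisor.
  obtain ⟨⟨M, hM⟩, hMz⟩ := (IsLocalizedModule.eq_zero_iff (nonZeroDivisors ℤ)
    (TensorProduct.mk ℤ ℚ (WeilClassGroup X) 1)).1 h0
  have hM0 : M ≠ 0 := nonZeroDivisors.ne_zero hM
  have hMz : M • cl ((N : ℤ) • A - ∑ i, m i • D i) = 0 := hMz
  have hz : cl ((M.natAbs : ℤ) • ((N : ℤ) • A - ∑ i, m i • D i)) = 0 := by
    rw [map_zsmul cl]
    rcases Int.natAbs_eq M with h | h
    · rw [← h, hMz]
    · rw [show (M.natAbs : ℤ) = -M by omega, neg_smul, hMz, neg_zero]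
  obtain ⟨f, hf, hdiv⟩ := exists_isDivisorOf_of_mem_closure ((QuotientAddGroup.eq_zero_iff _).1 hz)
  refine ⟨M.natAbs * N, fun i => -(M.natAbs * m i), f⁻¹,
    Nat.mul_pos (Int.natAbs_pos.2 hM0) hN, inv_ne_zero hf, fun P => ?_⟩
  have e : ∑ i, -(M.natAbs * m i) • D i + ((M.natAbs * N : ℕ) : ℤ) • A =
      (M.natAbs : ℤ) • ((N : ℤ) • A - ∑ i, m i • D i) := by
    simp only [neg_smul, mul_smul, Finset.sum_neg_distrib, smul_sub, Finset.smul_sum, Nat.cast_mul]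
    abel
  rw [ord_inv hf, e, hdiv]
  omega

end Sections

/-! ### The main theorem -/

theorem theorem2 {k : Type u} [Field k] [IsAlgClosed k] [CharZero k]
    (s₁ s₂ s₃ : ℚ) (h₁₂ : s₁ < s₂) (h₂₃ : s₂ < s₃)
    (hw : 1 / (s₂ - s₁) + 1 / (s₃ - s₂) < 1)
    (n : ℕ) (hn : n = {z : ℤ | s₁ ≤ z ∧ (z : ℚ) ≤ s₂}.ncard)
    (hcol : {z : ℤ | ((n : ℚ) - 1) * s₂ ≤ z ∧ (z : ℚ) ≤ ((n : ℚ) - 1) * s₃}.ncard = n)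
    (hns : ¬ ∃ z : ℤ, (n : ℚ) * s₂ = z)
    {X : Scheme.{u}} [IsIntegral X] [IsLocallyNoetherian X]
    (π : X ⟶ toricSurface k s₁ s₂ s₃)
    (hπ : IsBlowup π (pointIdeal (torusIdentity k s₁ s₂ s₃))) :
    ¬ HasFinitelyGeneratedCoxRing (π ≫ toricSurfaceOver k s₁ s₂ s₃) := by
  let _ := functionFieldAlgebra (π ≫ toricSurfaceOver k s₁ s₂ s₃)
  rintro ⟨r, D, hD, hfg⟩
  obtain ⟨φ, H, E, c, e, hφ, hφk, hsec⟩ := exists_divisors h₁₂ h₂₃ π hπ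
  set w := 1 / (s₂ - s₁) + 1 / (s₃ - s₂) with hwdef
  have hw0 : 0 < w := add_pos (one_div_pos.2 (by linarith)) (one_div_pos.2 (by linarith))
  -- the generators, their degrees, and the rational functions that trivialize multiples of `H`, `E`
  obtain ⟨T, hTS, hT⟩ := exists_finset_adjoin_eq_of_fg hfg
  choose! μ f hf hfT using fun x (hx : x ∈ T) => hTS hx
  obtain ⟨N, mH, u, hN, hu0, hu⟩ := hD.exists_ord_eq (Finsupp.single H c)
  obtain ⟨N', mE, v, hN', hv0, hv⟩ := hD.exists_ord_eq (-Finsupp.single E e)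
  let Dm : (Fin r → ℤ) →+ WeilDivisor X :=
    { toFun := fun m => ∑ i, m i • D i
      map_zero' := by simp
      map_add' := fun m m' => by simp [add_smul, Finset.sum_add_distrib] }
  have hDm (m) : Dm m = ∑ i, m i • D i := rfl
  have hsH (a : ℤ) : Finsupp.single H (a * c) = a • Finsupp.single H c := by simp
  have hsE (a : ℤ) : Finsupp.single E (a * e) = a • Finsupp.single E e := by simp
  -- Exponents of monomials in the generators, `u` and `v`. In degree zero the `D i` cancel, leaving
  -- a section of `aH - bE`, in the normalization of `hsec`, with `a` and `b` the values of `A` and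
  -- `B`.
  let deg : (T → ℕ) × ℕ × ℕ →+ (Fin r → ℤ) :=
    { toFun := fun x => ∑ t, x.1 t • μ t + x.2.1 • mH + x.2.2 • mE
      map_zero' := by simp
      map_add' := fun x y => by
        simp only [Prod.fst_add, Prod.snd_add, Pi.add_apply, add_smul, Finset.sum_add_distrib]
        abel }
  let A : (T → ℕ) × ℕ × ℕ →+ ℤ :=
    { toFun := fun x => x.2.1 * N
      map_zero' := by simp
      map_add' := fun x y => by simp [add_mul] }
  let B : (T → ℕ) × ℕ × ℕ →+ ℤ :=
    { toFun := fun x => x.2.2 * N'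
      map_zero' := by simp
      map_add' := fun x y => by simp [add_mul] }
  let val (x : (T → ℕ) × ℕ × ℕ) : X.functionField := (∏ t : T, f t ^ x.1 t) * u ^ x.2.1 * v ^ x.2.2
  have hval (x y) : val (x + y) = val x * val y := by
    simp only [val, Prod.fst_add, Prod.snd_add, Pi.add_apply, pow_add, Finset.prod_mul_distrib]
    ring
  let good (x : (T → ℕ) × ℕ × ℕ) : Prop :=
    ∃ F, φ F = val x ∧ ¬ AddMonoidAlgebra.single (0, 1) 1 - 1 ∣ F
  -- Nonnegative integer solutions of a linear system: a finitely generated monoid by Gordan's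
  -- lemma.
  let Λ := AddMonoidHom.eqLocusM deg 0
  have hΛ : Λ.FG := AddSubmonoid.fg_eqLocusM deg 0
  have hmem (x) (hx : x ∈ Λ) : ∃ F, val x = φ F ∧
      (∀ v ∈ F.coeff.support, v ∈ trianglePoints s₁ s₂ s₃ (A x)) ∧
      VanishesToOrder (B x).toNat F := by
    rw [← hsec]
    have h1 := mul_mem_divisorSections (mul_mem_divisorSections
      (prod_pow_mem_divisorSections Finset.univ (fun t : T => hf t t.2) x.1)
      (pow_mem_divisorSections (mem_divisorSections_of_ord_eq hu) x.2.1))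
      (pow_mem_divisorSections (mem_divisorSections_of_ord_eq hv) x.2.2)
    have hx : deg x = 0 := hx
    have h2 : Dm (∑ t, x.1 t • μ t + x.2.1 • mH + x.2.2 • mE) = 0 :=
      (congrArg Dm hx).trans (map_zero Dm)
    rw [map_add, map_add, map_sum, map_nsmul, map_nsmul] at h2
    simp only [map_nsmul] at h2
    convert h1 using 2
    rw [hsH, hsE, show A x = x.2.1 * N from rfl, show B x = x.2.2 * N' from rfl]
    simp only [← hDm, smul_add, smul_neg, mul_smul, natCast_zsmul]
    refine (add_zero _).symm.trans ?_
    rw [← h2]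
    abel
  have hgood (x) (hx : x ∈ Λ) (y) (hy : y ∈ Λ) (hxy : good (x + y)) : good x ∧ good y := by
    obtain ⟨F, hF, -⟩ := hmem x hx
    obtain ⟨G, hG, -⟩ := hmem y hy
    obtain ⟨P, hP, hd⟩ := hxy
    obtain rfl : P = F * G := hφ (by rw [hP, hval, hF, hG, map_mul])
    exact ⟨⟨F, hF.symm, fun h => hd (h.mul_right G)⟩, ⟨G, hG.symm, fun h => hd (h.mul_left F)⟩⟩
  obtain ⟨δ, hδ, hslope⟩ := hΛ.exists_slope_le hgood A B w fun x hx ⟨F, hF, hd⟩ => by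
    obtain ⟨G, hG, hG1, hG2⟩ := hmem x hx
    obtain rfl : F = G := hφ (hF.trans hG)
    exact order_lt_of_not_dvd h₁₂ h₂₃ hw hn hcol hns hG1 hG2 hd
  have hNq : (0 : ℚ) < N := by exact_mod_cast hN
  have hNq' : (0 : ℚ) < N' := by exact_mod_cast hN'
  -- a section whose slope is closer to `w` than `δ`
  obtain ⟨i, j, hj, hij, hδij⟩ : ∃ i j : ℕ, 1 ≤ j * N' ∧ ((j * N' : ℕ) : ℚ) + 2 ≤ w * (i * N : ℕ) ∧
      (w - δ) * (i * N : ℕ) < (j * N' : ℕ) := by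
    -- The first summand ensures `j N' ≥ 1`. The second makes `δ i N` exceed the loss of at most `2
    -- + N'` in rounding `j N'` down from `w i N`.
    obtain ⟨i, hi⟩ := exists_nat_gt ((2 * N' + 2) / (w * N) + (2 + N') / (δ * N))
    have hi1 : (2 * N' + 2) / (w * N) < i := lt_of_le_of_lt (le_add_of_nonneg_right (by positivity)) hi
    have hi2 : (2 + N') / (δ * N) < i := lt_of_le_of_lt (le_add_of_nonneg_left (by positivity)) hi
    rw [div_lt_iff₀ (by positivity)] at hi1 hi2
    set j := ⌊(w * (i * N) - 2) / N'⌋₊ with hj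
    have hle : (j : ℚ) ≤ (w * (i * N) - 2) / N' := Nat.floor_le (by
      apply div_nonneg _ hNq'.le
      nlinarith)
    have hlt : (w * (i * N) - 2) / N' < j + 1 := Nat.lt_floor_add_one _
    rw [le_div_iff₀ hNq'] at hle
    rw [div_lt_iff₀ hNq'] at hlt
    refine ⟨i, j, ?_, by push_cast; linarith, by push_cast; nlinarith⟩
    have : (0 : ℚ) < j * N' := by nlinarith
    have : 0 < j * N' := by exact_mod_cast this
    omega
  obtain ⟨F, hF1, hF2, hF3⟩ := exists_section_columnSum_ne_zero (k := k) h₁₂ h₂₃ hw hj hij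
  have hFd : ¬ AddMonoidAlgebra.single (0, 1) 1 - 1 ∣ F := fun h => hF3 (y_sub_one_dvd_iff.1 h 0)
  have huv : (u ^ i * v ^ j) ≠ 0 := mul_ne_zero (pow_ne_zero _ hu0) (pow_ne_zero _ hv0)
  -- Dividing by `u^i v^j` moves the section from `aH - bE` to a combination of the `D i`, where the
  -- generators of the ring are available.
  have hsingle : AddMonoidAlgebra.single (-(i • mH + j • mE)) (φ F * (u ^ i * v ^ j)⁻¹) ∈
      multisectionRing k D := by
    refine Algebra.subset_adjoin ⟨_, _, fun h P => ?_, rfl⟩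
    have hφF := left_ne_zero_of_mul h
    have h1 := (hsec (i * N : ℕ) (j * N' : ℕ) (φ F)).2 ⟨F, rfl, hF1, hF2⟩ hφF P
    have h2 := hu P
    have h3 := hv P
    rw [Scheme.ord_mul hφF (inv_ne_zero huv), ord_inv huv,
      Scheme.ord_mul (pow_ne_zero _ hu0) (pow_ne_zero _ hv0), ord_pow hu0, ord_pow hv0]
    rw [← hDm] at h2 h3 ⊢
    rw [map_neg, map_add, map_nsmul, map_nsmul]
    rw [hsH, hsE] at h1
    simp only [Finsupp.add_apply, Finsupp.sub_apply, Finsupp.neg_apply, Finsupp.smul_apply,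
      smul_eq_mul, nsmul_eq_mul] at h1 h2 h3 ⊢
    push_cast at h1
    linear_combination h1 + (i : ℤ) * h2 + (j : ℤ) * h3
  have hrange : Algebra.adjoin k (Set.range fun t : T => AddMonoidAlgebra.single (μ t) (f t)) =
      multisectionRing k D := by
    rw [multisectionRing, ← hT]
    congr 1
    ext x
    constructor
    · rintro ⟨t, rfl⟩
      exact (congrArg (· ∈ (T : Set _)) (hfT t t.2)).mp t.2
    · exact fun hx => ⟨⟨x, hx⟩, (hfT x hx).symm⟩
  rw [← hrange] at hsingle
  obtain ⟨I, a, hI, hsum⟩ := exists_eq_sum_of_single_mem_adjoin _ _ hsingle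
  have hIΛ (d) (hd : d ∈ I) : ((⇑d, i, j) : (T → ℕ) × ℕ × ℕ) ∈ Λ := by
    change ∑ t, d t • μ t + i • mH + j • mE = 0
    rw [hI d hd]
    abel
  choose! G hG using fun d hd => hmem _ (hIΛ d hd)
  have hFG : F = ∑ d ∈ I, algebraMap k _ (a d) * G d := by
    apply hφ
    rw [map_sum]
    rw [← div_eq_mul_inv, div_eq_iff huv, Finset.sum_mul] at hsum
    rw [hsum]
    refine Finset.sum_congr rfl fun d hd => ?_
    rw [map_mul, ← (hG d hd).1, hφk]
    simp only [val]
    ring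
  -- If `y - 1` divided every term, it would divide `F`. The surviving term has the same `A` and `B`
  -- as `F`, which violates the slope bound `w - δ`.
  obtain ⟨d, hd, hGd⟩ : ∃ d ∈ I, ¬ AddMonoidAlgebra.single (0, 1) 1 - 1 ∣ G d := by
    by_contra! h
    rw [hFG] at hFd
    exact hFd (Finset.dvd_sum fun d hd => (h d hd).mul_left _)
  have := hslope _ (hIΛ d hd) ⟨G d, (hG d hd).1.symm, hGd⟩
  change (((j * N' : ℤ)) : ℚ) ≤ (w - δ) * ((i * N : ℤ) : ℚ) at this
  push_cast at this hδij
  linarith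

end
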